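/- Let $\Phi$ be a (reduced, crystallographic) irreducible finite root system of type $A_n$ ($n\ge 1$), $D_n$ ($n\ge 4$), $E_6$, $E_7$ or $E_8$, of rank $n$, with Coxeter number $h$ (the order of a Coxeter element of its Weyl group), and let $\zeta=e^{2\pi\sqrt{-1}/(h+2)}$. Choose simple roots $\alpha_1,\dots,\alpha_n$ of $\Phi$, in any order, with Cartan matrix $A=(a_{ij})$, $a_{ij}=\langle\alpha_j,\alpha_i^\vee\rangle$, and let $B_A=(b_{ij})$ be the skew-symmetric matrix with $b_{ij}=a_{ij}$ for $i<j$ and $b_{ij}=-a_{ij}$ for $i>j$. Consider the cluster-Poisson seed pattern $\{((y_{t;1},\dots,y_{t;n}),B_t)\}_t$ (trivial coefficients) indexed by the vertices $t$ of the $n$-regular tree with edges labeled by $1,\dots,n$, with $B_{t_0}=B_A$ at the base vertex $t_0$. Along an edge labeled $k$ the $y$-variables transform by $y_k'=y_k^{-1}$ and $y_i'=y_i\,y_k^{\max(b_{ki},0)}(1+y_k)^{-b_{ki}}$ for $i\ne k$, and the matrices by matrix mutation. Let $\mathcal X_{>0}$ be the set of positive real points of the corresponding cluster variety $\mathcal X$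 (the points at which all $y$-variables take positive values), on which each $(y_{t;1},\dots,y_{t;n})$ is a global coordinate system with image $(\mathbb R_{>0})^n$. Let $t_0[1]$ be the end of the path with successive labels $1,2,\dots,n$ starting at $t_0$. Then $(t_0,t_0[1],\mathrm{id})$ is a reddening triple: mutating the matrix $B_A$ stacked on the identity matrix $I_n$ along this path gives $B_A$ stacked on $-I_n$. Let $\mathrm{DT}_{\mathcal X}:\mathcal X_{>0}\to\mathcal X_{>0}$ be the resulting Donaldson–Thomas transformation, i.e. $y_{t;i}(\mathrm{DT}_{\mathcal X}(p))=y_{t[1];i}(p)$ for all $t$ and $i$, where $t[1]$ is reached from $t_0[1]$ by the path whose labels are those of the path from $t_0$ to $t$. Then $\mathrm{DT}_{\mathcal X}$ has a unique fixed point $\mathbf b\in\mathcal X_{>0}$, and its linearization $\mathrm{dt}_{\mathcal X}=d_{\mathbf b}\mathrm{DT}_{\mathcal X}$ on $T_{\mathbf b}(\mathcal X_{>0})$ (computed in any of the coordinate systems $y_t$) satisfies Mizuno's conjectural formula for the exponents of the $Y$-system of type $\Phi$ and level $\ell=2$: $$\left(\frac{x^{h+2}-1}{x-1}\right)^n=\det\left(x-\mathrm{dt}_{\mathcal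 X}\right)\prod_{\beta\in\Phi}\left(x-\zeta^{\mathrm{ht}(\beta)}\right),$$ where $\mathrm{ht}:\Phi\to\mathbb Z$ is the height function with respect to any choice of simple roots of $\Phi$. -/

import Mathlib

/-! Cluster-Poisson (`𝕏`-) patterns with trivial coefficients, their positive points, reddening
triples and Donaldson-Thomas transformations, and root systems of type `ADE`.

A vertex `t` of the `n`-regular tree is addressed by the list of edge labels of a path from the
base vertex `t₀` to `t` (so `[]` is `t₀`). Paths with backtracking are allowed. This is harmless,
because mutation at `k` is an involution. -/

namespace ClusterX

section Mutation

variable {I : Type*} [DecidableEq I]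

/-- Mutation of the exchange matrix in direction `k`. -/
def mutateB (B : Matrix I I ℤ) (k : I) : Matrix I I ℤ :=
  Matrix.of fun i j =>
    if i = k ∨ j = k then -B i j
    else B i j + max 0 (B i k) * max 0 (B k j) - max 0 (-B i k) * max 0 (-B k j)

/-- Mutation in direction `k` of the frozen rows `C` of an extended exchange matrix whose
principal part is `B`. -/
def mutateC (B C : Matrix I I ℤ) (k : I) : Matrix I I ℤ :=
  Matrix.of fun i j =>
    if j = k then -C i j
    else C i j + max 0 (C i k) * max 0 (B k j) - max 0 (-C i k) * max 0 (-B k j)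

/-- Mutation of the (values of the) `y`-variables in direction `k`. -/
noncomputable def mutateY (B : Matrix I I ℤ) (k : I) (y : I → ℝ) : I → ℝ := fun i =>
  if i = k then (y k)⁻¹ else y i * y k ^ max 0 (B k i) * (1 + y k) ^ (-B k i)

/-- The matrix `B_t` of the matrix pattern with `B_{t₀} = B`. -/
def matrixAt (B : Matrix I I ℤ) (t : List I) : Matrix I I ℤ :=
  t.foldl mutateB B

/-- The matrix `C_t` of the extended matrix pattern whose value at `t₀` is `B` stacked on the
identity matrix. -/
def cMatrixAt (B : Matrix I I ℤ) (t : List I) : Matrix I I ℤ :=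
  (t.foldl (fun s k => (mutateB s.1 k, mutateC s.1 s.2 k)) (B, (1 : Matrix I I ℤ))).2

/-- A positive point of the `𝕏`-cluster variety of the pattern with `B_{t₀} = B`: the values
`coord t i > 0` of all `y`-variables `y_{t;i}`, related by the mutation rule along every edge. -/
@[ext]
structure PositivePoint (B : Matrix I I ℤ) where
  /-- `coord t i` is the value of the `y`-variable `y_{t;i}` at the point. -/
  coord : List I → I → ℝ
  pos : ∀ t i, 0 < coord t i
  coord_append : ∀ t k, coord (t ++ [k]) = mutateY (matrixAt B t) k (coord t)

/-- `(t₀, t₁, σ)` is a reddening triple, where `t₁ = t₀[1]`: with `S` the matrix whose `j`-th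
column is the standard basis vector `e_{σ j}`, one has `B_{t₁} = S B S⁻¹` and `C_{t₁} = -S⁻¹`. -/
structure IsReddeningTriple (B : Matrix I I ℤ) (t₁ : List I) (σ : Equiv.Perm I) : Prop where
  matrixAt_eq : matrixAt B t₁ = B.submatrix σ.symm σ.symm
  cMatrixAt_eq : cMatrixAt B t₁ = -(1 : Matrix I I ℤ).submatrix σ id

theorem matrixAt_append (B : Matrix I I ℤ) (t : List I) (k : I) :
    matrixAt B (t ++ [k]) = mutateB (matrixAt B t) k := by
  simp [matrixAt]

theorem matrixAt_shift {B : Matrix I I ℤ} {t₁ : List I} {σ : Equiv.Perm I}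
    (hB : matrixAt B t₁ = B.submatrix σ.symm σ.symm) (t : List I) (i j : I) :
    matrixAt B (t₁ ++ t.map σ) (σ i) (σ j) = matrixAt B t i j := by
  induction t using List.reverseRecOn generalizing i j with
  | nil =>
    rw [List.map_nil, List.append_nil, hB]
    simp [matrixAt]
  | append_singleton t k ih =>
    rw [List.map_append, ← List.append_assoc, List.map_singleton, matrixAt_append,
      matrixAt_append]
    simp [mutateB, ih]

/-- The Donaldson-Thomas transformation on positive points given by a reddening triple
`(t₀, t₁, σ)`: `y_t (DT p) = (y_{t[1];σ 1} (p), …, y_{t[1];σ n} (p))` for every vertex `t`, where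
`t[1]` is reached from `t₁` by the path from `t₀` to `t` with its labels permuted by `σ`. -/
def DTX {B : Matrix I I ℤ} {t₁ : List I} {σ : Equiv.Perm I} (h : IsReddeningTriple B t₁ σ)
    (p : PositivePoint B) : PositivePoint B where
  coord t i := p.coord (t₁ ++ t.map σ) (σ i)
  pos t i := p.pos _ _
  coord_append t k := by
    funext i
    have hk := matrixAt_shift h.matrixAt_eq t k i
    rw [List.map_append, ← List.append_assoc, List.map_singleton, p.coord_append]
    simp [mutateY, hk]

/-- `L` is the linearization at the point `p` of the self-map `F` of the manifold of positive
points, written in the global coordinates `y_t`: `L` is the derivative at `y_t(p)` of the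
coordinate expression of `F`. (The coordinates `y_t` map the positive points bijectively
onto the open positive orthant, so that `L` is unique.) -/
def IsLinearizationAt [Fintype I] {B : Matrix I I ℤ} (F : PositivePoint B → PositivePoint B)
    (p : PositivePoint B) (t : List I) (L : (I → ℝ) →L[ℝ] (I → ℝ)) : Prop :=
  ∃ G : (I → ℝ) → (I → ℝ),
    (∀ q : PositivePoint B, G (q.coord t) = (F q).coord t) ∧ HasFDerivAt G L (p.coord t)

end Mutation

/-- A Cartan matrix is of type `ADE` if, up to a simultaneous relabeling of rows and columns, it
is the Cartan matrix of type `A_m` (`m ≥ 1`), `D_m` (`m ≥ 4`), `E₆`, `E₇` or `E₈`. -/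
def IsTypeADE {κ : Type*} (A : Matrix κ κ ℤ) : Prop :=
  (∃ m, 1 ≤ m ∧ ∃ f : κ ≃ Fin m, A.reindex f f = CartanMatrix.A m) ∨
  (∃ m, 4 ≤ m ∧ ∃ f : κ ≃ Fin m, A.reindex f f = CartanMatrix.D m) ∨
  (∃ f : κ ≃ Fin 6, A.reindex f f = CartanMatrix.E₆) ∨
  (∃ f : κ ≃ Fin 7, A.reindex f f = CartanMatrix.E₇) ∨
  (∃ f : κ ≃ Fin 8, A.reindex f f = CartanMatrix.E₈)

section RootSystem

variable {ι M N : Type*} [AddCommGroup M] [Module ℝ M] [AddCommGroup N] [Module ℝ N]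
  {P : RootPairing ι ℝ M N}

/-- The Coxeter number: the order of the Coxeter element `s₁ s₂ ⋯ s_n`, where the simple roots
are numbered by `e`. -/
noncomputable def coxeterNumber (b : P.Base) {n : ℕ} (e : Fin n ≃ b.support) : ℕ :=
  orderOf (List.ofFn fun k : Fin n => P.reflection (e k)).prod

/-- The mutation matrix `B_A`, where `A = (a_{ij})`, `a_{ij} = ⟨α_j, α_i^∨⟩`, is the Cartan matrix
of the simple roots numbered by `e` (Mathlib's Cartan matrix has the transposed convention):
`b_{ij}` is `a_{ij}` above the diagonal, `-a_{ij}` below it, and `0` on it. -/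
noncomputable def initialMatrix [P.IsCrystallographic] (b : P.Base) {n : ℕ} (e : Fin n ≃ b.support) :
    Matrix (Fin n) (Fin n) ℤ :=
  Matrix.of fun i j =>
    if i = j then 0
    else if j < i then -b.cartanMatrix (e j) (e i)
    else b.cartanMatrix (e j) (e i)

end RootSystem

end ClusterX

/-!
Along the path `1, …, n` every vertex is, at the time of its mutation, a sink of the (acyclic) quiver
of the exchange matrix. Mutation there only changes signs, which gives the reddening triple
(`isReddeningTriple_skewMatrix`), and the Donaldson–Thomas transformation becomes explicit: if `z k`
is the value of the variable `y_k` just before the mutation at `k`, then the variables at both ends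
of the path are products of powers of the `z k` and the `1 + z k` (`stageLog`,
`mutateWord_finRange`). A point is fixed if and only if `z k ^ 2 = ∏ (1 + z j)`, the product running
over the neighbors `j` of `k` in the Dynkin diagram (`stageLog_eq_iff`). In the variables `log (z k)`
this equation has at most one solution, because `t ↦ log (1 + exp t)` is `1`-Lipschitz and the Cartan
matrix is positive definite (`fixedPoint_unique`).

The derivative at the fixed point is `J₁ * J₀⁻¹` up to conjugation, where `J₀` and `J₁` are the
triangular Jacobians of the logarithms of the variables at the two ends of the path with respect to
the `log (z k)`, both with constant diagonal `1` or `-1`. Its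
characteristic polynomial is therefore the determinant of a matrix supported on the Dynkin diagram,
with diagonal entries `x + 1` and with products of opposite entries `x * w i * w j` along the edges,
where `w = z / (1 + z)` (`eval_charpoly_fderiv`). It does not depend on the coordinate system, as
coordinate changes conjugate the derivative (`exists_isLinearizationAt`). With all weights `w` equal
to `1`, the same determinant is the characteristic polynomial of a Coxeter element, and this
determines the Coxeter number `h` (`coxeterNumber_eq`). Dynkin diagrams are trees, so that these
determinants depend only on the data above, and not on the numbering of the simple roots.

For each type there is an explicit fixed point: quotients of sines in type `A`, the integers
`(i + 1) * (i + 3)` along the chain in type `D`, and elements of `ℚ(cos (2π / 7))`, `ℚ(√5)` and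
`ℚ(√2)` in the types `E₆`, `E₇` and `E₈`. Expanding at the leaves of the diagram (`det_leaf`) gives
three-term recursions, which are solved in closed form for chains (`chainDet_mul`) and evaluated
step by step for the diagrams of type `E` (`branchDet`). The result is that the characteristic
polynomial of the linearization is `∏ (x - ζ ^ (m + 1))` over the exponents `m`.

On the other side, the positive roots are listed in an explicit model of each root system
(`prod_height_of_vectors`), which shows that their heights are the numbers `1, …, m` for all
exponents `m` together. The multiset of heights is the same for every base, since all bases are
conjugate under the Weyl group (`exists_height_eq`). As the exponents are stable under `m ↦ h - m`
and `ζ ^ (h + 2) = 1`, the heights `-k` with `1 ≤ k ≤ h - m` contribute the factors with the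
exponents `m + 2, …, h + 1`. Together with the heights `1, …, m` and the factor `x - ζ ^ (m + 1)` of
the characteristic polynomial, they make up all `(h + 2)`-th roots of unity other than `1`, once for
each of the `n` exponents (`prod_exponents_mul`, `mizuno_of_diagramData`).
-/

namespace ClusterX

/-! ### Mutation along words and positive points -/

section Words

variable {I : Type*} [DecidableEq I]

/-- The values of the `y`-variables obtained from the seed `(B, y)` by mutating along the word
`w`. -/
noncomputable def mutateWord (B : Matrix I I ℤ) (y : I → ℝ) (w : List I) : I → ℝ :=
  (w.foldl (fun s k => (mutateB s.1 k, mutateY s.1 k s.2)) (B, y)).2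

@[simp] theorem mutateWord_nil (B : Matrix I I ℤ) (y : I → ℝ) : mutateWord B y [] = y := rfl

theorem mutateWord_cons (B : Matrix I I ℤ) (y : I → ℝ) (k : I) (w : List I) :
    mutateWord B y (k :: w) = mutateWord (mutateB B k) (mutateY B k y) w := rfl

theorem mutateWord_append (B : Matrix I I ℤ) (y : I → ℝ) (w w' : List I) :
    mutateWord B y (w ++ w') = mutateWord (matrixAt B w) (mutateWord B y w) w' := by
  induction w generalizing B y with
  | nil => rfl
  | cons k w ih => rw [List.cons_append, mutateWord_cons, mutateWord_cons, ih]; rfl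

theorem mutateWord_concat (B : Matrix I I ℤ) (y : I → ℝ) (w : List I) (k : I) :
    mutateWord B y (w ++ [k]) = mutateY (matrixAt B w) k (mutateWord B y w) := by
  rw [mutateWord_append]; rfl

theorem matrixAt_append_append (B : Matrix I I ℤ) (w w' : List I) :
    matrixAt B (w ++ w') = matrixAt (matrixAt B w) w' := by
  simp [matrixAt]

theorem mutateY_pos {B : Matrix I I ℤ} {k : I} {y : I → ℝ} (hy : ∀ i, 0 < y i) (i : I) :
    0 < mutateY B k y i := by
  have := hy k
  have := hy i
  unfold mutateY
  split_ifs <;> positivity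

theorem mutateWord_pos {B : Matrix I I ℤ} {y : I → ℝ} (hy : ∀ i, 0 < y i) (w : List I) (i : I) :
    0 < mutateWord B y w i := by
  induction w generalizing B y with
  | nil => exact hy i
  | cons k w ih => exact ih (mutateY_pos hy)

theorem mutateB_mutateB (B : Matrix I I ℤ) (k : I) : mutateB (mutateB B k) k = B := by
  ext i j
  by_cases h : i = k ∨ j = k
  · simp [mutateB, h]
  · simp [mutateB, h]

theorem mutateY_mutateY (B : Matrix I I ℤ) (k : I) {y : I → ℝ} (hy : ∀ i, 0 < y i) :
    mutateY (mutateB B k) k (mutateY B k y) = y := by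
  funext i
  by_cases h : i = k
  · simp [mutateY, h]
  · have h1 : 0 < y k := hy k
    have h2 : (0 : ℝ) < 1 + y k := by positivity
    have h3 : 1 + (y k)⁻¹ = (1 + y k) * (y k)⁻¹ := by field_simp; ring
    have h4 : mutateB B k k i = -B k i := by simp [mutateB]
    simp only [mutateY, h, if_false, if_true, h4, h3, neg_neg, mul_zpow, inv_zpow', zpow_neg]
    have h5 : max 0 (B k i) = max 0 (-B k i) + B k i := by
      rcases le_total 0 (B k i) with h | h
      · rw [max_eq_right h, max_eq_left (by omega)]; ring
      · rw [max_eq_left h, max_eq_right (by omega)]; ring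
    rw [h5, zpow_add₀ h1.ne']
    have := (zpow_pos h1 (B k i)).ne'
    have := (zpow_pos h1 (max 0 (-B k i))).ne'
    have := (zpow_pos h2 (B k i)).ne'
    field_simp

theorem matrixAt_reverse (B : Matrix I I ℤ) (w : List I) :
    matrixAt (matrixAt B w) w.reverse = B := by
  induction w generalizing B with
  | nil => rfl
  | cons k w ih =>
    rw [List.reverse_cons, matrixAt_append]
    have : matrixAt B (k :: w) = matrixAt (mutateB B k) w := rfl
    rw [this, ih, mutateB_mutateB]

theorem mutateWord_reverse (B : Matrix I I ℤ) (w : List I) {y : I → ℝ} (hy : ∀ i, 0 < y i) :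
    mutateWord (matrixAt B w) (mutateWord B y w) w.reverse = y := by
  induction w generalizing B y with
  | nil => rfl
  | cons k w ih =>
    rw [List.reverse_cons, mutateWord_concat, mutateWord_cons]
    have : matrixAt B (k :: w) = matrixAt (mutateB B k) w := rfl
    rw [this, ih _ (mutateY_pos hy), matrixAt_reverse, mutateY_mutateY B k hy]

namespace PositivePoint

variable {B : Matrix I I ℤ}

theorem coord_add (p : PositivePoint B) (t w : List I) :
    p.coord (t ++ w) = mutateWord (matrixAt B t) (p.coord t) w := by
  induction w using List.reverseRecOn with
  | nil => simp
  | append_singleton w k ih =>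
    rw [← List.append_assoc, p.coord_append, ih, mutateWord_concat, matrixAt_append_append]

theorem coord_eq (p : PositivePoint B) (t : List I) :
    p.coord t = mutateWord B (p.coord []) t :=
  p.coord_add [] t

theorem ext_nil {p q : PositivePoint B} (h : p.coord [] = q.coord []) : p = q := by
  ext1
  funext t
  rw [p.coord_eq, q.coord_eq, h]

/-- The positive point with prescribed coordinates at the base vertex. -/
noncomputable def ofCoord (B : Matrix I I ℤ) (y : I → ℝ) (hy : ∀ i, 0 < y i) :
    PositivePoint B where
  coord := mutateWord B y
  pos t i := mutateWord_pos hy t i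
  coord_append t k := mutateWord_concat B y t k

end PositivePoint

/-- A point is determined by its coordinates at the base vertex, so that fixed points can be
recognized there. -/
theorem DTX_eq_self_iff {B : Matrix I I ℤ} {t₁ : List I} (h : IsReddeningTriple B t₁ 1)
    (p : PositivePoint B) :
    DTX h p = p ↔ mutateWord B (p.coord []) t₁ = p.coord [] := by
  have h0 : (DTX h p).coord [] = mutateWord B (p.coord []) t₁ := by
    funext i
    simp [DTX, p.coord_eq t₁]
  refine ⟨fun hp => ?_, fun hp => PositivePoint.ext_nil (h0.trans hp)⟩
  rw [← h0, hp]

end Words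

/-! ### Linearization in different coordinate systems -/

section Linearization

variable {I : Type*} [DecidableEq I] [Fintype I]

theorem differentiableAt_mutateY (B : Matrix I I ℤ) (k : I) {y : I → ℝ} (hy : ∀ i, 0 < y i) :
    DifferentiableAt ℝ (mutateY B k) y := by
  have h1 : y k ≠ 0 := (hy k).ne'
  have h2 : 1 + y k ≠ 0 := by have := hy k; positivity
  rw [differentiableAt_pi]
  intro i
  have hd (j : I) : DifferentiableAt ℝ (fun y : I → ℝ => y j) y := differentiableAt_apply j y
  by_cases h : i = k
  · simp only [mutateY, h, if_true]
    exact (hd k).inv h1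
  · simp only [mutateY, h, if_false]
    exact ((hd i).mul ((hd k).zpow (Or.inl h1))).mul
      (((differentiableAt_const _).add (hd k)).zpow (Or.inl h2))

theorem differentiableAt_mutateWord (B : Matrix I I ℤ) (w : List I) {y : I → ℝ}
    (hy : ∀ i, 0 < y i) : DifferentiableAt ℝ (fun y => mutateWord B y w) y := by
  induction w generalizing B y with
  | nil => exact differentiableAt_id
  | cons k w ih =>
    have h1 := ih (mutateB B k) (mutateY_pos (B := B) (k := k) hy)
    exact h1.comp y (differentiableAt_mutateY B k hy)

theorem charpoly_mul_comm_end (f g : (I → ℝ) →ₗ[ℝ] (I → ℝ)) :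
    (f * g).charpoly = (g * f).charpoly := by
  rw [← LinearMap.charpoly_toMatrix (f * g) (Pi.basisFun ℝ I),
    ← LinearMap.charpoly_toMatrix (g * f) (Pi.basisFun ℝ I), LinearMap.toMatrix_mul,
    LinearMap.toMatrix_mul, Matrix.charpoly_mul_comm]

theorem eventually_pos {I : Type*} [Fintype I] {y : I → ℝ} (hy : ∀ i, 0 < y i) :
    ∀ᶠ x in nhds y, ∀ i, 0 < x i := by
  rw [Filter.eventually_all]
  exact fun i => (continuous_apply i).continuousAt.eventually (lt_mem_nhds (hy i))

/-- The characteristic polynomial of the linearization of the DT transformation does not depend on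
the coordinate system: two coordinate expressions are conjugate under the derivative of the
coordinate change. -/
theorem exists_isLinearizationAt {B : Matrix I I ℤ} {t₁ : List I} (h : IsReddeningTriple B t₁ 1)
    {p : PositivePoint B} (hp : DTX h p = p) (t : List I) :
    ∃ L : (I → ℝ) →L[ℝ] (I → ℝ), IsLinearizationAt (DTX h) p t L ∧
      LinearMap.charpoly (L : (I → ℝ) →ₗ[ℝ] (I → ℝ)) =
      LinearMap.charpoly
        (fderiv ℝ (fun y => mutateWord B y t₁) (p.coord []) : (I → ℝ) →ₗ[ℝ] (I → ℝ)) := by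
  have hB : matrixAt B t₁ = B := by
    rw [h.matrixAt_eq]; rfl
  have hpos := p.pos
  set y₀ := p.coord [] with hy₀
  have hfix : mutateWord B y₀ t₁ = y₀ := (DTX_eq_self_iff h p).1 hp
  have hyt : p.coord t = mutateWord B y₀ t := p.coord_eq t
  set R' := fderiv ℝ (fun y => mutateWord (matrixAt B t) y t.reverse) (p.coord t)
  set R := fderiv ℝ (fun y => mutateWord B y t) y₀
  set L₀ := fderiv ℝ (fun y => mutateWord B y t₁) y₀
  have hR' : HasFDerivAt (fun y => mutateWord (matrixAt B t) y t.reverse) R' (p.coord t) :=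
    (differentiableAt_mutateWord _ _ (hpos t)).hasFDerivAt
  have hR : HasFDerivAt (fun y => mutateWord B y t) R y₀ :=
    (differentiableAt_mutateWord _ _ (hpos [])).hasFDerivAt
  have hL₀ : HasFDerivAt (fun y => mutateWord B y t₁) L₀ y₀ :=
    (differentiableAt_mutateWord _ _ (hpos [])).hasFDerivAt
  have hback : mutateWord (matrixAt B t) (p.coord t) t.reverse = y₀ := by
    rw [hyt, mutateWord_reverse B t (hpos [])]
  -- `R'` is the derivative of the inverse coordinate change
  have hRR : R'.comp R = ContinuousLinearMap.id ℝ _ := by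
    have h1 : HasFDerivAt (fun y => mutateWord (matrixAt B t) (mutateWord B y t) t.reverse)
        (R'.comp R) y₀ := by
      refine HasFDerivAt.comp (g := fun y => mutateWord (matrixAt B t) y t.reverse) y₀ ?_ hR
      rw [← hyt]; exact hR'
    have h2 : HasFDerivAt (fun y => mutateWord (matrixAt B t) (mutateWord B y t) t.reverse)
        (ContinuousLinearMap.id ℝ _) y₀ := by
      refine (hasFDerivAt_id y₀).congr_of_eventuallyEq ?_
      filter_upwards [eventually_pos (hpos [])] with y hy
      exact mutateWord_reverse B t hy
    exact h1.unique h2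
  refine ⟨(R.comp L₀).comp R', ⟨fun y => mutateWord B (mutateWord B (mutateWord (matrixAt B t) y
    t.reverse) t₁) t, fun q => ?_, ?_⟩, ?_⟩
  · have : mutateWord (matrixAt B t) (q.coord t) t.reverse = q.coord [] := by
      rw [q.coord_eq t, mutateWord_reverse B t (q.pos [])]
    dsimp only
    rw [this]
    funext i
    have : (DTX h q).coord t i = q.coord (t₁ ++ t) i := by simp [DTX]
    rw [this, q.coord_eq (t₁ ++ t), mutateWord_append, hB]
  · refine HasFDerivAt.comp (g := fun y => mutateWord B (mutateWord B y t₁) t) (p.coord t) ?_ hR'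
    rw [hback]
    refine HasFDerivAt.comp (g := fun y => mutateWord B y t) y₀ ?_ hL₀
    rw [hfix]; exact hR
  · have hm : (R' : (I → ℝ) →ₗ[ℝ] (I → ℝ)) * (R : (I → ℝ) →ₗ[ℝ] (I → ℝ)) = 1 := by
      exact congrArg ContinuousLinearMap.toLinearMap hRR
    have : (((R.comp L₀).comp R' : (I → ℝ) →L[ℝ] (I → ℝ)) : (I → ℝ) →ₗ[ℝ] (I → ℝ)) =
        ((R : (I → ℝ) →ₗ[ℝ] (I → ℝ)) * (L₀ : (I → ℝ) →ₗ[ℝ] (I → ℝ))) * R' := rfl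
    rw [this, charpoly_mul_comm_end, ← mul_assoc, hm, one_mul]

end Linearization

/-! ### Mutation of an acyclic seed at successive sinks -/

section Acyclic

variable {n : ℕ} (A : Matrix (Fin n) (Fin n) ℤ)

/-- The skew-symmetric matrix with upper triangle that of `A` and lower triangle that of `-A`. -/
def skewMatrix : Matrix (Fin n) (Fin n) ℤ :=
  Matrix.of fun i j => if i = j then 0 else if j < i then -A i j else A i j

/-- The exchange matrix after mutating the skew matrix at `0, …, m - 1`: the sign of an entry has
been changed once for each of its two indices which is less than `m`. -/
def stageB (m : ℕ) : Matrix (Fin n) (Fin n) ℤ :=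
  Matrix.of fun i j =>
    (if i.1 < m then -1 else 1) * (if j.1 < m then -1 else 1) * skewMatrix A i j

/-- The `C`-matrix after mutating at `0, …, m - 1`. -/
def stageC (n m : ℕ) : Matrix (Fin n) (Fin n) ℤ :=
  Matrix.diagonal fun i => if i.1 < m then -1 else 1

/-- The logarithms of the `y`-variables after mutating at `0, …, m - 1`, in terms of the logarithms
`s k` of the values `z k` that the variables `y_k` have just before the mutation at `k`. -/
noncomputable def stageLog (m : ℕ) (s : Fin n → ℝ) : Fin n → ℝ := fun i =>
  if i.1 < m then
    -s i + ∑ j, if i < j ∧ j.1 < m then -(A j i : ℝ) * Real.log (1 + Real.exp (s j)) else 0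
  else
    s i + ∑ j, if m ≤ j.1 ∧ j < i then (A j i : ℝ) * Real.log (1 + Real.exp (s j)) else 0

variable {A}

theorem stageB_apply_nonpos (hA : ∀ i j, i ≠ j → A i j ≤ 0) (k j : Fin n) :
    stageB A k.1 k j ≤ 0 := by
  by_cases h : k = j
  · simp [stageB, skewMatrix, h]
  · have := hA k j h
    simp only [Fin.ext_iff] at h
    simp only [stageB, skewMatrix, Matrix.of_apply, Fin.lt_def, Fin.ext_iff]
    split_ifs <;> omega

theorem stageB_apply_of_ne (k j : Fin n) (h : j ≠ k) :
    stageB A k.1 k j = A k j := by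
  simp only [ne_eq, Fin.ext_iff] at h
  simp only [stageB, skewMatrix, Matrix.of_apply, Fin.lt_def, Fin.ext_iff]
  split_ifs <;> omega

theorem stageB_antisymm (hs : ∀ i j, A i j = A j i) (m : ℕ) (i j : Fin n) :
    stageB A m i j = -stageB A m j i := by
  have := hs i j
  simp only [stageB, skewMatrix, Matrix.of_apply, Fin.lt_def, Fin.ext_iff]
  split_ifs <;> omega

theorem mutateB_stageB (hs : ∀ i j, A i j = A j i) (hA : ∀ i j, i ≠ j → A i j ≤ 0) (k : Fin n) :
    mutateB (stageB A k.1) k = stageB A (k.1 + 1) := by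
  ext i j
  have hk1 := stageB_apply_nonpos hA k j
  have hk2 : 0 ≤ stageB A k.1 i k := by
    rw [stageB_antisymm hs]; linarith [stageB_apply_nonpos hA k i]
  have h1 : max 0 (stageB A k.1 k j) = 0 := max_eq_left hk1
  have h2 : max 0 (-stageB A k.1 i k) = 0 := max_eq_left (by omega)
  simp only [mutateB, Matrix.of_apply, h1, h2, mul_zero, zero_mul, add_zero, sub_zero]
  by_cases hij : i = j
  · simp [stageB, skewMatrix, hij]
  · simp only [Fin.ext_iff] at hij
    simp only [stageB, Matrix.of_apply, Fin.ext_iff]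
    split_ifs <;> omega

theorem mutateC_stageC (hA : ∀ i j, i ≠ j → A i j ≤ 0) (k : Fin n) :
    mutateC (stageB A k.1) (stageC n k.1) k = stageC n (k.1 + 1) := by
  ext i j
  have h1 : max 0 (stageB A k.1 k j) = 0 := max_eq_left (stageB_apply_nonpos hA k j)
  have h2 : max 0 (-stageC n k.1 i k) = 0 := by
    refine max_eq_left ?_
    by_cases h : i = k <;> simp [stageC, h]
  simp only [mutateC, Matrix.of_apply, h1, h2, mul_zero, zero_mul, add_zero, sub_zero]
  simp only [stageC, Matrix.diagonal_apply, Fin.ext_iff]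
  split_ifs <;> omega

/-- The mutation at `k` takes place when `stageLog` has the value `s k` at `k`. The only power
involved is `(1 + exp (s k)) ^ (-A k i)`, because the row `k` of the exchange matrix is nonpositive. -/
theorem mutateY_stageLog (hA : ∀ i j, i ≠ j → A i j ≤ 0) (s : Fin n → ℝ)
    (k : Fin n) : mutateY (stageB A k.1) k (fun i => Real.exp (stageLog A k.1 s i)) =
      fun i => Real.exp (stageLog A (k.1 + 1) s i) := by
  funext i
  have hk : stageLog A k.1 s k = s k := by
    have (j : Fin n) : ¬ (k.1 ≤ j.1 ∧ j < k) := fun h => by have : j.1 < k.1 := h.2; omega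
    simp only [stageLog, this, lt_irrefl, if_false, Finset.sum_const_zero, add_zero]
  have hk' : stageLog A (k.1 + 1) s k = -s k := by
    have (j : Fin n) : ¬ (k < j ∧ j.1 < k.1 + 1) := fun h => by have : k.1 < j.1 := h.1; omega
    simp only [stageLog, this, Nat.lt_succ_self, if_true, if_false, Finset.sum_const_zero,
      add_zero]
  by_cases h : i = k
  · subst h
    simp only [mutateY, if_true, hk, hk', Real.exp_neg]
  · have h1 : max 0 (stageB A k.1 k i) = 0 := max_eq_left (stageB_apply_nonpos hA k i)
    have h0 : (0 : ℝ) < 1 + Real.exp (s k) := by positivity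
    have h2 : (1 + Real.exp (s k)) ^ (-A k i) =
        Real.exp (-(A k i : ℝ) * Real.log (1 + Real.exp (s k))) := by
      rw [mul_comm, Real.exp_mul, Real.exp_log h0, ← Int.cast_neg, Real.rpow_intCast]
    simp only [mutateY, h, if_false, h1, zpow_zero, mul_one, hk]
    rw [stageB_apply_of_ne k i h, h2, ← Real.exp_add]
    congr 1
    have hne : i.1 ≠ k.1 := fun h' => h (Fin.ext h')
    have hsingle : -(A k i : ℝ) * Real.log (1 + Real.exp (s k)) =
        ∑ j, if k = j then -(A j i : ℝ) * Real.log (1 + Real.exp (s j)) else 0 := by simp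
    rcases lt_or_gt_of_ne hne with hlt | hgt
    · simp only [stageLog, hlt, show i.1 < k.1 + 1 by omega, if_true, add_assoc]
      congr 1
      rw [hsingle, ← Finset.sum_add_distrib]
      refine Finset.sum_congr rfl fun j _ => ?_
      have e1 : (i < j ↔ i.1 < j.1) := Iff.rfl
      have e2 : (k = j ↔ k.1 = j.1) := Fin.ext_iff
      simp only [e1, e2]
      split_ifs <;> first | omega | simp
    · simp only [stageLog, show ¬ i.1 < k.1 by omega, show ¬ i.1 < k.1 + 1 by omega, if_false,
        add_assoc]
      congr 1
      rw [hsingle, ← Finset.sum_add_distrib]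
      refine Finset.sum_congr rfl fun j _ => ?_
      have e1 : (j < i ↔ j.1 < i.1) := Iff.rfl
      have e2 : (k = j ↔ k.1 = j.1) := Fin.ext_iff
      simp only [e1, e2]
      split_ifs <;> first | omega | simp

theorem take_finRange_succ (k : Fin n) :
    (List.finRange n).take (k.1 + 1) = (List.finRange n).take k.1 ++ [k] := by
  rw [List.take_succ_eq_append_getElem (by simp)]
  simp

theorem foldl_stage (hs : ∀ i j, A i j = A j i) (hA : ∀ i j, i ≠ j → A i j ≤ 0) {m : ℕ}
    (hm : m ≤ n) :
    (((List.finRange n).take m).foldl (fun s k => (mutateB s.1 k, mutateC s.1 s.2 k))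
      (skewMatrix A, (1 : Matrix (Fin n) (Fin n) ℤ))) = (stageB A m, stageC n m) := by
  induction m with
  | zero => ext <;> simp [stageB, stageC, Matrix.one_apply, Matrix.diagonal_apply]
  | succ m ih =>
    have := take_finRange_succ ⟨m, hm⟩
    dsimp only at this
    rw [this, List.foldl_append, ih (by omega)]
    have h1 := mutateB_stageB hs hA ⟨m, hm⟩
    have h2 := mutateC_stageC hA ⟨m, hm⟩
    dsimp only at h1 h2
    simp [h1, h2]

theorem mutateWord_stage (hs : ∀ i j, A i j = A j i) (hA : ∀ i j, i ≠ j → A i j ≤ 0)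
    (s : Fin n → ℝ) {m : ℕ} (hm : m ≤ n) :
    (((List.finRange n).take m).foldl (fun s k => (mutateB s.1 k, mutateY s.1 k s.2))
      (skewMatrix A, fun i => Real.exp (stageLog A 0 s i))) =
        (stageB A m, fun i => Real.exp (stageLog A m s i)) := by
  induction m with
  | zero => ext <;> simp [stageB]
  | succ m ih =>
    have := take_finRange_succ ⟨m, hm⟩
    dsimp only at this
    rw [this, List.foldl_append, ih (by omega)]
    have h1 := mutateB_stageB hs hA ⟨m, hm⟩
    have h2 := mutateY_stageLog hA s ⟨m, hm⟩
    dsimp only at h1 h2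
    simp [h1, h2]

theorem matrixAt_eq_foldl_fst (B C : Matrix (Fin n) (Fin n) ℤ) (w : List (Fin n)) :
    matrixAt B w = (w.foldl (fun s k => (mutateB s.1 k, mutateC s.1 s.2 k)) (B, C)).1 := by
  induction w generalizing B C with
  | nil => rfl
  | cons k w ih => exact ih _ _

/-- Every vertex of the path is a sink when it is mutated, so that mutation only changes signs. -/
theorem isReddeningTriple_skewMatrix (hs : ∀ i j, A i j = A j i)
    (hA : ∀ i j, i ≠ j → A i j ≤ 0) :
    IsReddeningTriple (skewMatrix A) (List.finRange n) 1 := by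
  have h := foldl_stage hs hA le_rfl
  rw [List.take_of_length_le (by simp)] at h
  refine ⟨?_, ?_⟩
  · rw [matrixAt_eq_foldl_fst _ 1, h]
    ext i j
    have h1 : (Equiv.symm (1 : Equiv.Perm (Fin n))) = 1 := rfl
    simp [stageB, h1]
  · rw [cMatrixAt, h]
    ext i j
    by_cases hij : i = j <;> simp [stageC, hij]

theorem mutateWord_finRange (hs : ∀ i j, A i j = A j i) (hA : ∀ i j, i ≠ j → A i j ≤ 0)
    (s : Fin n → ℝ) :
    mutateWord (skewMatrix A) (fun i => Real.exp (stageLog A 0 s i)) (List.finRange n) =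
      fun i => Real.exp (stageLog A n s i) := by
  have h := mutateWord_stage hs hA s le_rfl
  rw [List.take_of_length_le (by simp)] at h
  rw [mutateWord, h]

/-- The change of variables from the `s k` to the logarithms of the `y k` is triangular, hence
surjective. -/
theorem exists_stageLog_zero_eq (A : Matrix (Fin n) (Fin n) ℤ) (u : Fin n → ℝ) :
    ∃ s, stageLog A 0 s = u := by
  suffices h : ∀ m ≤ n, ∃ s : Fin n → ℝ, ∀ k : Fin n, k.1 < m → stageLog A 0 s k = u k by
    obtain ⟨s, hs⟩ := h n le_rfl
    exact ⟨s, funext fun k => hs k k.2⟩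
  intro m hm
  induction m with
  | zero => exact ⟨u, fun k hk => absurd hk (by omega)⟩
  | succ m ih =>
    obtain ⟨s, hs⟩ := ih (by omega)
    let k₀ : Fin n := ⟨m, hm⟩
    have hsum (t : ℝ) (k : Fin n) (hk : k.1 ≤ m) :
        (∑ j, if 0 ≤ j.1 ∧ j < k then (A j k : ℝ) *
          Real.log (1 + Real.exp (Function.update s k₀ t j)) else 0) =
        ∑ j, if 0 ≤ j.1 ∧ j < k then (A j k : ℝ) * Real.log (1 + Real.exp (s j)) else 0 := by
      refine Finset.sum_congr rfl fun j _ => ?_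
      split_ifs with h
      · have : j ≠ k₀ := by
          intro h'
          have h1 : j.1 = m := congrArg Fin.val h'
          have h2 : j.1 < k.1 := h.2
          omega
        rw [Function.update_of_ne this]
      · rfl
    refine ⟨Function.update s k₀ (u k₀ - ∑ j, if 0 ≤ j.1 ∧ j < k₀ then
      (A j k₀ : ℝ) * Real.log (1 + Real.exp (s j)) else 0), fun k hk => ?_⟩
    simp only [stageLog, Nat.not_lt_zero, if_false]
    rw [hsum _ k (by omega)]
    by_cases h : k = k₀
    · rw [h]; simp
    · rw [Function.update_of_ne h]
      have hne : k.1 ≠ m := fun h' => h (Fin.ext h')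
      have := hs k (by omega)
      simpa [stageLog] using this

/-- The fixed point equation: in the variables `z k = exp (s k)` it reads
`z k ^ 2 = ∏_{j ≠ k} (1 + z j) ^ (-A j k)`. -/
theorem stageLog_eq_iff (s : Fin n → ℝ) :
    stageLog A n s = stageLog A 0 s ↔
      ∀ k, 2 * s k = ∑ j, if j = k then 0 else -(A j k : ℝ) * Real.log (1 + Real.exp (s j)) := by
  rw [funext_iff]
  refine forall_congr' fun k => ?_
  have h1 : (∑ j, if j = k then 0 else -(A j k : ℝ) * Real.log (1 + Real.exp (s j))) =
      (∑ j : Fin n, if k < j ∧ j.1 < n then -(A j k : ℝ) * Real.log (1 + Real.exp (s j)) else 0) -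
      ∑ j : Fin n, if 0 ≤ j.1 ∧ j < k then (A j k : ℝ) * Real.log (1 + Real.exp (s j)) else 0 := by
    rw [← Finset.sum_sub_distrib]
    refine Finset.sum_congr rfl fun j _ => ?_
    rcases lt_trichotomy j k with h | h | h
    · simp [h, h.ne, h.not_gt]
    · simp [h]
    · simp [h, h.ne', h.not_gt]
  rw [h1]
  simp only [stageLog, k.2, if_true, Nat.not_lt_zero, if_false]
  constructor <;> intro h <;> linarith

theorem log_one_add_exp_sub_le {a b : ℝ} :
    |Real.log (1 + Real.exp a) - Real.log (1 + Real.exp b)| ≤ |a - b| := by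
  wlog h : b ≤ a generalizing a b
  · rw [abs_sub_comm, abs_sub_comm a]
    exact this (le_of_not_ge h)
  have hb : (0 : ℝ) < 1 + Real.exp b := by positivity
  have ha : (0 : ℝ) < 1 + Real.exp a := by positivity
  have h1 : Real.log (1 + Real.exp b) ≤ Real.log (1 + Real.exp a) :=
    Real.log_le_log hb (by gcongr)
  rw [abs_of_nonneg (by linarith), abs_of_nonneg (by linarith), sub_le_iff_le_add,
    Real.log_le_iff_le_exp ha, Real.exp_add, Real.exp_log hb, Real.exp_sub]
  have h2 : 1 ≤ Real.exp a / Real.exp b := by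
    rw [one_le_div (Real.exp_pos b)]; exact Real.exp_le_exp.2 h
  have h3 : Real.exp a / Real.exp b * Real.exp b = Real.exp a := by
    field_simp
  nlinarith

/-- The fixed point equation has at most one solution, because `t ↦ log (1 + exp t)` is
`1`-Lipschitz and `A` is positive definite after multiplying its columns by positive numbers `d`. -/
theorem fixedPoint_unique (hA : ∀ i j, i ≠ j → A i j ≤ 0) (hd : ∀ i, A i i = 2)
    (d : Fin n → ℝ) (hd0 : ∀ i, 0 < d i)
    (hpd : ∀ v : Fin n → ℝ, (∑ k, ∑ j, v k * ((A j k : ℝ) * d k) * v j) ≤ 0 → v = 0)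
    {s s' : Fin n → ℝ}
    (h : ∀ k, 2 * s k = ∑ j, if j = k then 0 else -(A j k : ℝ) * Real.log (1 + Real.exp (s j)))
    (h' : ∀ k, 2 * s' k =
      ∑ j, if j = k then 0 else -(A j k : ℝ) * Real.log (1 + Real.exp (s' j))) :
    s = s' := by
  -- the quadratic form is nonpositive at the vector of distances between the two solutions
  have key : (fun k => |s k - s' k|) = 0 := by
    refine hpd _ (Finset.sum_nonpos fun k _ => ?_)
    have hk : 2 * |s k - s' k| ≤ ∑ j, if j = k then 0 else -(A j k : ℝ) * |s j - s' j| := by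
      have e : 2 * (s k - s' k) = ∑ j, if j = k then 0 else -(A j k : ℝ) *
          (Real.log (1 + Real.exp (s j)) - Real.log (1 + Real.exp (s' j))) := by
        rw [mul_sub, h, h', ← Finset.sum_sub_distrib]
        refine Finset.sum_congr rfl fun j _ => ?_
        split_ifs <;> ring
      calc 2 * |s k - s' k| = |2 * (s k - s' k)| := by rw [abs_mul]; simp
        _ ≤ _ := by
          rw [e]
          refine (Finset.abs_sum_le_sum_abs _ _).trans (Finset.sum_le_sum fun j _ => ?_)
          split_ifs with hj
          · simp
          · have : (0 : ℝ) ≤ -(A j k : ℝ) := by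
              have := hA j k hj
              exact_mod_cast Int.neg_nonneg_of_nonpos this
            rw [abs_mul, abs_of_nonneg this]
            exact mul_le_mul_of_nonneg_left log_one_add_exp_sub_le this
    have e2 : ∑ j, |s k - s' k| * ((A j k : ℝ) * d k) * |s j - s' j| =
        |s k - s' k| * d k * (2 * |s k - s' k| -
          ∑ j, if j = k then 0 else -(A j k : ℝ) * |s j - s' j|) := by
      have : 2 * |s k - s' k| = ∑ j, if j = k then (A j k : ℝ) * |s j - s' j| else 0 := by
        simp [hd]
      rw [this, ← Finset.sum_sub_distrib, Finset.mul_sum]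
      refine Finset.sum_congr rfl fun j _ => ?_
      split_ifs <;> ring
    rw [e2]
    exact mul_nonpos_of_nonneg_of_nonpos (mul_nonneg (abs_nonneg _) (hd0 k).le) (by linarith)
  funext k
  have := congrFun key k
  simpa [sub_eq_zero] using this

end Acyclic

/-! ### The derivative of the Donaldson–Thomas transformation -/

section Derivative

variable {n : ℕ} {A : Matrix (Fin n) (Fin n) ℤ}

/-- The Jacobian matrix of `stageLog A m` in terms of the weights `w = z / (1 + z)`. -/
noncomputable def stageJacobian (A : Matrix (Fin n) (Fin n) ℤ) (m : ℕ) (w : Fin n → ℝ) :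
    Matrix (Fin n) (Fin n) ℝ :=
  Matrix.of fun i j =>
    if i.1 < m then
      (if i = j then -1 else 0) + if i < j ∧ j.1 < m then -(A j i : ℝ) * w j else 0
    else (if i = j then 1 else 0) + if m ≤ j.1 ∧ j < i then (A j i : ℝ) * w j else 0

theorem hasFDerivAt_exp_stageLog (m : ℕ) (s : Fin n → ℝ) :
    HasFDerivAt (fun s i => Real.exp (stageLog A m s i))
      (LinearMap.toContinuousLinearMap (Matrix.mulVecLin
        (Matrix.diagonal (fun i => Real.exp (stageLog A m s i)) *
        stageJacobian A m fun j => Real.exp (s j) / (1 + Real.exp (s j))))) s := by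
  rw [hasFDerivAt_pi']
  intro i
  have hp (j : Fin n) : HasFDerivAt (fun s : Fin n → ℝ => s j)
      (ContinuousLinearMap.proj (R := ℝ) (φ := fun _ : Fin n => ℝ) j) s := hasFDerivAt_apply j s
  have hl (j : Fin n) : HasFDerivAt (fun s : Fin n → ℝ => Real.log (1 + Real.exp (s j)))
      ((Real.exp (s j) / (1 + Real.exp (s j))) •
        ContinuousLinearMap.proj (R := ℝ) (φ := fun _ : Fin n => ℝ) j) s := by
    have h0 : 1 + Real.exp (s j) ≠ 0 := by positivity
    refine (((hp j).exp.const_add 1).log h0).congr_fderiv ?_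
    rw [smul_smul, div_eq_inv_mul]
  have key : HasFDerivAt (fun s => stageLog A m s i)
      (∑ j, stageJacobian A m (fun j => Real.exp (s j) / (1 + Real.exp (s j))) i j •
        ContinuousLinearMap.proj (R := ℝ) (φ := fun _ : Fin n => ℝ) j) s := by
    by_cases him : i.1 < m
    · have h1 : HasFDerivAt (fun s : Fin n → ℝ => ∑ j, if i < j ∧ j.1 < m then
          -(A j i : ℝ) * Real.log (1 + Real.exp (s j)) else 0)
          (∑ j, (if i < j ∧ j.1 < m then -(A j i : ℝ) *
            (Real.exp (s j) / (1 + Real.exp (s j))) else 0) •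
            ContinuousLinearMap.proj (R := ℝ) (φ := fun _ : Fin n => ℝ) j) s := by
        refine HasFDerivAt.fun_sum fun j _ => ?_
        split_ifs
        · rw [mul_smul]; exact (hl j).const_mul _
        · rw [zero_smul]; exact hasFDerivAt_const _ _
      simp only [stageLog, stageJacobian, him, if_true, Matrix.of_apply]
      refine ((hp i).neg.add h1).congr_fderiv ?_
      simp only [add_smul, Finset.sum_add_distrib]
      congr 1
      simp
    · have h1 : HasFDerivAt (fun s : Fin n → ℝ => ∑ j, if m ≤ j.1 ∧ j < i then
          (A j i : ℝ) * Real.log (1 + Real.exp (s j)) else 0)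
          (∑ j, (if m ≤ j.1 ∧ j < i then (A j i : ℝ) *
            (Real.exp (s j) / (1 + Real.exp (s j))) else 0) •
            ContinuousLinearMap.proj (R := ℝ) (φ := fun _ : Fin n => ℝ) j) s := by
        refine HasFDerivAt.fun_sum fun j _ => ?_
        split_ifs
        · rw [mul_smul]; exact (hl j).const_mul _
        · rw [zero_smul]; exact hasFDerivAt_const _ _
      simp only [stageLog, stageJacobian, him, if_false, Matrix.of_apply]
      refine ((hp i).add h1).congr_fderiv ?_
      simp only [add_smul, Finset.sum_add_distrib]
      congr 1
      simp
  refine key.exp.congr_fderiv ?_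
  ext v
  simp [Matrix.mulVec, dotProduct, Finset.mul_sum, mul_assoc]

theorem det_stageJacobian_zero (w : Fin n → ℝ) : (stageJacobian A 0 w).det = 1 := by
  rw [Matrix.det_of_isLowerTriangular]
  · simp [stageJacobian]
  · intro i j hij
    have hij : i < j := hij
    simp [stageJacobian, hij.ne, hij.not_gt]

/-- The characteristic polynomial of the linearized DT transformation at the fixed point with
parameters `s`, as the determinant of a matrix that is supported on the Dynkin diagram. -/
theorem eval_charpoly_fderiv (hs : ∀ i j, A i j = A j i) (hA : ∀ i j, i ≠ j → A i j ≤ 0)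
    {s : Fin n → ℝ} (hfix : stageLog A n s = stageLog A 0 s) (x : ℂ) :
    ((LinearMap.charpoly (fderiv ℝ (fun y => mutateWord (skewMatrix A) y (List.finRange n))
      (fun i => Real.exp (stageLog A 0 s i)) : (Fin n → ℝ) →ₗ[ℝ] (Fin n → ℝ))).map
        (algebraMap ℝ ℂ)).eval x =
    (Matrix.of fun k j : Fin n => if k = j then x + 1 else
      (if j < k then x else 1) *
        ((A j k : ℂ) * (Real.exp (s j) / (1 + Real.exp (s j)) : ℝ))).det := by
  set y : Fin n → ℝ := fun i => Real.exp (stageLog A 0 s i) with hy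
  set w : Fin n → ℝ := fun j => Real.exp (s j) / (1 + Real.exp (s j)) with hw
  set L₀ := fderiv ℝ (fun y => mutateWord (skewMatrix A) y (List.finRange n)) y
  have hypos : ∀ i, 0 < y i := fun i => Real.exp_pos _
  have hL₀ : HasFDerivAt (fun y => mutateWord (skewMatrix A) y (List.finRange n)) L₀ y :=
    (differentiableAt_mutateWord _ _ hypos).hasFDerivAt
  have h0 := hasFDerivAt_exp_stageLog (A := A) 0 s
  have hn := hasFDerivAt_exp_stageLog (A := A) n s
  have hcomp : HasFDerivAt (fun s i => Real.exp (stageLog A n s i))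
      (L₀.comp (LinearMap.toContinuousLinearMap (Matrix.mulVecLin
        (Matrix.diagonal y * stageJacobian A 0 w)))) s := by
    refine (HasFDerivAt.comp (g := fun y => mutateWord (skewMatrix A) y (List.finRange n)) s
      hL₀ h0).congr_of_eventuallyEq (Filter.Eventually.of_forall fun s => ?_)
    exact (mutateWord_finRange hs hA s).symm
  have hcl := hcomp.unique hn
  have hlin := congrArg (fun f : (Fin n → ℝ) →L[ℝ] (Fin n → ℝ) =>
    LinearMap.toMatrix' (f : (Fin n → ℝ) →ₗ[ℝ] (Fin n → ℝ))) hcl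
  set Lm := LinearMap.toMatrix' (L₀ : (Fin n → ℝ) →ₗ[ℝ] (Fin n → ℝ)) with hLm
  have hmat : Lm * (Matrix.diagonal y * stageJacobian A 0 w) =
      Matrix.diagonal y * stageJacobian A n w := by
    rw [hfix] at hlin
    have e : LinearMap.toMatrix' ((L₀ : (Fin n → ℝ) →ₗ[ℝ] (Fin n → ℝ)) ∘ₗ
        Matrix.mulVecLin (Matrix.diagonal y * stageJacobian A 0 w)) =
        LinearMap.toMatrix' (Matrix.mulVecLin (Matrix.diagonal y * stageJacobian A n w)) := hlin
    rw [LinearMap.toMatrix'_comp, ← Matrix.toLin'_apply', ← Matrix.toLin'_apply',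
      LinearMap.toMatrix'_toLin', LinearMap.toMatrix'_toLin'] at e
    exact e
  have hch : LinearMap.charpoly (L₀ : (Fin n → ℝ) →ₗ[ℝ] (Fin n → ℝ)) = Lm.charpoly := by
    rw [hLm, ← LinearMap.charpoly_toMatrix _ (Pi.basisFun ℝ (Fin n))]
    rfl
  let φ : Matrix (Fin n) (Fin n) ℝ →+* Matrix (Fin n) (Fin n) ℂ := (algebraMap ℝ ℂ).mapMatrix
  have hD : φ (Matrix.diagonal y) = Matrix.diagonal fun i => (y i : ℂ) := by
    simp [φ, Matrix.diagonal_map]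
  have hJ0 : (φ (stageJacobian A 0 w)).det = 1 := by
    rw [← RingHom.map_det, det_stageJacobian_zero, map_one]
  have hy0 : (φ (Matrix.diagonal y)).det ≠ 0 := by
    rw [hD, Matrix.det_diagonal]
    exact Finset.prod_ne_zero_iff.2 fun i _ => by exact_mod_cast (hypos i).ne'
  have hφ : φ Lm * (φ (Matrix.diagonal y) * φ (stageJacobian A 0 w)) =
      φ (Matrix.diagonal y) * φ (stageJacobian A n w) := by
    rw [← map_mul, ← map_mul, hmat, map_mul]
  rw [hch, ← Matrix.charpoly_map, Matrix.eval_charpoly]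
  -- the Jacobian at the fixed point intertwines the derivative with the two triangular matrices
  have e1 : (Matrix.scalar (Fin n) x - φ Lm) *
      (φ (Matrix.diagonal y) * φ (stageJacobian A 0 w)) =
      φ (Matrix.diagonal y) * (x • φ (stageJacobian A 0 w) - φ (stageJacobian A n w)) := by
    rw [sub_mul, hφ, mul_sub]
    congr 1
    rw [Matrix.scalar_apply, ← Matrix.smul_eq_diagonal_mul, Matrix.mul_smul]
  have e2 := congrArg Matrix.det e1
  rw [Matrix.det_mul, Matrix.det_mul, Matrix.det_mul, hJ0, mul_one, mul_comm] at e2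
  have e3 := mul_left_cancel₀ hy0 e2
  refine Eq.trans e3 (congrArg Matrix.det ?_)
  ext k j
  simp only [φ, RingHom.mapMatrix_apply, Matrix.sub_apply, Matrix.smul_apply, Matrix.map_apply,
    stageJacobian, Matrix.of_apply, Nat.not_lt_zero, if_false, k.2, j.2, if_true, and_true,
    Nat.zero_le, true_and, hw]
  rcases lt_trichotomy k j with h | h | h
  · simp [h, h.ne, h.not_gt]
  · simp [h]
  · simp [h, h.ne', h.not_gt]

end Derivative

/-! ### Determinants supported on trees -/

section TreeDet

variable {R : Type*} [CommRing R]

/-- Expansion of a determinant along a leaf: the last index has `a` as its only neighbor. -/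
theorem det_leaf {k : ℕ} (M : Matrix (Fin (k + 2)) (Fin (k + 2)) R) (a : Fin (k + 1))
    (h1 : ∀ j, j ≠ a → M (Fin.last _) j.castSucc = 0)
    (h2 : ∀ j, j ≠ a → M j.castSucc (Fin.last _) = 0) :
    M.det = M (Fin.last _) (Fin.last _) * (M.submatrix Fin.castSucc Fin.castSucc).det -
      M (Fin.last _) a.castSucc * M a.castSucc (Fin.last _) *
        ((M.submatrix Fin.castSucc Fin.castSucc).submatrix a.succAbove a.succAbove).det := by
  rw [Matrix.det_succ_row M (Fin.last _), Fin.sum_univ_castSucc, Finset.sum_eq_single a]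
  · have e1 : M.submatrix (Fin.last (k + 1)).succAbove (Fin.last (k + 1)).succAbove =
        M.submatrix Fin.castSucc Fin.castSucc := by
      ext i j; simp
    have e2 : (M.submatrix (Fin.last (k + 1)).succAbove a.castSucc.succAbove).det =
        (-1) ^ (a.1 + k) * M a.castSucc (Fin.last _) *
          ((M.submatrix Fin.castSucc Fin.castSucc).submatrix a.succAbove a.succAbove).det := by
      rw [Matrix.det_succ_column _ (Fin.last _), Finset.sum_eq_single a]
      · congr 1
        · simp
        · congr 1
          ext i j
          simp
      · intro i _ hi
        have : M i.castSucc (Fin.last _) = 0 := h2 i hi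
        simp [this]
      · simp
    rw [e1, e2]
    have s1 : ((-1 : R)) ^ ((Fin.last (k + 1)).1 + (Fin.last (k + 1)).1) = 1 := by
      rw [← two_mul, pow_mul]; simp
    have s2 : ((-1 : R)) ^ ((Fin.last (k + 1)).1 + a.castSucc.1) * (-1) ^ (a.1 + k) = -1 := by
      rw [← pow_add]
      have : (Fin.last (k + 1)).1 + a.castSucc.1 + (a.1 + k) = 2 * (k + a.1) + 1 := by
        simp; ring
      rw [this, pow_succ, pow_mul]; simp
    rw [s1]
    linear_combination (M (Fin.last (k + 1)) a.castSucc * M a.castSucc (Fin.last (k + 1)) *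
      ((M.submatrix Fin.castSucc Fin.castSucc).submatrix a.succAbove a.succAbove).det) * s2
  · intro j _ hj
    simp [h1 j hj]
  · simp

/-- A determinant supported on a path satisfies the three-term recursion of continuants. -/
theorem det_path (d : R) (p : ℕ → R) (c : ℕ → R) (c0 : c 0 = 1) (c1 : c 1 = d)
    (hc : ∀ k, c (k + 2) = d * c (k + 1) - p k * c k) (k : ℕ) (M : Matrix (Fin k) (Fin k) R)
    (hd : ∀ i, M i i = d) (h0 : ∀ i j : Fin k, i.1 + 1 < j.1 → M i j = 0 ∧ M j i = 0)
    (hp : ∀ i j : Fin k, i.1 + 1 = j.1 → M i j * M j i = p i.1) :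
    M.det = c k := by
  induction k using Nat.twoStepInduction with
  | zero => simp [c0]
  | one => rw [Matrix.det_fin_one, hd, c1]
  | more k ih1 ih2 =>
    rw [det_leaf M (Fin.last k), hc, hd, ih2]
    · have e : (M.submatrix Fin.castSucc Fin.castSucc).submatrix (Fin.last k).succAbove
        (Fin.last k).succAbove = M.submatrix (fun i : Fin k => i.castSucc.castSucc)
          (fun i : Fin k => i.castSucc.castSucc) := by ext i j; simp
      rw [e, ih1]
      · rw [mul_comm (M _ _), hp _ _ (by simp)]; simp
      · exact fun i => hd _
      · exact fun i j hij => h0 _ _ hij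
      · exact fun i j hij => hp _ _ hij
    · exact fun i => hd _
    · exact fun i j hij => h0 _ _ hij
    · exact fun i j hij => hp _ _ hij
    · intro j hj
      refine (h0 _ _ ?_).2
      have : j.1 ≠ k := fun h => hj (Fin.ext h)
      simp; omega
    · intro j hj
      refine (h0 _ _ ?_).1
      have : j.1 ≠ k := fun h => hj (Fin.ext h)
      simp; omega

end TreeDet

/-! ### Permutations of the roots and positive definiteness -/

section RootSystemFacts

variable {ι M N : Type*} [Fintype ι] [AddCommGroup M] [Module ℝ M] [AddCommGroup N] [Module ℝ N]
  {P : RootPairing ι ℝ M N} [P.IsRootSystem] [P.IsCrystallographic]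

/-- The basis of simple roots numbered by `e`. -/
noncomputable def simpleBasis (b : P.Base) {n : ℕ} (e : Fin n ≃ b.support) :
    Module.Basis (Fin n) ℝ M :=
  b.toWeightBasis.reindex e.symm

omit [Fintype ι] [P.IsCrystallographic] in
theorem simpleBasis_apply (b : P.Base) {n : ℕ} (e : Fin n ≃ b.support) (k : Fin n) :
    simpleBasis b e k = P.root (e k) := by
  simp [simpleBasis]

omit [Fintype ι] [P.IsRootSystem] in
theorem cast_cartanMatrix (b : P.Base) (i j : b.support) :
    ((b.cartanMatrix i j : ℤ) : ℝ) = P.pairing i j :=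
  b.algebraMap_cartanMatrixIn_apply ℤ i j

/-- Positive definiteness of the symmetrized Cartan matrix, over the reals. -/
theorem cartanMatrix_posDef (b : P.Base) {n : ℕ} (e : Fin n ≃ b.support) :
    ∃ d : Fin n → ℝ, (∀ i, 0 < d i) ∧ ∀ v : Fin n → ℝ,
      (∑ k, ∑ j, v k * ((b.cartanMatrix (e j) (e k) : ℤ) * d k) * v j) ≤ 0 → v = 0 := by
  refine ⟨fun k => P.RootForm (P.root (e k)) (P.root (e k)), fun k => ?_, fun v hv => ?_⟩
  · exact P.rootForm_pos_of_ne_zero (Submodule.subset_span ⟨_, rfl⟩) (P.ne_zero _)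
  · set x : M := ∑ k, v k • simpleBasis b e k with hx
    have h2 : 2 * P.RootForm x x =
        ∑ k, ∑ j, v k * ((b.cartanMatrix (e j) (e k) : ℤ) *
          P.RootForm (P.root (e k)) (P.root (e k))) * v j := by
      have (k j : Fin n) : v k * ((b.cartanMatrix (e j) (e k) : ℤ) *
          P.RootForm (P.root (e k)) (P.root (e k))) * v j =
          2 * (v j * (v k * P.RootForm (P.root (e j)) (P.root (e k)))) := by
        rw [cast_cartanMatrix]
        have := P.toInvariantForm.two_mul_apply_root_root (e j) (e k)
        simp only [RootPairing.toInvariantForm_form] at this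
        rw [← this]; ring
      simp only [this, hx, map_sum, LinearMap.sum_apply, map_smul, LinearMap.smul_apply,
        smul_eq_mul, simpleBasis_apply, Finset.mul_sum]
      exact Finset.sum_congr rfl fun k _ => Finset.sum_congr rfl fun j _ => by ring
    have hx0 : x = 0 := by
      by_contra hne
      have hmem : x ∈ P.rootSpan ℝ := by
        have : P.rootSpan ℝ = ⊤ := RootPairing.IsRootSystem.span_root_eq_top
        rw [this]; trivial
      have := P.rootForm_pos_of_ne_zero hmem hne
      linarith
    have hlin := (simpleBasis b e).linearIndependent
    rw [Fintype.linearIndependent_iff] at hlin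
    exact funext (hlin v hx0)

/-- `w` permutes the roots, by the permutation `π` of their indices. -/
def PermutesRoots (P : RootPairing ι ℝ M N) (w : M ≃ₗ[ℝ] M) (π : Equiv.Perm ι) : Prop :=
  ∀ i, P.root (π i) = w (P.root i)

omit [Fintype ι] [P.IsRootSystem] [P.IsCrystallographic] in
theorem permutesRoots_reflection (i : ι) :
    PermutesRoots P (P.reflection i) (P.reflectionPerm i) :=
  fun j => P.root_reflectionPerm i j

omit [Fintype ι] [P.IsRootSystem] [P.IsCrystallographic] in
theorem PermutesRoots.mul {w w' : M ≃ₗ[ℝ] M} {π π' : Equiv.Perm ι} (h : PermutesRoots P w π)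
    (h' : PermutesRoots P w' π') : PermutesRoots P (w * w') (π * π') := fun i => by
  rw [Equiv.Perm.mul_apply, h, h']; rfl

omit [Fintype ι] [P.IsRootSystem] [P.IsCrystallographic] in
theorem PermutesRoots.one : PermutesRoots P 1 1 := fun _ => rfl

omit [Fintype ι] [P.IsRootSystem] [P.IsCrystallographic] in
theorem PermutesRoots.pow {w : M ≃ₗ[ℝ] M} {π : Equiv.Perm ι} (h : PermutesRoots P w π) (m : ℕ) :
    PermutesRoots P (w ^ m) (π ^ m) := by
  induction m with
  | zero => exact PermutesRoots.one
  | succ m ih => rw [pow_succ, pow_succ]; exact ih.mul h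

omit [Fintype ι] [P.IsRootSystem] [P.IsCrystallographic] in
theorem exists_permutesRoots_prod (l : List ι) :
    ∃ π, PermutesRoots P (l.map P.reflection).prod π := by
  induction l with
  | nil => exact ⟨1, PermutesRoots.one⟩
  | cons i l ih =>
    obtain ⟨π, hπ⟩ := ih
    exact ⟨_, (permutesRoots_reflection i).mul hπ⟩

omit [P.IsCrystallographic] in
theorem PermutesRoots.exists_pow_eq_one {w : M ≃ₗ[ℝ] M} {π : Equiv.Perm ι}
    (h : PermutesRoots P w π) : ∃ m, 0 < m ∧ w ^ m = 1 := by
  classical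
  refine ⟨orderOf π, orderOf_pos π, ?_⟩
  have h1 := h.pow (orderOf π)
  rw [pow_orderOf_eq_one] at h1
  have h2 : ((w ^ orderOf π : M ≃ₗ[ℝ] M) : M →ₗ[ℝ] M) = LinearMap.id := by
    refine LinearMap.ext_on_range (v := P.root) ?_ fun i => (h1 i).symm
    exact RootPairing.IsRootSystem.span_root_eq_top
  ext x
  exact LinearMap.congr_fun h2 x

/-! ### The Coxeter element -/

omit [Fintype ι] [P.IsCrystallographic] in
/-- A simple reflection changes only one coordinate with respect to the simple roots. -/
theorem simpleBasis_repr_reflection (b : P.Base) {n : ℕ} (e : Fin n ≃ b.support) (k j : Fin n)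
    (v : M) : (simpleBasis b e).repr (P.reflection (e k) v) j =
      (simpleBasis b e).repr v j -
        if j = k then ∑ i, (simpleBasis b e).repr v i * P.pairing (e i) (e k) else 0 := by
  have h1 : P.toLinearMap v (P.coroot (e k)) =
      ∑ i, (simpleBasis b e).repr v i * P.pairing (e i) (e k) := by
    conv_lhs => rw [← (simpleBasis b e).sum_repr v]
    simp [simpleBasis_apply]
  rw [RootPairing.reflection_apply, map_sub, map_smul, ← simpleBasis_apply b e k,
    Module.Basis.repr_self]
  have h2 : P.coroot' (e k) v = P.toLinearMap v (P.coroot (e k)) := rfl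
  rw [h2, h1]
  by_cases h : j = k <;> simp [h]

omit [Fintype ι] [P.IsCrystallographic] in
/-- In coordinates, a Coxeter element is minus the product of the inverse of the upper unitriangular
part of the Cartan matrix and its lower unitriangular part. -/
theorem coxeter_coordinates (b : P.Base) {n : ℕ} (e : Fin n ≃ b.support) (v : M) (k : Fin n) :
    (simpleBasis b e).repr ((List.ofFn fun k : Fin n => P.reflection (e k)).prod v) k +
      (∑ j, if k < j then P.pairing (e j) (e k) *
        (simpleBasis b e).repr ((List.ofFn fun k : Fin n => P.reflection (e k)).prod v) j else 0) =
    -((simpleBasis b e).repr v k +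
      ∑ j, if j < k then P.pairing (e j) (e k) * (simpleBasis b e).repr v j else 0) := by
  set l := List.ofFn fun k : Fin n => P.reflection (e k) with hl
  -- `g m` applies only the reflections with index at least `m`, so that the `j`-th coordinate is
  -- that of `v` as long as `j < m`, and that of `l.prod v` afterwards
  let g : ℕ → M := fun m => (l.drop m).prod v
  have hg0 : g 0 = l.prod v := by simp [g]
  have hgn : g n = v := by
    have : l.drop n = [] := List.drop_eq_nil_of_le (by simp [hl])
    simp [g, this]
  have hstep (k : Fin n) : g k = P.reflection (e k) (g (k + 1)) := by
    have : l.drop k = P.reflection (e k) :: l.drop (k + 1) := by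
      rw [List.drop_eq_getElem_cons (by simp [hl])]
      simp [hl]
    simp [g, this]
  have hne (m : ℕ) (hm : m < n) (j : Fin n) (hj : j.1 ≠ m) :
      (simpleBasis b e).repr (g m) j = (simpleBasis b e).repr (g (m + 1)) j := by
    have h1 := hstep ⟨m, hm⟩
    dsimp only at h1
    rw [h1, simpleBasis_repr_reflection, if_neg (fun h => hj (congrArg Fin.val h)), sub_zero]
  have hlt (j : Fin n) : ∀ m, j.1 < m → m ≤ n →
      (simpleBasis b e).repr (g m) j = (simpleBasis b e).repr v j := by
    intro m hm hmn
    obtain ⟨d, rfl⟩ : ∃ d, n = m + d := ⟨n - m, by omega⟩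
    clear hmn
    have : ∀ d' ≤ d, (simpleBasis b e).repr (g (m + d')) j = (simpleBasis b e).repr (g m) j := by
      intro d' hd'
      induction d' with
      | zero => rfl
      | succ d' ih =>
        rw [← ih (by omega), ← add_assoc, hne (m + d') (by omega) j (by omega)]
    rw [← this d le_rfl, hgn]
  have hge (j : Fin n) : ∀ m, m ≤ j.1 →
      (simpleBasis b e).repr (g m) j = (simpleBasis b e).repr (l.prod v) j := by
    intro m hm
    induction m with
    | zero => rw [hg0]
    | succ m ih => rw [← ih (by omega), hne m (by omega) j (by omega)]
  have h1 := congrArg (fun u => (simpleBasis b e).repr u k) (hstep k)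
  simp only [simpleBasis_repr_reflection, if_true] at h1
  rw [hge k k.1 le_rfl, hlt k (k.1 + 1) (by omega) (by omega)] at h1
  have h2 : ∑ i, (simpleBasis b e).repr (g (k.1 + 1)) i * P.pairing (e i) (e k) =
      2 * (simpleBasis b e).repr v k +
      (∑ j, if k < j then P.pairing (e j) (e k) * (simpleBasis b e).repr (l.prod v) j else 0) +
      ∑ j, if j < k then P.pairing (e j) (e k) * (simpleBasis b e).repr v j else 0 := by
    have h3 : 2 * (simpleBasis b e).repr v k =
        ∑ j, if j = k then 2 * (simpleBasis b e).repr v j else 0 := by simp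
    rw [h3, ← Finset.sum_add_distrib, ← Finset.sum_add_distrib]
    refine Finset.sum_congr rfl fun j _ => ?_
    rcases lt_trichotomy j k with h | h | h
    · have h' : j.1 < k.1 := h
      rw [hlt j _ (by omega) (by omega)]
      simp [h, h.ne, h.not_gt, mul_comm]
    · subst h
      rw [hlt j _ (by omega) (by omega)]
      simp [mul_comm]
    · have h' : k.1 < j.1 := h
      rw [hge j _ (by omega)]
      simp [h, h.ne', h.not_gt, mul_comm]
  rw [h2] at h1
  linarith

/-- The order of a Coxeter element, read off from its characteristic polynomial, which is again a
determinant supported on the Dynkin diagram. Since the Coxeter element has finite order, it is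
semisimple. -/
theorem coxeterNumber_eq (b : P.Base) {n : ℕ} (e : Fin n ≃ b.support) {h : ℕ}
    (χ : Polynomial ℂ)
    (hχ : ∀ x, (Matrix.of fun k j : Fin n => if k = j then x + 1 else
      (if k < j then x else 1) * (b.cartanMatrix (e j) (e k) : ℂ)).det = χ.eval x)
    {r : ℕ} (hdvd : χ ∣ (Polynomial.X ^ h - 1) ^ r) {ζ : ℂ} (hζ : IsPrimitiveRoot ζ h)
    (hroot : χ.IsRoot ζ) : coxeterNumber b e = h := by
  unfold coxeterNumber
  set c := (List.ofFn fun k : Fin n => P.reflection (e k)).prod with hc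
  let φ : Matrix (Fin n) (Fin n) ℝ →+* Matrix (Fin n) (Fin n) ℂ := (algebraMap ℝ ℂ).mapMatrix
  let B := simpleBasis b e
  let X := LinearMap.toMatrix B B (c : M →ₗ[ℝ] M)
  let U : Matrix (Fin n) (Fin n) ℝ := Matrix.of fun k j =>
    (if k = j then 1 else 0) + if k < j then P.pairing (e j) (e k) else 0
  let V : Matrix (Fin n) (Fin n) ℝ := Matrix.of fun k j =>
    (if k = j then 1 else 0) + if j < k then P.pairing (e j) (e k) else 0
  -- `x - X = U⁻¹ * (x * U + V)`, where `U` has determinant `1`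
  have hUX : U * X = -V := by
    ext k i
    have h1 := coxeter_coordinates b e (B i) k
    simp only [B, Module.Basis.repr_self] at h1
    have h2 (j : Fin n) : X j i = (simpleBasis b e).repr (c (simpleBasis b e i)) j := by
      simp [X, B, LinearMap.toMatrix_apply]
    simp only [Matrix.mul_apply, U, V, Matrix.of_apply, add_mul, Finset.sum_add_distrib, ite_mul,
      one_mul, zero_mul, Finset.sum_ite_eq, Finset.mem_univ, if_true, h2, Matrix.neg_apply]
    rw [hc, h1]
    congr 2
    · simp [Finsupp.single_apply, eq_comm]
    · rw [Finset.sum_eq_single i]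
      · simp
      · intro j _ hj; simp [hj.symm]
      · simp
  have hUdet : U.det = 1 := by
    rw [Matrix.det_of_isUpperTriangular]
    · simp [U]
    · intro i j hij
      have hij : j < i := hij
      simp [U, hij.ne', hij.not_gt]
  have hch : (φ X).charpoly = χ := by
    refine Polynomial.funext fun x => ?_
    rw [Matrix.eval_charpoly, ← hχ]
    have e1 : φ U * (Matrix.scalar (Fin n) x - φ X) = x • φ U + φ V := by
      rw [mul_sub, ← map_mul, hUX, map_neg, sub_neg_eq_add, Matrix.scalar_apply,
        ← Matrix.smul_one_eq_diagonal, Matrix.mul_smul, mul_one]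
    have e2 := congrArg Matrix.det e1
    rw [Matrix.det_mul, ← RingHom.map_det, hUdet, map_one, one_mul] at e2
    rw [e2]
    congr 1
    ext k j
    have e3 : ((P.pairing (e j) (e k) : ℝ) : ℂ) = (b.cartanMatrix (e j) (e k) : ℂ) := by
      rw [← cast_cartanMatrix]; simp
    simp only [φ, RingHom.mapMatrix_apply, Matrix.add_apply, Matrix.smul_apply, Matrix.map_apply,
      U, V, Matrix.of_apply]
    rcases lt_trichotomy k j with h | h | h
    · simp [h, h.ne, h.not_gt, e3]
    · simp [h]
    · simp [h, h.ne', h.not_gt, e3]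
  have hpow (m : ℕ) : c ^ m = 1 ↔ φ X ^ m = 1 := by
    have h1 : (φ X) ^ m = φ (LinearMap.toMatrix B B ((c ^ m : M ≃ₗ[ℝ] M) : M →ₗ[ℝ] M)) := by
      rw [← map_pow, LinearMap.toMatrix_pow]
      congr 2
      ext v
      induction m generalizing v with
      | zero => rfl
      | succ m ih => rw [pow_succ, pow_succ, Module.End.mul_apply, ih]; rfl
    have hinj : Function.Injective φ := Matrix.map_injective Complex.ofReal_injective
    rw [h1]
    constructor
    · intro h
      rw [h]
      have : ((1 : M ≃ₗ[ℝ] M) : M →ₗ[ℝ] M) = 1 := rfl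
      rw [this, LinearMap.toMatrix_one, map_one]
    · intro h
      have h2 : LinearMap.toMatrix B B ((c ^ m : M ≃ₗ[ℝ] M) : M →ₗ[ℝ] M) =
          LinearMap.toMatrix B B 1 := by
        rw [LinearMap.toMatrix_one]; exact hinj (by rw [h, map_one])
      have h3 := (LinearMap.toMatrix B B).injective h2
      ext v
      exact LinearMap.congr_fun h3 v
  -- a matrix of finite order has a squarefree minimal polynomial, which divides `X ^ h - 1`;
  -- conversely, the eigenvalue `ζ` forces the order to be a multiple of `h`
  refine Nat.dvd_antisymm (orderOf_dvd_of_pow_eq_one ?_) ?_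
  · obtain ⟨π, hπ⟩ := exists_permutesRoots_prod (P := P) (List.ofFn fun k : Fin n => (e k : ι))
    rw [List.map_ofFn] at hπ
    obtain ⟨m, hm0, hm⟩ := PermutesRoots.exists_pow_eq_one hπ
    have hm : c ^ m = 1 := hm
    rw [hpow] at hm ⊢
    have h1 : minpoly ℂ (φ X) ∣ Polynomial.X ^ m - 1 := minpoly.dvd _ _ (by simp [hm])
    have hsq : Squarefree (minpoly ℂ (φ X)) := by
      refine Squarefree.squarefree_of_dvd h1 (Polynomial.Separable.squarefree ?_)
      have := Polynomial.separable_X_pow_sub_C (1 : ℂ) (n := m)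
        (by exact_mod_cast hm0.ne') one_ne_zero
      simpa using this
    have h2 : minpoly ℂ (φ X) ∣ (Polynomial.X ^ h - 1) ^ r :=
      ((Matrix.minpoly_dvd_charpoly _).trans (dvd_of_eq hch)).trans hdvd
    obtain ⟨q, hq⟩ := hsq.isRadical _ _ h2
    have h3 := congrArg (Polynomial.aeval (φ X)) hq
    rw [map_mul, minpoly.aeval, zero_mul] at h3
    simpa [sub_eq_zero] using h3
  · have hcm : c ^ orderOf c = 1 := pow_orderOf_eq_one c
    rw [hpow] at hcm
    refine hζ.dvd_of_pow_eq_one _ ?_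
    have hdet : (Matrix.scalar (Fin n) ζ - φ X).det = 0 := by
      rw [← Matrix.eval_charpoly, hch]; exact hroot
    obtain ⟨v, hv0, hv⟩ := Matrix.exists_mulVec_eq_zero_iff.2 hdet
    have hv1 : (φ X).mulVec v = ζ • v := by
      rw [Matrix.sub_mulVec, sub_eq_zero] at hv
      rw [← hv]
      ext i
      simp [Matrix.mulVec_diagonal]
    have hvm (m : ℕ) : ((φ X) ^ m).mulVec v = ζ ^ m • v := by
      induction m with
      | zero => simp
      | succ m ih =>
        rw [pow_succ, ← Matrix.mulVec_mulVec, hv1, Matrix.mulVec_smul, ih, smul_smul, pow_succ,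
          mul_comm]
    have := hvm (orderOf c)
    rw [hcm, Matrix.one_mulVec] at this
    obtain ⟨i, hi⟩ := Function.ne_iff.1 hv0
    have h4 := congrFun this i
    simp only [Pi.smul_apply, smul_eq_mul] at h4
    have hi' : v i ≠ 0 := hi
    exact mul_right_cancel₀ hi' (by rw [← h4, one_mul])

end RootSystemFacts

/-! ### Heights of roots -/

section Heights

variable {ι M N : Type*} [Fintype ι] [AddCommGroup M] [Module ℝ M] [AddCommGroup N] [Module ℝ N]
  {P : RootPairing ι ℝ M N} [P.IsRootSystem] [P.IsCrystallographic] [P.IsReduced]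

omit [P.IsRootSystem] [P.IsReduced] in
/-- A permutation of the roots that matches the positive roots of two bases maps simple roots to
simple roots, since the simple roots are the indecomposable positive roots. -/
theorem mem_support_of_isPos_iff {b b' : P.Base} {w : M ≃ₗ[ℝ] M} {π : Equiv.Perm ι}
    (hw : PermutesRoots P w π) (hpos : ∀ i, b'.IsPos i ↔ b.IsPos (π i)) {i : ι}
    (hi : π i ∈ b.support) : i ∈ b'.support := by
  have hbi : b'.IsPos i := (hpos i).2 (RootPairing.Base.isPos_of_mem_support hi)
  obtain ⟨j, hj, hj'⟩ := hbi.exists_mem_support_pos_pairingIn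
  rw [P.zero_lt_pairingIn_iff'] at hj'
  by_contra hne
  have hij : i ≠ j := fun h => hne (h ▸ hj)
  obtain ⟨k, hk⟩ := P.root_sub_root_mem_of_pairingIn_pos hj' hij
  have hkpos : b'.IsPos k := hbi.sub hj hk
  have h1 : P.root (π i) = P.root (π k) + P.root (π j) := by
    rw [hw, hw, hw, hk]; simp
  have h2 := b.height_add h1
  have h3 : 0 < b.height (π k) := (hpos k).1 hkpos
  have h4 : 0 < b.height (π j) := (hpos j).1 (RootPairing.Base.isPos_of_mem_support hj)
  rw [RootPairing.Base.height_one_of_mem_support hi] at h2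
  omega

omit [P.IsRootSystem] [P.IsReduced] in
/-- A permutation of the roots that matches the positive roots of two bases preserves heights. -/
theorem height_eq_of_isPos_iff {b b' : P.Base} {w : M ≃ₗ[ℝ] M} {π : Equiv.Perm ι}
    (hw : PermutesRoots P w π) (hpos : ∀ i, b'.IsPos i ↔ b.IsPos (π i)) (i : ι) :
    b'.height i = b.height (π i) := by
  have hw' : PermutesRoots P w⁻¹ π⁻¹ := fun i => by
    apply w.injective
    rw [← hw]
    simp
  have hsupp (j : ι) : π j ∈ b.support ↔ j ∈ b'.support := by
    refine ⟨mem_support_of_isPos_iff hw hpos, fun hj => ?_⟩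
    refine mem_support_of_isPos_iff (b := b') (b' := b) hw' (fun i => ?_) (by simpa using hj)
    rw [hpos]; simp
  obtain ⟨f, -, -, hf⟩ := b'.exists_root_eq_sum_int i
  have hf' : P.root (π i) = ∑ j ∈ b.support, f (π⁻¹ j) • P.root j := by
    rw [hw, hf, map_sum]
    refine Finset.sum_nbij' (fun j => π j) (fun j => π⁻¹ j) ?_ ?_ ?_ ?_ ?_
    · exact fun j hj => (hsupp j).2 hj
    · exact fun j hj => (hsupp _).1 (by simpa using hj)
    · simp
    · simp
    · intro j _
      rw [map_zsmul, hw]; simp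
  rw [RootPairing.Base.height_eq_sum hf, RootPairing.Base.height_eq_sum hf']
  refine Finset.sum_nbij' (fun j => π j) (fun j => π⁻¹ j) ?_ ?_ ?_ ?_ ?_
  · exact fun j hj => (hsupp j).2 hj
  · exact fun j hj => (hsupp _).1 (by simpa using hj)
  · simp
  · simp
  · simp

omit [P.IsRootSystem] in
/-- Any two bases are conjugate: among the products `π` of reflections, one that minimizes the
number of `i` with `π i` positive for `b` but `i` not positive for `b'` matches the two sets of
positive roots, because composing with a simple reflection lowers a nonzero number by one. -/
theorem exists_height_eq (b b' : P.Base) : ∃ π : Equiv.Perm ι, ∀ i,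
    b'.height i = b.height (π i) := by
  classical
  let := P.indexNeg
  have hnegroot (i : ι) : P.root (-i) = -P.root i := by simp
  let bad (π : Equiv.Perm ι) : Finset ι := {i | b.IsPos (π i) ∧ ¬ b'.IsPos i}
  suffices h : ∀ m, ∀ (w : M ≃ₗ[ℝ] M) (π : Equiv.Perm ι), PermutesRoots P w π →
      (bad π).card = m → ∃ (w : M ≃ₗ[ℝ] M) (π : Equiv.Perm ι), PermutesRoots P w π ∧
        ∀ i, b'.IsPos i ↔ b.IsPos (π i) by
    obtain ⟨w, π, hw, hpos⟩ := h _ 1 1 PermutesRoots.one rfl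
    exact ⟨π, height_eq_of_isPos_iff hw hpos⟩
  intro m
  induction m with
  | zero =>
    intro w π hw hcard
    refine ⟨w, π, hw, fun i => ?_⟩
    have hsub (j : ι) (hj : b.IsPos (π j)) : b'.IsPos j := by
      by_contra hne
      have : j ∈ bad π := by simp [bad, hj, hne]
      rw [Finset.card_eq_zero.1 hcard] at this
      simp at this
    refine ⟨fun hi => ?_, hsub i⟩
    by_contra hne
    have hneg : π (-i) = -π i := by
      apply P.root.injective
      rw [hw, hnegroot, hnegroot, hw, map_neg]
    have := hsub (-i) (by rw [hneg]; exact (RootPairing.Base.IsPos.neg_iff_not b _).2 hne)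
    exact (RootPairing.Base.IsPos.neg_iff_not b' i).1 this hi
  | succ m ih =>
    intro w π hw hcard
    have hneg (i : ι) : π (-i) = -π i := by
      apply P.root.injective
      rw [hw, hnegroot, hnegroot, hw, map_neg]
    -- some simple root of `b` is the image of a root which is not positive for `b'`
    obtain ⟨k, hk, hkneg⟩ : ∃ k, π k ∈ b.support ∧ ¬ b'.IsPos k := by
      by_contra! hall
      have hpos (j : ι) (hj : b.IsPos j) : b'.IsPos (π⁻¹ j) := by
        refine hj.induction_on_add (p := fun j => b'.IsPos (π⁻¹ j)) ?_ ?_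
        · exact fun j hj => hall _ (by simpa using hj)
        · intro i j l hl hi hj
          refine hi.add (hall (π⁻¹ j) (by simpa using hj)) ?_
          apply w.injective
          rw [map_add, ← hw, ← hw, ← hw]
          simpa using hl
      have : bad π = ∅ := by
        ext i
        simp only [bad, Finset.mem_filter, Finset.mem_univ, true_and, Finset.notMem_empty,
          iff_false, not_and, not_not]
        intro hi
        simpa using hpos _ hi
      rw [this] at hcard
      simp at hcard
    -- composing with the reflection at this simple root removes `k` from the bad set
    refine ih _ _ ((permutesRoots_reflection (P := P) (π k)).mul hw) ?_
    have hkpos : b.IsPos (π k) := RootPairing.Base.isPos_of_mem_support hk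
    have hrefl (j : ι) : b.IsPos (P.reflectionPerm (π k) j) ↔
        (b.IsPos j ∧ j ≠ π k) ∨ j = -π k := by
      have hself : P.reflectionPerm (π k) (π k) = -π k := rfl
      have hself' : P.reflectionPerm (π k) (-π k) = π k := by
        rw [← hself]; exact P.reflectionPerm_self (π k) (π k)
      constructor
      · intro h
        by_cases h1 : j = -π k
        · exact Or.inr h1
        · refine Or.inl ⟨?_, ?_⟩
          · have h2 : P.reflectionPerm (π k) j ≠ π k := by
              intro h3
              have h4 := congrArg (P.reflectionPerm (π k)) h3
              rw [P.reflectionPerm_self, hself] at h4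
              exact h1 h4
            simpa using h.reflectionPerm hk h2
          · rintro rfl
            rw [hself] at h
            exact (RootPairing.Base.IsPos.neg_iff_not b _).1 h hkpos
      · rintro (⟨h1, h2⟩ | rfl)
        · exact h1.reflectionPerm hk h2
        · rw [hself']; exact hkpos
    have : bad (P.reflectionPerm (π k) * π) = (bad π).erase k := by
      ext i
      simp only [bad, Finset.mem_filter, Finset.mem_univ, true_and, Finset.mem_erase,
        Equiv.Perm.mul_apply, hrefl, ne_eq, π.injective.eq_iff]
      constructor
      · rintro ⟨⟨h1, h2⟩ | h1, h3⟩
        · exact ⟨h2, h1, h3⟩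
        · rw [← hneg, π.injective.eq_iff] at h1
          rw [h1, RootPairing.Base.IsPos.neg_iff_not] at h3
          exact absurd hkneg h3
      · rintro ⟨h1, h2, h3⟩
        exact ⟨Or.inl ⟨h2, h1⟩, h3⟩
    rw [this, Finset.card_erase_of_mem (by simp [bad, hkpos, hkneg]), hcard]
    rfl

omit [P.IsRootSystem] in
theorem prod_height_eq (b b' : P.Base) {R : Type*} [CommMonoid R] (F : ℤ → R) :
    ∏ i, F (b'.height i) = ∏ i, F (b.height i) := by
  obtain ⟨π, hπ⟩ := exists_height_eq b b'
  simp only [hπ]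
  exact Equiv.prod_comp π fun i => F (b.height i)

omit [P.IsRootSystem] in
/-- Heights of the roots from an explicit model of the root system: `e` embeds the root space into
`V`, the simple reflections become the maps `T k`, the vectors `φ s` with `s ∈ S` are images of
roots, and the set of all `±φ s` contains the simple roots and is stable under the `T k`. Then the
`φ s` are the positive roots. -/
theorem prod_height_of_model (b : P.Base) {V : Type*} [AddCommGroup V] [Module ℝ V]
    (e : M →ₗ[ℝ] V) (he : Function.Injective e) (H : V →ₗ[ℝ] ℝ)
    (hH : ∀ k ∈ b.support, H (e (P.root k)) = 1) (T : b.support → V → V)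
    (hT : ∀ (k : b.support) x, e (P.reflection k x) = T k (e x))
    (hTneg : ∀ k x, T k (-x) = -T k x) {β : Type*} (S : Finset β)
    (φ : β → V) (g : β → ℤ) (hinj : Set.InjOn φ S) (hg : ∀ s ∈ S, H (φ s) = g s)
    (hg0 : ∀ s ∈ S, 0 < g s) (hroot : ∀ s ∈ S, ∃ i, e (P.root i) = φ s)
    (hsimple : ∀ k ∈ b.support, ∃ s ∈ S, e (P.root k) = φ s)
    (hcl : ∀ k, ∀ s ∈ S, ∃ s' ∈ S, T k (φ s) = φ s' ∨ T k (φ s) = -φ s')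
    {R : Type*} [CommMonoid R] (F : ℤ → R) :
    ∏ i, F (b.height i) = ∏ s ∈ S, F (g s) * F (-g s) := by
  classical
  let := P.indexNeg
  have hht (i : ι) : (b.height i : ℝ) = H (e (P.root i)) := by
    obtain ⟨f, -, -, hf⟩ := b.exists_root_eq_sum_int i
    rw [RootPairing.Base.height_eq_sum hf, hf, map_sum, map_sum, Int.cast_sum]
    refine Finset.sum_congr rfl fun j hj => ?_
    rw [map_zsmul, map_zsmul, hH j hj]
    simp
  have hex (i : ι) : ∃ s ∈ S, e (P.root i) = φ s ∨ e (P.root i) = -φ s := by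
    refine b.induction_reflect i (p := fun i => ∃ s ∈ S, e (P.root i) = φ s ∨
      e (P.root i) = -φ s) ?_ ?_ ?_
    · rintro i ⟨s, hs, h⟩
      refine ⟨s, hs, ?_⟩
      rw [P.root_reflectionPerm, P.reflection_apply_self, map_neg]
      rcases h with h | h
      · exact Or.inr (by rw [h])
      · exact Or.inl (by rw [h, neg_neg])
    · intro k hk
      obtain ⟨s, hs, h⟩ := hsimple k hk
      exact ⟨s, hs, Or.inl h⟩
    · rintro i j ⟨s, hs, h⟩ hj
      obtain ⟨s', hs', h'⟩ := hcl ⟨j, hj⟩ s hs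
      refine ⟨s', hs', ?_⟩
      have h1 := hT ⟨j, hj⟩ (P.root i)
      rw [P.root_reflectionPerm, h1]
      rcases h with h | h
      · rw [h]; exact h'
      · rw [h, hTneg, neg_eq_iff_eq_neg, neg_inj]; exact h'.symm
  have hposex (i : ι) (hi : 0 < b.height i) : ∃ s ∈ S, e (P.root i) = φ s := by
    obtain ⟨s, hs, h | h⟩ := hex i
    · exact ⟨s, hs, h⟩
    · exfalso
      have h1 := hht i
      rw [h, map_neg, hg s hs] at h1
      have h2 := hg0 s hs
      have h3 : b.height i = -g s := by exact_mod_cast h1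
      omega
  choose r hr using hroot
  have hrg (s : β) (hs : s ∈ S) : b.height (r s hs) = g s := by
    have h1 := hht (r s hs)
    rw [hr s hs, hg s hs] at h1
    exact_mod_cast h1
  have hpos : ∏ i with 0 < b.height i, F (b.height i) * F (-b.height i) =
      ∏ s ∈ S, F (g s) * F (-g s) := by
    symm
    refine Finset.prod_bij (fun s hs => r s hs) ?_ ?_ ?_ ?_
    · intro s hs
      simp [hrg s hs, hg0 s hs]
    · intro s hs s' hs' h
      refine hinj hs hs' ?_
      rw [← hr s hs, ← hr s' hs', h]
    · intro i hi
      obtain ⟨s, hs, h⟩ := hposex i (by simpa using hi)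
      refine ⟨s, hs, P.root.injective (he ?_)⟩
      rw [hr s hs, h]
    · intro s hs
      rw [hrg s hs]
  rw [← hpos, Finset.prod_mul_distrib,
    ← Finset.prod_filter_mul_prod_filter_not Finset.univ (fun i => 0 < b.height i)]
  congr 1
  refine Finset.prod_nbij' (fun i => -i) (fun i => -i) ?_ ?_ ?_ ?_ ?_
  · intro i hi
    have := b.height_ne_zero i
    simp only [Finset.mem_filter, Finset.mem_univ, true_and, b.height_reflectionPerm_self] at hi ⊢
    omega
  · intro i hi
    simp only [Finset.mem_filter, Finset.mem_univ, true_and, b.height_reflectionPerm_self] at hi ⊢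
    omega
  · exact fun i _ => neg_neg i
  · exact fun i _ => neg_neg i
  · intro i _
    rw [b.height_reflectionPerm_self, neg_neg]

end Heights

open Polynomial

/-! ### Reduction to data of the Dynkin diagram -/

section Assembly

/-- `M` is supported on the Dynkin diagram of the simply laced Cartan matrix `C`, its diagonal
entries are `x + 1`, and the products of opposite entries along the edges are `x * (w i * w j)`.
If the diagram is a tree, these data determine `M.det`. -/
structure IsDiagramMatrix {m : ℕ} (C : Matrix (Fin m) (Fin m) ℤ) (x : ℂ) (w : Fin m → ℂ)
    (M : Matrix (Fin m) (Fin m) ℂ) : Prop where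
  diag : ∀ i, M i i = x + 1
  eq_zero : ∀ i j, i ≠ j → C i j = 0 → M i j = 0
  mul_eq : ∀ i j, C i j = -1 → M i j * M j i = x * (w i * w j)

/-- What has to be known about the simply laced Cartan matrix `C` with Coxeter number `h` and
exponents `E`: a positive solution `z` of the fixed point equation, and the two determinants
supported on the Dynkin diagram with the weights `z / (1 + z)` and `1`. The second one is the
characteristic polynomial `χ` of a Coxeter element; the last two fields identify its order as `h`.
The first one is only needed for `x` outside of a finite set. -/
structure DiagramData {m : ℕ} (C : Matrix (Fin m) (Fin m) ℤ) (h : ℕ) (E : Multiset ℕ)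
    (z : Fin m → ℝ) (χ : ℂ[X]) : Prop where
  symm : ∀ i j, C i j = C j i
  diag : ∀ i, C i i = 2
  offDiag : ∀ i j, i ≠ j → C i j = 0 ∨ C i j = -1
  card_exponents : E.card = m
  exponent_lt : ∀ k ∈ E, k < h
  map_sub_exponents : E.map (fun k => h - k) = E
  pos : ∀ i, 0 < z i
  sq_eq : ∀ k, z k ^ 2 = ∏ j, if C j k = -1 then 1 + z j else 1
  det_weighted : ∀ x : ℂ, x ^ (h + 2) ≠ 1 → ∀ M,
    IsDiagramMatrix C x (fun i => ((z i / (1 + z i) : ℝ) : ℂ)) M →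
      M.det = (E.map fun k =>
        x - Complex.exp (2 * Real.pi * Complex.I / ((h : ℂ) + 2)) ^ (k + 1)).prod
  det_one : ∀ x : ℂ, ∀ M, IsDiagramMatrix C x (fun _ => 1) M → M.det = χ.eval x
  dvd : ∃ r, χ ∣ (X ^ h - 1) ^ r
  isRoot : χ.IsRoot (Complex.exp (2 * Real.pi * Complex.I / h))

/-- If `F` has period `h + 2`, then the factors at `1, …, h + 1` are, for each exponent `m`, those at
`1, …, m`, the one at `m + 1`, and those at `-1, …, -(h - m)`. As `h - m` runs over the exponents as
well, the latter can be collected over `-1, …, -m` instead. -/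
theorem prod_exponents_mul {R : Type*} [CommMonoid R] {E : Multiset ℕ} {h : ℕ}
    (hE : ∀ k ∈ E, k < h) (hsymm : E.map (fun k => h - k) = E) (F : ℤ → R)
    (hF : ∀ k, F (-k) = F (h + 2 - k)) :
    (E.map fun m : ℕ => F ((m : ℤ) + 1)).prod *
      (E.map fun m : ℕ => ∏ k ∈ Finset.range m, F ((k : ℤ) + 1) * F (-((k : ℤ) + 1))).prod =
      (∏ k ∈ Finset.range (h + 1), F (k + 1)) ^ E.card := by
  have h1 : (E.map fun m : ℕ => ∏ k ∈ Finset.range m, F (-((k : ℤ) + 1))).prod =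
      (E.map fun m : ℕ => ∏ k ∈ Finset.range (h - m), F (-((k : ℤ) + 1))).prod := by
    conv_lhs => rw [← hsymm]
    rw [Multiset.map_map]
    rfl
  simp only [Finset.prod_mul_distrib, Multiset.prod_map_mul]
  rw [h1, ← Multiset.prod_map_mul, ← Multiset.prod_map_mul, ← Multiset.prod_replicate,
    ← Multiset.map_const]
  congr 1
  refine Multiset.map_congr rfl fun m hm => ?_
  have hm := hE m hm
  have h2 : ∏ k ∈ Finset.range (h - m), F (-((k : ℤ) + 1)) =
      ∏ k ∈ Finset.range (h - m), F (((m + 1 + k : ℕ) : ℤ) + 1) := by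
    rw [← Finset.prod_range_reflect]
    refine Finset.prod_congr rfl fun k hk => ?_
    have hk := Finset.mem_range.1 hk
    rw [hF]
    congr 1
    have : ((h - m - 1 - k : ℕ) : ℤ) = h - m - 1 - k := by omega
    rw [this]; push_cast; ring
  rw [h2, Function.const_apply]
  have h3 : h + 1 = m + 1 + (h - m) := by omega
  rw [h3, Finset.prod_range_add _ (m + 1), Finset.prod_range_succ, mul_comm (F _), mul_assoc,
    mul_comm _ (F _), mul_assoc]

theorem geom_sum_eq_prod {N : ℕ} {ζ : ℂ} (hζ : IsPrimitiveRoot ζ (N + 1)) (x : ℂ) :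
    ∑ i ∈ Finset.range (N + 1), x ^ i = ∏ k ∈ Finset.range N, (x - ζ ^ (k + 1)) := by
  have h1 : (X ^ (N + 1) - 1 : ℂ[X]) = ∏ k ∈ Finset.range (N + 1), (X - C (ζ ^ k)) := by
    have h2 := (X_pow_sub_one_splits hζ).eq_prod_roots_of_monic
      (monic_X_pow_sub_C (1 : ℂ) (Nat.succ_ne_zero N))
    have h3 : (X ^ (N + 1) - 1 : ℂ[X]).roots = (Multiset.range (N + 1)).map fun k => ζ ^ k := by
      have := hζ.nthRoots_eq (one_pow (N + 1))
      rw [nthRoots, C_1] at this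
      rw [this]; simp
    rw [C_1, h3] at h2
    rw [h2, Multiset.map_map]
    rfl
  have h4 : (X - 1 : ℂ[X]) * ∑ i ∈ Finset.range (N + 1), X ^ i =
      (X - 1) * ∏ k ∈ Finset.range N, (X - C (ζ ^ (k + 1))) := by
    rw [mul_geom_sum, h1, Finset.prod_range_succ', pow_zero, C_1, mul_comm]
  have h5 := mul_left_cancel₀ (X_sub_C_ne_zero (1 : ℂ)) h4
  simpa [eval_finsetSum, eval_prod] using congrArg (eval x) h5

variable {ι M N : Type*} [Fintype ι] [AddCommGroup M] [Module ℝ M] [AddCommGroup N] [Module ℝ N]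

omit [Fintype ι] in
theorem initialMatrix_eq (P : RootPairing ι ℝ M N) [P.IsCrystallographic] (b : P.Base) {n : ℕ}
    (e : Fin n ≃ b.support) :
    initialMatrix b e = skewMatrix (Matrix.of fun i j => b.cartanMatrix (e j) (e i)) := by
  ext i j
  simp [initialMatrix, skewMatrix]

/-- Existence and uniqueness of the fixed point and Mizuno's formula for a root system whose Cartan
matrix agrees with `C` up to a renumbering `f`, and the heights of whose positive roots are
`1, …, m` for every exponent `m`. -/
theorem mizuno_of_diagramData (P : RootPairing ι ℝ M N) [P.IsRootSystem]
    [P.IsCrystallographic] [P.IsReduced] (b : P.Base) {n : ℕ} (e : Fin n ≃ b.support) (b' : P.Base)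
    {m : ℕ} {C : Matrix (Fin m) (Fin m) ℤ} {h₀ : ℕ} {E : Multiset ℕ} {z : Fin m → ℝ} {χ : ℂ[X]}
    (D : DiagramData C h₀ E z χ) (f : b.support ≃ Fin m) (hf : b.cartanMatrix.reindex f f = C)
    (hheight : ∀ F : ℤ → ℂ, ∏ i, F (b.height i) =
      (E.map fun m : ℕ => ∏ k ∈ Finset.range m, F ((k : ℤ) + 1) * F (-((k : ℤ) + 1))).prod)
    (h : ℕ) (hh : h = coxeterNumber b e)
    (ζ : ℂ) (hζ : ζ = Complex.exp (2 * Real.pi * Complex.I / ((h : ℂ) + 2))) :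
    ∃ hred : IsReddeningTriple (initialMatrix b e) (List.finRange n) 1,
      (∃! p, DTX hred p = p) ∧
      ∀ p, DTX hred p = p → ∀ t : List (Fin n),
        ∃ L : (Fin n → ℝ) →L[ℝ] (Fin n → ℝ),
          IsLinearizationAt (DTX hred) p t L ∧
          (((X ^ (h + 2) - 1) / (X - 1) : Polynomial ℂ)) ^ n =
            (LinearMap.charpoly (L : (Fin n → ℝ) →ₗ[ℝ] (Fin n → ℝ))).map (algebraMap ℝ ℂ) *
              ∏ i : ι, (X - Polynomial.C (ζ ^ b'.height i)) := by
  let g : Fin n ≃ Fin m := e.trans f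
  have hbC (i j : Fin n) : b.cartanMatrix (e j) (e i) = C (g j) (g i) := by
    rw [← hf]; simp [g]
  have hA' (i j : Fin m) (hij : i ≠ j) : C i j ≤ 0 := by
    rcases D.offDiag i j hij with h | h <;> omega
  have hmn : m = n := by simpa using (Fintype.card_congr g).symm
  -- the Coxeter number
  have hh₀ : h = h₀ := by
    obtain ⟨r, hr⟩ := D.dvd
    -- `h₀ = 0` would force `m = 0`, but then the determinant is `1` while `χ` has a root
    have hpos : h₀ ≠ 0 := by
      intro h0
      rcases Multiset.empty_or_exists_mem E with hE | ⟨k, hk⟩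
      · have hm0 : m = 0 := by rw [← D.card_exponents, hE, Multiset.card_zero]
        have h1 := D.isRoot
        have h2 : IsDiagramMatrix C 1 (fun _ => 1) 1 := by
          subst hm0
          exact ⟨fun i => i.elim0, fun i => i.elim0, fun i => i.elim0⟩
        have h3 := D.det_one 1 1 h2
        rw [h0] at h1
        simp only [IsRoot.def, Nat.cast_zero, div_zero, Complex.exp_zero] at h1
        rw [h1] at h3
        simp at h3
      · exact absurd (D.exponent_lt k hk) (by omega)
    rw [hh]
    refine coxeterNumber_eq b e χ (fun x => ?_) hr (Complex.isPrimitiveRoot_exp h₀ hpos) D.isRoot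
    rw [← Matrix.det_submatrix_equiv_self g.symm]
    refine D.det_one x _ ⟨fun i => by simp, fun i j hij hC => ?_, fun i j hC => ?_⟩
    · have : C j i = 0 := by rw [D.symm, hC]
      simp [hbC, this, hij]
    · have hij : i ≠ j := fun h => by rw [h, D.diag] at hC; omega
      have hC' : C j i = -1 := by rw [D.symm, hC]
      have hij' : g.symm i ≠ g.symm j := fun h => hij (g.symm.injective h)
      rcases lt_or_gt_of_ne hij' with hl | hl <;>
        simp [hbC, hC, hC', hij, hij.symm, hl, hl.not_gt]
  subst hh₀
  rw [initialMatrix_eq]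
  set A : Matrix (Fin n) (Fin n) ℤ := Matrix.of fun i j => b.cartanMatrix (e j) (e i) with hAdef
  have hAC (i j : Fin n) : A i j = C (g j) (g i) := hbC i j
  have hAs (i j : Fin n) : A i j = A j i := by rw [hAC, hAC, D.symm]
  have hA0 (i j : Fin n) (hij : i ≠ j) : A i j ≤ 0 := by
    rw [hAC]; exact hA' _ _ (fun h => hij (g.injective h).symm)
  have hAd (i : Fin n) : A i i = 2 := by rw [hAC, D.diag]
  -- the fixed point, in the variables of the fixed point equation
  let s : Fin n → ℝ := fun k => Real.log (z (g k))
  have hexp (k : Fin n) : Real.exp (s k) = z (g k) := Real.exp_log (D.pos _)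
  have hs : ∀ k, 2 * s k =
      ∑ j, if j = k then 0 else -(A j k : ℝ) * Real.log (1 + Real.exp (s j)) := by
    intro k
    have h1 : 2 * s k = Real.log (z (g k) ^ 2) := by rw [Real.log_pow]; simp [s]
    rw [h1, D.sq_eq, Real.log_prod, ← Equiv.sum_comp g]
    · refine Finset.sum_congr rfl fun j _ => ?_
      rw [hexp, hAs, hAC]
      by_cases hjk : j = k
      · simp [hjk, D.diag]
      · have hne : g j ≠ g k := fun h => hjk (g.injective h)
        rcases D.offDiag _ _ hne with h | h <;> simp [h, hjk]
    · intro j _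
      have := D.pos j
      split_ifs <;> positivity
  have hred := isReddeningTriple_skewMatrix hAs hA0
  have hsfix := (stageLog_eq_iff s).2 hs
  obtain ⟨d, hd, hpd⟩ := cartanMatrix_posDef b e
  have hcoord (p : PositivePoint (skewMatrix A)) (hp : DTX hred p = p) :
      p.coord [] = fun i => Real.exp (stageLog A 0 s i) := by
    obtain ⟨s', hs'⟩ := exists_stageLog_zero_eq A fun i => Real.log (p.coord [] i)
    have h1 : p.coord [] = fun i => Real.exp (stageLog A 0 s' i) := by
      rw [hs']
      funext i
      exact (Real.exp_log (p.pos _ _)).symm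
    rw [DTX_eq_self_iff, h1, mutateWord_finRange hAs hA0] at hp
    have h2 : stageLog A n s' = stageLog A 0 s' := funext fun i =>
      Real.exp_injective (congrFun hp i)
    rw [stageLog_eq_iff] at h2
    rw [h1, fixedPoint_unique hA0 hAd d hd (fun v hv => hpd v ?_) hs h2]
    refine le_trans (le_of_eq ?_) hv
    refine Finset.sum_congr rfl fun k _ => Finset.sum_congr rfl fun j _ => ?_
    rw [hAs j k]; rfl
  refine ⟨hred, ?_, ?_⟩
  · refine ⟨PositivePoint.ofCoord _ (fun i => Real.exp (stageLog A 0 s i))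
      fun i => Real.exp_pos _, ?_, fun p hp => PositivePoint.ext_nil (hcoord p hp)⟩
    dsimp only
    rw [DTX_eq_self_iff]
    have : (PositivePoint.ofCoord (skewMatrix A) (fun i => Real.exp (stageLog A 0 s i))
      fun i => Real.exp_pos _).coord [] = fun i => Real.exp (stageLog A 0 s i) := rfl
    rw [this, mutateWord_finRange hAs hA0, hsfix]
  · intro p hp t
    obtain ⟨L, hL, hch⟩ := exists_isLinearizationAt hred hp t
    refine ⟨L, hL, ?_⟩
    rw [hch, hcoord p hp]
    have hdiv : ((X ^ (h + 2) - 1) / (X - 1) : ℂ[X]) = ∑ i ∈ Finset.range (h + 2), X ^ i := by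
      have h1 : (X - 1 : ℂ[X]) ≠ 0 := X_sub_C_ne_zero (1 : ℂ)
      rw [← mul_geom_sum, mul_div_cancel_left₀ _ h1]
    rw [hdiv]
    have hζp : IsPrimitiveRoot ζ (h + 1 + 1) := by
      have := Complex.isPrimitiveRoot_exp (h + 1 + 1) (by omega)
      rw [hζ]
      convert this using 3
      push_cast; ring
    -- both sides agree at the infinitely many points which are not roots of unity of order `h + 2`
    refine Polynomial.eq_of_infinite_eval_eq _ _
      (Set.Infinite.mono (s := {x : ℂ | x ^ (h + 2) = 1}ᶜ) ?_ (Set.Finite.infinite_compl ?_))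
    · intro x hx
      have hx : x ^ (h + 2) ≠ 1 := hx
      simp only [Set.mem_ofPred_eq, eval_mul, eval_pow, eval_finsetSum, eval_X, eval_prod, eval_sub,
        eval_C]
      rw [eval_charpoly_fderiv hAs hA0 hsfix, prod_height_eq b b' fun k => x - ζ ^ k,
        hheight fun k => x - ζ ^ k, geom_sum_eq_prod hζp, ← Matrix.det_submatrix_equiv_self g.symm, D.det_weighted x hx]
      · have := prod_exponents_mul (E := E) D.exponent_lt D.map_sub_exponents (fun k => x - ζ ^ k)
          (fun k => by
            have h0 : ζ ≠ 0 := hζp.ne_zero (by omega)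
            have h1 : ζ ^ ((h : ℤ) + 2) = 1 := by
              have := hζp.pow_eq_one
              rw [← this]; norm_cast
            rw [zpow_sub₀ h0, h1, zpow_neg, one_div])
        rw [D.card_exponents, hmn] at this
        rw [← hζ]
        refine Eq.trans ?_ (this.symm.trans ?_)
        · norm_cast
        · norm_cast
      · refine ⟨fun i => by simp, fun i j hij hC => ?_, fun i j hC => ?_⟩
        · simp [hAC, hC, hij]
        · have hij : i ≠ j := fun h => by rw [h, D.diag] at hC; omega
          have hC' : C j i = -1 := by rw [D.symm, hC]
          have hij' : g.symm i ≠ g.symm j := fun h => hij (g.symm.injective h)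
          rcases lt_or_gt_of_ne hij' with hl | hl <;>
            simp [hAC, hC, hC', hij, hij.symm, hl, hl.not_gt, hexp] <;> ring
    · have h1 : (X ^ (h + 2) - 1 : ℂ[X]) ≠ 0 := X_pow_sub_C_ne_zero (by omega) 1
      refine (Polynomial.finite_setOfPred_isRoot h1).subset fun x hx => ?_
      have hx : x ^ (h + 2) = 1 := hx
      simp [hx]

end Assembly

/-! ### Heights from explicit models -/

section HeightModel

variable {ι M N : Type*} [Fintype ι] [AddCommGroup M] [Module ℝ M] [AddCommGroup N] [Module ℝ N]
  {P : RootPairing ι ℝ M N} [P.IsRootSystem] [P.IsCrystallographic] [P.IsReduced]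

/-- Heights computed in a concrete model of a root system with Cartan matrix `C`: the vectors `v k`
are the simple roots, the `T k` the simple reflections and the `φ s`, `s ∈ S`, of height `g s` the
positive roots. It suffices that every `φ s` arises from simple roots by reflections which raise the
height, and that the reflections preserve these vectors up to sign. -/
theorem prod_height_of_vectors (b : P.Base) {m : ℕ} {C : Matrix (Fin m) (Fin m) ℤ}
    (f : b.support ≃ Fin m) (hf : b.cartanMatrix.reindex f f = C)
    {V : Type*} [AddCommGroup V] [Module ℝ V] (v : Fin m → V)
    (H : V →ₗ[ℝ] ℝ) (hH : ∀ k, H (v k) = 1) (T : Fin m → V →ₗ[ℝ] V)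
    (hT : ∀ k j, T k (v j) = v j - (C j k : ℝ) • v k) {β : Type*} (S : Finset β)
    (φ : β → V) (g : β → ℕ) (hinj : Set.InjOn φ S) (hg : ∀ s ∈ S, H (φ s) = g s)
    (hg0 : ∀ s ∈ S, 0 < g s) (hsimple : ∀ k, ∃ s ∈ S, v k = φ s)
    (hroot : ∀ s ∈ S, (∃ k, φ s = v k) ∨ ∃ k, ∃ s' ∈ S, g s' < g s ∧ φ s = T k (φ s'))
    (hcl : ∀ k, ∀ s ∈ S, ∃ s' ∈ S, T k (φ s) = φ s' ∨ T k (φ s) = -φ s')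
    {R : Type*} [CommMonoid R] (F : ℤ → R) :
    ∏ i, F (b.height i) = ∏ s ∈ S, F (g s) * F (-(g s)) := by
  have hC (i j : b.support) : b.cartanMatrix i j = C (f i) (f j) := by rw [← hf]; simp
  let B := b.toWeightBasis.reindex f
  have hB (i : b.support) : B (f i) = P.root i := by simp [B]
  let e : M →ₗ[ℝ] V := B.constr ℝ v
  have heB (k : Fin m) : e (B k) = v k := B.constr_basis ℝ v k
  have he (i : b.support) : e (P.root i) = v (f i) := by rw [← hB, heB]
  have heT (k : b.support) (x : M) : e (P.reflection k x) = T (f k) (e x) := by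
    have : e ∘ₗ (P.reflection k : M →ₗ[ℝ] M) = T (f k) ∘ₗ e := by
      refine B.ext fun j => ?_
      obtain ⟨j, rfl⟩ := f.surjective j
      simp only [LinearMap.comp_apply, LinearEquiv.coe_coe, heB]
      rw [hB, P.reflection_apply_root, map_sub, map_smul, he, he, hT, ← hC, cast_cartanMatrix]
    exact LinearMap.congr_fun this x
  refine prod_height_of_model b e ?_ H ?_ (fun k => T (f k)) heT (fun k x => map_neg _ _) S φ
    (fun s => (g s : ℤ)) hinj (by simpa using hg) (by simpa using hg0) ?_ ?_ (fun k => hcl (f k)) F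
  · rw [← LinearMap.ker_eq_bot, LinearMap.ker_eq_bot']
    intro x hx
    have h1 : e x = ∑ k, B.repr x k • v k := by
      rw [Module.Basis.constr_apply_fintype]; rfl
    -- a linear relation between the `v k` lies in the kernel of the Cartan matrix
    have h2 (k : Fin m) : ∑ j, B.repr x j * (C j k : ℝ) = 0 := by
      have h3 : T k (e x) = e x - (∑ j, B.repr x j * (C j k : ℝ)) • v k := by
        rw [h1, map_sum, Finset.sum_smul, ← Finset.sum_sub_distrib]
        refine Finset.sum_congr rfl fun j _ => ?_
        rw [map_smul, hT, smul_sub, smul_smul]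
      have h4 := congrArg H h3
      simpa [hx, hH] using h4
    obtain ⟨d, -, hpd⟩ := cartanMatrix_posDef b f.symm
    have h5 := hpd (fun k => B.repr x k) (le_of_eq ?_)
    · exact B.ext_elem fun k => by simpa using congrFun h5 k
    · refine Finset.sum_eq_zero fun k _ => ?_
      have (j : Fin m) : B.repr x k * ((b.cartanMatrix (f.symm j) (f.symm k) : ℤ) * d k) *
          B.repr x j = B.repr x k * d k * (B.repr x j * (C j k : ℝ)) := by
        rw [hC, Equiv.apply_symm_apply, Equiv.apply_symm_apply]; ring
      simp_rw [this]
      rw [← Finset.mul_sum, h2, mul_zero]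
  · intro k hk
    rw [he ⟨k, hk⟩, hH]
  -- by induction on the height, every `φ s` is the image of a root
  · have key : ∀ N, ∀ s ∈ S, g s = N → ∃ i, e (P.root i) = φ s := by
      intro N
      induction N using Nat.strong_induction_on with
      | _ N ih =>
        intro s hs hN
        rcases hroot s hs with ⟨k, hk⟩ | ⟨k, s', hs', hlt, hk⟩
        · exact ⟨f.symm k, by rw [he, hk, Equiv.apply_symm_apply]⟩
        · obtain ⟨i, hi⟩ := ih (g s') (hN ▸ hlt) s' hs' rfl
          refine ⟨P.reflectionPerm (f.symm k) i, ?_⟩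
          rw [P.root_reflectionPerm, heT, hi, hk, Equiv.apply_symm_apply]
    exact fun s hs => key _ s hs rfl
  · intro k hk
    rw [he ⟨k, hk⟩]
    exact hsimple _

end HeightModel

/-! ### Heights in type A -/

section TypeAHeights

/-- The standard basis vector `ε_a`. -/
def stdVec (a : ℕ) : ℕ → ℝ := Pi.single a 1

theorem stdVec_apply (a c : ℕ) : stdVec a c = if c = a then 1 else 0 := Pi.single_apply _ _ _

/-- The reflection which interchanges `ε_p` and `ε_{p+1}`. -/
def swapReflection (p : ℕ) : (ℕ → ℝ) →ₗ[ℝ] (ℕ → ℝ) :=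
  LinearMap.funLeft ℝ ℝ (Equiv.swap p (p + 1))

theorem swapReflection_stdVec (p a : ℕ) :
    swapReflection p (stdVec a) = stdVec (Equiv.swap p (p + 1) a) := by
  funext c
  simp only [swapReflection, LinearMap.funLeft_apply, stdVec_apply]
  congr 1
  rw [eq_iff_iff, Equiv.swap_apply_eq_iff]

theorem swapReflection_sub (p q : ℕ) :
    swapReflection p (stdVec (q + 1) - stdVec q) = stdVec (q + 1) - stdVec q -
      (if q = p then 2 else if q + 1 = p ∨ p + 1 = q then -1 else 0 : ℝ) •
        (stdVec (p + 1) - stdVec p) := by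
  rw [map_sub, swapReflection_stdVec, swapReflection_stdVec]
  by_cases h1 : q = p
  · subst h1
    rw [if_pos rfl, Equiv.swap_apply_left, Equiv.swap_apply_right]
    module
  rw [if_neg h1]
  by_cases h2 : q + 1 = p
  · subst h2
    rw [if_pos (Or.inl rfl), Equiv.swap_apply_left, Equiv.swap_apply_of_ne_of_ne (by omega)
      (by omega)]
    module
  by_cases h3 : p + 1 = q
  · subst h3
    rw [if_pos (Or.inr rfl), Equiv.swap_apply_right, Equiv.swap_apply_of_ne_of_ne (by omega)
      (by omega)]
    module
  · rw [if_neg (by tauto), Equiv.swap_apply_of_ne_of_ne (by omega) (by omega),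
      Equiv.swap_apply_of_ne_of_ne (by omega) (by omega)]
    module

/-- The height functional: the vector `ε_a` has height `a`, for `a < N`. -/
def stdHeight (N : ℕ) : (ℕ → ℝ) →ₗ[ℝ] ℝ :=
  ∑ a ∈ Finset.range N, (a : ℝ) • LinearMap.proj a

theorem stdHeight_stdVec {N a : ℕ} (ha : a < N) : stdHeight N (stdVec a) = a := by
  simp [stdHeight, stdVec_apply, ha]

variable {ι M N : Type*} [Fintype ι] [AddCommGroup M] [Module ℝ M] [AddCommGroup N] [Module ℝ N]
  {P : RootPairing ι ℝ M N} [P.IsRootSystem] [P.IsCrystallographic] [P.IsReduced]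

/-- The positive roots are the vectors `ε_a - ε_b` with `b < a ≤ n`, of height `a - b`. -/
theorem prod_height_typeA (b : P.Base) {n : ℕ} (f : b.support ≃ Fin n)
    (hf : b.cartanMatrix.reindex f f = CartanMatrix.A n) {R : Type*} [CommMonoid R] (F : ℤ → R) :
    ∏ i, F (b.height i) = (((Multiset.range n).map (· + 1)).map fun m : ℕ =>
      ∏ k ∈ Finset.range m, F ((k : ℤ) + 1) * F (-((k : ℤ) + 1))).prod := by
  rw [prod_height_of_vectors b f hf (fun k => stdVec (k + 1) - stdVec k) (stdHeight (n + 1)) ?_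
    (fun k => swapReflection k) ?_ ((Finset.range (n + 1)).sigma Finset.range)
    (fun s => stdVec s.1 - stdVec s.2) (fun s => s.1 - s.2) ?_ ?_ ?_ ?_ ?_ ?_ F]
  · rw [Finset.prod_sigma, Finset.prod_range_succ', Finset.range_zero, Finset.prod_empty, mul_one,
      Multiset.map_map]
    refine Finset.prod_congr rfl fun m _ => ?_
    rw [← Finset.prod_range_reflect]
    refine Finset.prod_congr rfl fun k hk => ?_
    have hk : k < m + 1 := Finset.mem_range.1 hk
    have : ((m + 1 - (m + 1 - 1 - k) : ℕ) : ℤ) = k + 1 := by omega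
    dsimp only
    rw [this]
  · intro k
    rw [map_sub, stdHeight_stdVec (by omega), stdHeight_stdVec (by omega)]
    push_cast; ring
  · intro k j
    rw [swapReflection_sub]
    congr 2
    simp only [CartanMatrix.A, Matrix.of_apply, Fin.ext_iff]
    split_ifs <;> simp
  · rintro ⟨a, b⟩ hs ⟨a', b'⟩ hs' h
    simp only [Finset.coe_sigma, Set.mem_sigma_iff, Finset.mem_coe, Finset.mem_range] at hs hs'
    have h1 := congrFun h a
    have h2 := congrFun h b
    simp only [Pi.sub_apply, stdVec_apply] at h1 h2
    grind
  · rintro ⟨a, b⟩ hs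
    simp only [Finset.mem_sigma, Finset.mem_range] at hs
    dsimp only
    rw [map_sub, stdHeight_stdVec (by omega), stdHeight_stdVec (by omega), Nat.cast_sub hs.2.le]
  · rintro ⟨a, b⟩ hs
    simp only [Finset.mem_sigma, Finset.mem_range] at hs
    simp only; omega
  · intro k
    exact ⟨⟨k + 1, k⟩, by simp, rfl⟩
  · rintro ⟨a, b⟩ hs
    simp only [Finset.mem_sigma, Finset.mem_range] at hs
    by_cases hab : a = b + 1
    · exact Or.inl ⟨⟨b, by omega⟩, by simp [hab]⟩
    · refine Or.inr ⟨⟨a - 1, by omega⟩, ⟨a - 1, b⟩, by simp; omega, by simp only; omega, ?_⟩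
      have h1 : a - 1 + 1 = a := by omega
      simp only [map_sub, swapReflection_stdVec, h1]
      rw [Equiv.swap_apply_left, Equiv.swap_apply_of_ne_of_ne (by omega) (by omega)]
  · rintro k ⟨a, b⟩ hs
    simp only [Finset.mem_sigma, Finset.mem_range] at hs
    simp only [map_sub, swapReflection_stdVec]
    have hlt : ∀ c < n + 1, Equiv.swap (k : ℕ) (k + 1) c < n + 1 := fun c hc => by
      have := k.2
      rw [Equiv.swap_apply_def]; split_ifs <;> omega
    have hne : Equiv.swap (k : ℕ) (k + 1) a ≠ Equiv.swap (k : ℕ) (k + 1) b := fun h => by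
      have := (Equiv.swap (k : ℕ) (k + 1)).injective h
      omega
    rcases lt_or_gt_of_ne hne with h | h
    · exact ⟨⟨_, _⟩, Finset.mem_sigma.2 ⟨Finset.mem_range.2 (hlt b (by omega)),
        Finset.mem_range.2 h⟩, Or.inr (neg_sub _ _).symm⟩
    · exact ⟨⟨_, _⟩, Finset.mem_sigma.2 ⟨Finset.mem_range.2 (hlt a (by omega)),
        Finset.mem_range.2 h⟩, Or.inl rfl⟩

end TypeAHeights

/-! ### Heights in type D -/

section TypeDHeights

/-- The reflection which interchanges `ε_0` and `-ε_1`. -/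
def negSwapReflection : (ℕ → ℝ) →ₗ[ℝ] (ℕ → ℝ) where
  toFun x a := if a = 0 then -x 1 else if a = 1 then -x 0 else x a
  map_add' x y := by
    funext a
    simp only [Pi.add_apply]
    split_ifs <;> ring
  map_smul' c x := by
    funext a
    simp only [Pi.smul_apply, smul_eq_mul, RingHom.id_apply]
    split_ifs <;> ring

theorem negSwapReflection_zero : negSwapReflection (stdVec 0) = -stdVec 1 := by
  funext a
  simp only [negSwapReflection, LinearMap.coe_mk, AddHom.coe_mk, stdVec_apply, Pi.neg_apply]
  grind

theorem negSwapReflection_one : negSwapReflection (stdVec 1) = -stdVec 0 := by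
  funext a
  simp only [negSwapReflection, LinearMap.coe_mk, AddHom.coe_mk, stdVec_apply, Pi.neg_apply]
  grind

theorem negSwapReflection_of_two_le {c : ℕ} (hc : 2 ≤ c) :
    negSwapReflection (stdVec c) = stdVec c := by
  funext a
  simp only [negSwapReflection, LinearMap.coe_mk, AddHom.coe_mk, stdVec_apply]
  grind

theorem negSwapReflection_sub (q : ℕ) :
    negSwapReflection (stdVec (q + 1) - stdVec q) = stdVec (q + 1) - stdVec q -
      (if q = 1 then -1 else 0 : ℝ) • (stdVec 1 + stdVec 0) := by
  rcases q with _ | _ | q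
  · simp [negSwapReflection_zero, negSwapReflection_one]; abel
  · rw [map_sub, negSwapReflection_one, negSwapReflection_of_two_le (by omega), if_pos rfl]
    module
  · rw [map_sub, negSwapReflection_of_two_le (by omega), negSwapReflection_of_two_le (by omega),
      if_neg (by omega)]
    module

theorem swapReflection_add (p : ℕ) :
    swapReflection p (stdVec 1 + stdVec 0) = stdVec 1 + stdVec 0 -
      (if p = 1 then -1 else 0 : ℝ) • (stdVec (p + 1) - stdVec p) := by
  rw [map_add, swapReflection_stdVec, swapReflection_stdVec]
  rcases p with _ | _ | p
  · simp; abel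
  · rw [Equiv.swap_apply_left, Equiv.swap_apply_of_ne_of_ne (by omega) (by omega), if_pos rfl]
    module
  · rw [Equiv.swap_apply_of_ne_of_ne (by omega) (by omega),
      Equiv.swap_apply_of_ne_of_ne (by omega) (by omega), if_neg (by omega)]
    module

variable {ι M N : Type*} [Fintype ι] [AddCommGroup M] [Module ℝ M] [AddCommGroup N] [Module ℝ N]
  {P : RootPairing ι ℝ M N} [P.IsRootSystem] [P.IsCrystallographic] [P.IsReduced]

/-- The exponents of the root system of type `D_m`. -/
def exponentsD (m : ℕ) : Multiset ℕ :=
  (m - 1) ::ₘ (Multiset.range (m - 1)).map fun k => 2 * k + 1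

/-- The root `ε_a + ε_b` or `ε_a - ε_b` of a root system of type `D`, depending on the sign. -/
def rootD (s : (Σ _ : ℕ, ℕ) × Bool) : ℕ → ℝ :=
  if s.2 then stdVec s.1.1 + stdVec s.1.2 else stdVec s.1.1 - stdVec s.1.2

/-- For fixed `a`, the heights `a - b` and `a + b` with `b < a` run over `1, …, a` and
`a, …, 2 * a - 1`, that is, over `1, …, 2 * a - 1` and `a` once more. The additional numbers `a` make
up the range of the exponent `m - 1`. -/
theorem prod_range_sigma_typeD {R : Type*} [CommMonoid R] (m : ℕ) (G : ℤ → R) :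
    ∏ s ∈ (Finset.range m).sigma Finset.range,
        G ((s.1 + s.2 : ℕ) : ℤ) * G ((s.1 - s.2 : ℕ) : ℤ) =
      ((exponentsD m).map fun m : ℕ => ∏ k ∈ Finset.range m, G ((k : ℤ) + 1)).prod := by
  rcases m with _ | m
  · simp [exponentsD, Finset.prod_sigma]
  rw [Finset.prod_sigma, Finset.prod_range_succ', Finset.range_zero, Finset.prod_empty, mul_one,
    exponentsD, Nat.add_sub_cancel, Multiset.map_cons, Multiset.prod_cons, Multiset.map_map]
  change _ = _ * ∏ k ∈ Finset.range m, ∏ j ∈ Finset.range (2 * k + 1), G ((j : ℤ) + 1)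
  rw [← Finset.prod_mul_distrib]
  refine Finset.prod_congr rfl fun a _ => ?_
  have h1 : 2 * a + 1 = a + (a + 1) := by ring
  rw [Finset.prod_mul_distrib, h1, Finset.prod_range_add (fun j : ℕ => G ((j : ℤ) + 1)) a,
    ← mul_assoc, mul_comm]
  congr 1
  · rw [mul_comm, ← Finset.prod_range_succ (fun j : ℕ => G ((j : ℤ) + 1)),
      ← Finset.prod_range_reflect]
    refine Finset.prod_congr rfl fun k hk => ?_
    have hk : k < a + 1 := Finset.mem_range.1 hk
    dsimp only
    congr 1; omega
  · refine Finset.prod_congr rfl fun k _ => ?_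
    congr 1; push_cast; ring

/-- The positive roots are the vectors `ε_a ± ε_b` with `b < a < m`, of height `a ± b`. The node `k` of
the chain is the simple root `ε_{m-1-k} - ε_{m-2-k}`, and the last node is `ε_1 + ε_0`. -/
theorem prod_height_typeD (b : P.Base) {m : ℕ} (hm : 4 ≤ m) (f : b.support ≃ Fin m)
    (hf : b.cartanMatrix.reindex f f = CartanMatrix.D m) {R : Type*} [CommMonoid R] (F : ℤ → R) :
    ∏ i, F (b.height i) = ((exponentsD m).map fun m : ℕ =>
      ∏ k ∈ Finset.range m, F ((k : ℤ) + 1) * F (-((k : ℤ) + 1))).prod := by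
  rw [prod_height_of_vectors b f hf
    (fun k => if k.1 + 1 = m then stdVec 1 + stdVec 0 else
      stdVec (m - 2 - k + 1) - stdVec (m - 2 - k)) (stdHeight m) ?_
    (fun k => if k.1 + 1 = m then negSwapReflection else swapReflection (m - 2 - k)) ?_
    (((Finset.range m).sigma Finset.range) ×ˢ Finset.univ)
    rootD (fun s => if s.2 then s.1.1 + s.1.2 else s.1.1 - s.1.2) ?_ ?_ ?_ ?_ ?_ ?_ F]
  · rw [← prod_range_sigma_typeD m fun k => F k * F (-k), Finset.prod_product]
    refine Finset.prod_congr rfl fun s _ => ?_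
    rw [Fintype.prod_bool]
    rfl
  · intro k
    split_ifs
    · rw [map_add, stdHeight_stdVec (by omega), stdHeight_stdVec (by omega)]
      simp
    · rw [map_sub, stdHeight_stdVec (by omega), stdHeight_stdVec (by omega)]
      push_cast; ring
  · intro k j
    have hk := k.2
    have hj := j.2
    by_cases h1 : k.1 + 1 = m
    · by_cases h2 : j.1 + 1 = m
      · have : j = k := by omega
        simp only [h1, this, if_true, map_add, negSwapReflection_zero, negSwapReflection_one]
        simp only [CartanMatrix.D, Matrix.of_apply, if_true]
        module
      · simp only [h1, h2, if_true, if_false]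
        rw [negSwapReflection_sub]
        congr 2
        simp only [CartanMatrix.D, Matrix.of_apply, Fin.ext_iff]
        split_ifs <;> first | omega | simp
    · by_cases h2 : j.1 + 1 = m
      · simp only [h1, h2, if_true, if_false]
        rw [swapReflection_add]
        congr 2
        simp only [CartanMatrix.D, Matrix.of_apply, Fin.ext_iff]
        split_ifs <;> first | omega | simp
      · simp only [h1, h2, if_false]
        rw [swapReflection_sub]
        congr 2
        simp only [CartanMatrix.D, Matrix.of_apply, Fin.ext_iff]
        split_ifs <;> first | omega | simp
  · rintro ⟨⟨a, b⟩, s⟩ hs ⟨⟨a', b'⟩, s'⟩ hs' h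
    simp only [Finset.coe_product, Finset.coe_sigma, Set.mem_prod, Set.mem_sigma_iff,
      Finset.mem_coe, Finset.mem_range] at hs hs'
    have h1 := congrFun h a
    have h2 := congrFun h b
    have h3 := congrFun h a'
    have h4 := congrFun h b'
    simp only [rootD] at h1 h2 h3 h4
    cases s <;> cases s' <;> simp [stdVec_apply] at h1 h2 h3 h4 <;> grind
  · rintro ⟨⟨a, b⟩, s⟩ hs
    simp only [Finset.mem_product, Finset.mem_sigma, Finset.mem_range] at hs
    cases s
    · simp only [rootD, Bool.false_eq_true, if_false]
      rw [map_sub, stdHeight_stdVec (by omega), stdHeight_stdVec (by omega),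
        Nat.cast_sub hs.1.2.le]
    · simp only [rootD, if_true]
      rw [map_add, stdHeight_stdVec (by omega), stdHeight_stdVec (by omega), Nat.cast_add]
  · rintro ⟨⟨a, b⟩, s⟩ hs
    simp only [Finset.mem_product, Finset.mem_sigma, Finset.mem_range] at hs
    dsimp only
    split_ifs <;> omega
  · intro k
    by_cases h1 : k.1 + 1 = m
    · refine ⟨(⟨1, 0⟩, true), ?_, by simp [h1, rootD]⟩
      simp; omega
    · refine ⟨(⟨m - 2 - k + 1, m - 2 - k⟩, false), ?_, by simp [h1, rootD]⟩
      simp; omega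
  · rintro ⟨⟨a, b⟩, s⟩ hs
    simp only [Finset.mem_product, Finset.mem_sigma, Finset.mem_range] at hs
    by_cases hab : a = b + 1
    · cases s
      · refine Or.inl ⟨⟨m - 2 - b, by omega⟩, ?_⟩
        have h1 : ¬ m - 2 - b + 1 = m := by omega
        have h2 : m - 2 - (m - 2 - b) = b := by omega
        simp [rootD, h1, h2, hab]
      -- `ε_{b+1} + ε_b` arises from `ε_{b+1} + ε_{b-1}`
      · rcases b with _ | b
        · refine Or.inl ⟨⟨m - 1, by omega⟩, ?_⟩
          have h1 : m - 1 + 1 = m := by omega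
          simp [rootD, h1, hab]
        · refine Or.inr ⟨⟨m - 2 - b, by omega⟩, (⟨a, b⟩, true), ?_, by simp, ?_⟩
          · simp; omega
          · have h1 : ¬ m - 2 - b + 1 = m := by omega
            have h2 : m - 2 - (m - 2 - b) = b := by omega
            simp only [rootD, h1, h2, if_true, if_false, map_add, swapReflection_stdVec]
            rw [Equiv.swap_apply_left, Equiv.swap_apply_of_ne_of_ne (by omega) (by omega)]
    · refine Or.inr ⟨⟨m - 2 - (a - 1), by omega⟩, (⟨a - 1, b⟩, s), ?_, ?_, ?_⟩
      · simp; omega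
      · dsimp only; split_ifs <;> omega
      · have h1 : ¬ m - 2 - (a - 1) + 1 = m := by omega
        have h2 : m - 2 - (m - 2 - (a - 1)) = a - 1 := by omega
        have h3 : a - 1 + 1 = a := by omega
        simp only [rootD, h1, h2, if_false]
        split_ifs
        · simp only [map_add, swapReflection_stdVec, h3]
          rw [Equiv.swap_apply_left, Equiv.swap_apply_of_ne_of_ne (by omega) (by omega)]
        · simp only [map_sub, swapReflection_stdVec, h3]
          rw [Equiv.swap_apply_left, Equiv.swap_apply_of_ne_of_ne (by omega) (by omega)]
  · rintro k ⟨⟨a, b⟩, s⟩ hs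
    simp only [Finset.mem_product, Finset.mem_sigma, Finset.mem_range] at hs
    have hk := k.2
    -- `± ε_c ± ε_d` with `c ≠ d` is a root up to sign
    have key (c d : ℕ) (hc : c < m) (hd : d < m) (hcd : c ≠ d) (s : Bool) :
        ∃ s' ∈ ((Finset.range m).sigma Finset.range) ×ˢ (Finset.univ : Finset Bool),
          rootD (⟨c, d⟩, s) = rootD s' ∨ rootD (⟨c, d⟩, s) = -rootD s' := by
      rcases lt_or_gt_of_ne hcd with h | h
      · refine ⟨(⟨d, c⟩, s), by simp; omega, ?_⟩
        cases s
        · right; simp [rootD]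
        · left; simp [rootD, add_comm]
      · exact ⟨(⟨c, d⟩, s), by simp; omega, Or.inl rfl⟩
    have keyneg (c d : ℕ) (hc : c < m) (hd : d < m) (hcd : c ≠ d) (s : Bool) :
        ∃ s' ∈ ((Finset.range m).sigma Finset.range) ×ˢ (Finset.univ : Finset Bool),
          -rootD (⟨c, d⟩, s) = rootD s' ∨ -rootD (⟨c, d⟩, s) = -rootD s' := by
      obtain ⟨s', hs', h | h⟩ := key c d hc hd hcd s
      · exact ⟨s', hs', Or.inr (by rw [h])⟩
      · exact ⟨s', hs', Or.inl (by rw [h, neg_neg])⟩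
    by_cases h1 : k.1 + 1 = m
    · simp only [h1, if_true]
      rcases b with _ | _ | b
      · by_cases ha : a = 1
        · subst ha
          cases s
          · convert key 1 0 (by omega) (by omega) (by omega) false using 4 <;>
            simp [rootD, negSwapReflection_zero, negSwapReflection_one, neg_add_eq_sub]
          · convert keyneg 1 0 (by omega) (by omega) (by omega) true using 4 <;>
            simp [rootD, negSwapReflection_zero, negSwapReflection_one]
        · have := negSwapReflection_of_two_le (c := a) (by omega)
          cases s
          · convert key a 1 (by omega) (by omega) (by omega) true using 4 <;>
            simp [rootD, negSwapReflection_zero, this]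
          · convert key a 1 (by omega) (by omega) (by omega) false using 4 <;>
            simp [rootD, negSwapReflection_zero, this, sub_eq_add_neg]
      · have := negSwapReflection_of_two_le (c := a) (by omega)
        cases s
        · convert key a 0 (by omega) (by omega) (by omega) true using 4 <;>
          simp [rootD, negSwapReflection_one, this]
        · convert key a 0 (by omega) (by omega) (by omega) false using 4 <;>
          simp [rootD, negSwapReflection_one, this, sub_eq_add_neg]
      · have h2 := negSwapReflection_of_two_le (c := a) (by omega)
        have h3 := negSwapReflection_of_two_le (c := b + 1 + 1) (by omega)
        convert key a (b + 1 + 1) (by omega) (by omega) (by omega) s using 4 <;>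
        cases s <;> simp [rootD, h2, h3]
    · simp only [h1, if_false]
      set p := m - 2 - k.1 with hp
      have hlt : ∀ c < m, Equiv.swap p (p + 1) c < m := fun c hc => by
        rw [Equiv.swap_apply_def]; split_ifs <;> omega
      have hne : Equiv.swap p (p + 1) a ≠ Equiv.swap p (p + 1) b := fun h => by
        have := (Equiv.swap p (p + 1)).injective h
        omega
      convert key _ _ (hlt a (by omega)) (hlt b (by omega)) hne s using 4 <;>
      cases s <;> simp [rootD, swapReflection_stdVec]

end TypeDHeights

/-! ### Heights in type E -/

section TypeEHeights

/-- The `j`-th decimal digit of `s`. A vector of small natural numbers is encoded as the number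
with these digits. -/
def digit (s j : ℕ) : ℕ := s / 10 ^ j % 10

/-- The vector encoded by `s'` arises from the one encoded by `s` by the `k`-th simple reflection,
which adds the `k`-th simple root to it. -/
def RaisesTo {m : ℕ} (C : Matrix (Fin m) (Fin m) ℤ) (k : Fin m) (s s' : ℕ) : Prop :=
  ∑ j : Fin m, C j k * digit s j = -1 ∧
    ∀ j : Fin m, digit s' j = digit s j + if j = k then 1 else 0

instance {m : ℕ} (C : Matrix (Fin m) (Fin m) ℤ) (k : Fin m) (s s' : ℕ) :
    Decidable (RaisesTo C k s s') := inferInstanceAs (Decidable (_ ∧ _))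

/-- The numbers in `L` encode the coefficient vectors of the positive roots with respect to
the simple roots, for the Cartan matrix `C`. The `k`-th simple root is encoded as `10 ^ k`, so that
adding it to a vector adds `10 ^ k` to the code, as long as no digit exceeds `9`. The pairings of a
positive root other than `α_k` with `α_k` are `0`, `-1` or `1`. -/
structure IsRootList {m : ℕ} (C : Matrix (Fin m) (Fin m) ℤ) (L : List ℕ) : Prop where
  nodup : L.Nodup
  simple_mem : ∀ k : Fin m, 10 ^ k.1 ∈ L ∧ C k k = 2 ∧
    ∀ j : Fin m, digit (10 ^ k.1) j = if j = k then 1 else 0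
  eq_sum : ∀ s ∈ L, 0 < ∑ j : Fin m, digit s j ∧ s = ∑ j : Fin m, digit s j * 10 ^ j.1
  exists_raisesTo : ∀ s ∈ L, ∃ k : Fin m, s = 10 ^ k.1 ∨
    (RaisesTo C k (s - 10 ^ k.1) s ∧ s - 10 ^ k.1 ∈ L)
  reflection_mem : ∀ s ∈ L, ∀ k : Fin m, s = 10 ^ k.1 ∨ ∑ j : Fin m, C j k * digit s j = 0 ∨
    (RaisesTo C k s (s + 10 ^ k.1) ∧ s + 10 ^ k.1 ∈ L) ∨
    (RaisesTo C k (s - 10 ^ k.1) s ∧ s - 10 ^ k.1 ∈ L)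

/-- The vector with the digits of `s` as its coordinates. -/
def digitVec (m s : ℕ) : Fin m → ℝ := fun j => digit s j

/-- The simple reflection in the coordinates with respect to the simple roots. -/
def coordReflection {m : ℕ} (C : Matrix (Fin m) (Fin m) ℤ) (k : Fin m) :
    (Fin m → ℝ) →ₗ[ℝ] (Fin m → ℝ) :=
  LinearMap.id - (∑ j, (C j k : ℝ) • LinearMap.proj j : (Fin m → ℝ) →ₗ[ℝ] ℝ).smulRight
    (Pi.single k 1)

theorem coordReflection_single {m : ℕ} (C : Matrix (Fin m) (Fin m) ℤ) (k j : Fin m) :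
    coordReflection C k (Pi.single j 1) = Pi.single j 1 - (C j k : ℝ) • Pi.single k 1 := by
  simp [coordReflection, Pi.single_apply]

theorem coordReflection_digitVec {m : ℕ} (C : Matrix (Fin m) (Fin m) ℤ) (k : Fin m) (s : ℕ) :
    coordReflection C k (digitVec m s) =
      digitVec m s - ((∑ j : Fin m, C j k * digit s j : ℤ) : ℝ) • Pi.single k 1 := by
  simp [coordReflection, digitVec]

theorem RaisesTo.digitVec_eq {m : ℕ} {C : Matrix (Fin m) (Fin m) ℤ} {k : Fin m} {s s' : ℕ}
    (h : RaisesTo C k s s') : digitVec m s' = digitVec m s + Pi.single k 1 := by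
  funext j
  simp [digitVec, h.2 j, Pi.single_apply]

theorem RaisesTo.coordReflection_eq {m : ℕ} {C : Matrix (Fin m) (Fin m) ℤ} {k : Fin m} {s s' : ℕ}
    (h : RaisesTo C k s s') : coordReflection C k (digitVec m s) = digitVec m s' := by
  rw [coordReflection_digitVec, h.1, h.digitVec_eq]
  simp

theorem RaisesTo.sum_lt {m : ℕ} {C : Matrix (Fin m) (Fin m) ℤ} {k : Fin m} {s s' : ℕ}
    (h : RaisesTo C k s s') : ∑ j : Fin m, digit s j < ∑ j : Fin m, digit s' j := by
  simp [h.2, Finset.sum_add_distrib]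

variable {ι M N : Type*} [Fintype ι] [AddCommGroup M] [Module ℝ M] [AddCommGroup N] [Module ℝ N]
  {P : RootPairing ι ℝ M N} [P.IsRootSystem] [P.IsCrystallographic] [P.IsReduced]

/-- The hypothesis `hE` says that the heights of the positive roots are `1, …, m` for every exponent
`m`. -/
theorem IsRootList.prod_height {m : ℕ} {C : Matrix (Fin m) (Fin m) ℤ} {L : List ℕ}
    (hL : IsRootList C L) {E : Multiset ℕ}
    (hE : ((L.map fun s => ∑ j : Fin m, digit s j : List ℕ) : Multiset ℕ) =
      E.bind fun m => (Multiset.range m).map (· + 1))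
    (b : P.Base) (f : b.support ≃ Fin m)
    (hf : b.cartanMatrix.reindex f f = C) {R : Type*} [CommMonoid R] (F : ℤ → R) :
    ∏ i, F (b.height i) = (E.map fun m : ℕ =>
      ∏ k ∈ Finset.range m, F ((k : ℤ) + 1) * F (-((k : ℤ) + 1))).prod := by
  have hsimple (k : Fin m) : (Pi.single k 1 : Fin m → ℝ) = digitVec m (10 ^ k.1) := by
    funext j
    simp [digitVec, (hL.simple_mem k).2.2 j, Pi.single_apply]
  rw [prod_height_of_vectors b f hf (fun k => Pi.single k 1) (∑ j, LinearMap.proj j) ?_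
    (coordReflection C) (coordReflection_single C)
    ⟨(L : Multiset ℕ), Multiset.coe_nodup.2 hL.nodup⟩ (digitVec m)
    (fun s => ∑ j : Fin m, digit s j) ?_ ?_ (fun s hs => (hL.eq_sum s hs).1) ?_ ?_ ?_ F]
  · have h1 := congrArg (fun s => (s.map fun a : ℕ => F a * F (-a)).prod) hE
    simp only [Multiset.map_coe, List.map_map] at h1
    refine Eq.trans ?_ (h1.trans ?_)
    · rfl
    · rw [Multiset.map_bind, Multiset.prod_bind]
      simp only [Multiset.map_map]
      refine congrArg Multiset.prod (Multiset.map_congr rfl fun m _ => ?_)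
      refine congrArg Multiset.prod (Multiset.map_congr rfl fun k _ => ?_)
      simp
  · intro k
    simp
  · intro s hs s' hs' h
    rw [(hL.eq_sum s hs).2, (hL.eq_sum s' hs').2]
    refine Finset.sum_congr rfl fun j _ => ?_
    have := congrFun h j
    simp only [digitVec, Nat.cast_inj] at this
    rw [this]
  · intro s _
    simp [digitVec]
  · exact fun k => ⟨_, (hL.simple_mem k).1, hsimple k⟩
  · intro s hs
    obtain ⟨k, rfl | ⟨h', h⟩⟩ := hL.exists_raisesTo s hs
    · exact Or.inl ⟨k, (hsimple k).symm⟩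
    · exact Or.inr ⟨k, _, h, h'.sum_lt, h'.coordReflection_eq.symm⟩
  · intro k s hs
    rcases hL.reflection_mem s hs k with rfl | h | ⟨h', h⟩ | ⟨h', h⟩
    · refine ⟨_, hs, Or.inr ?_⟩
      rw [← hsimple, coordReflection_single, (hL.simple_mem k).2.1]
      module
    · refine ⟨s, hs, Or.inl ?_⟩
      rw [coordReflection_digitVec, h]
      simp
    · exact ⟨_, h, Or.inl h'.coordReflection_eq⟩
    · refine ⟨_, h, Or.inl ?_⟩
      rw [h'.digitVec_eq, map_add, h'.coordReflection_eq, coordReflection_single,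
        (hL.simple_mem k).2.1, h'.digitVec_eq]
      module

/-- The positive roots of the root system of type `E₈`. Those of its subsystems of type `E₇` and
`E₆` are the ones below `10 ^ 7` and `10 ^ 6`, as the simple roots of the subsystems come first. -/
def rootsE₈ : List ℕ :=
    [1, 10, 100, 1000, 10000, 100000, 1000000, 10000000, 101, 1010, 1100, 11000, 110000, 1100000,
     11000000, 1101, 1110, 11010, 11100, 111000, 1110000, 11100000, 1111, 11101, 11110, 111010,
     111100, 1111000, 11110000, 11111, 12110, 111101, 111110, 1111010, 1111100, 11111000, 12111,
     111111, 112110, 1111101, 1111110, 11111010, 11111100, 12211, 112111, 122110, 1111111,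
     1112110, 11111101, 11111110, 112211, 122111, 1112111, 1122110, 11111111, 11112110, 122211,
     1112211, 1122111, 1222110, 11112111, 11122110, 123211, 1122211, 1222111, 11112211, 11122111,
     11222110, 123221, 1123211, 1222211, 11122211, 11222111, 12222110, 1123221, 1223211,
     11123211, 11222211, 12222111, 1223221, 1233211, 11123221, 11223211, 12222211, 1233221,
     11223221, 11233211, 12223211, 1234221, 11233221, 12223221, 12233211, 1234321, 11234221,
     12233221, 12333211, 1234322, 11234321, 12234221, 12333221, 11234322, 12234321, 12334221,
     12234322, 12334321, 12344221, 12334322, 12344321, 12344322, 12345321, 12345322, 12345331,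
     12345332, 12345422, 12345432, 12346432, 12356432, 12456432, 13456432, 23456432]

/-- The positive roots of the root system of type `E₇`. -/
def rootsE₇ : List ℕ := rootsE₈.filter (· < 10 ^ 7)

/-- The positive roots of the root system of type `E₆`. -/
def rootsE₆ : List ℕ := rootsE₈.filter (· < 10 ^ 6)

theorem isRootList_rootsE₆ : IsRootList CartanMatrix.E₆ rootsE₆ := by
  constructor <;> decide +kernel

theorem isRootList_rootsE₇ : IsRootList CartanMatrix.E₇ rootsE₇ := by
  constructor <;> decide +kernel

theorem isRootList_rootsE₈ : IsRootList CartanMatrix.E₈ rootsE₈ := by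
  constructor <;> decide +kernel

/-- The exponents of the root system of type `E₆`. -/
def exponentsE₆ : Multiset ℕ := {1, 4, 5, 7, 8, 11}

/-- The exponents of the root system of type `E₇`. -/
def exponentsE₇ : Multiset ℕ := {1, 5, 7, 9, 11, 13, 17}

/-- The exponents of the root system of type `E₈`. -/
def exponentsE₈ : Multiset ℕ := {1, 7, 11, 13, 17, 19, 23, 29}

theorem heights_rootsE₆ : ((rootsE₆.map fun s => ∑ j : Fin 6, digit s j : List ℕ) : Multiset ℕ) =
    exponentsE₆.bind fun m => (Multiset.range m).map (· + 1) := by decide +kernel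

theorem heights_rootsE₇ : ((rootsE₇.map fun s => ∑ j : Fin 7, digit s j : List ℕ) : Multiset ℕ) =
    exponentsE₇.bind fun m => (Multiset.range m).map (· + 1) := by decide +kernel

theorem heights_rootsE₈ : ((rootsE₈.map fun s => ∑ j : Fin 8, digit s j : List ℕ) : Multiset ℕ) =
    exponentsE₈.bind fun m => (Multiset.range m).map (· + 1) := by decide +kernel

end TypeEHeights

open Polynomial

/-! ### Continuants -/

section Chains

/-- The continuant of a chain with diagonal entries `x + 1` and the products of opposite
off-diagonal entries equal to `x * (u k * u (k + 1))`. -/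
def chainDet (x : ℂ) (u : ℕ → ℂ) : ℕ → ℂ
  | 0 => 1
  | 1 => x + 1
  | k + 2 => (x + 1) * chainDet x u (k + 1) - x * (u k * u (k + 1)) * chainDet x u k

theorem chainDet_one (x : ℂ) (k : ℕ) :
    chainDet x (fun _ => 1) k = ∑ i ∈ Finset.range (k + 1), x ^ i := by
  induction k using Nat.twoStepInduction with
  | zero => simp [chainDet]
  | one => simp [chainDet, Finset.sum_range_succ]; ring
  | more k ih1 ih2 =>
    rw [chainDet, ih1, ih2, Finset.sum_range_succ _ (k + 2), Finset.sum_range_succ _ (k + 1)]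
    ring

/-- The continuant for the weights `s (k + 1) * s (k + 3) / s (k + 2) ^ 2`, where `s` is a sequence
of Chebyshev type. If `s 2 = q + q⁻¹`, the cubic factor on the left is
`(x - 1) * (x - q ^ 2) * (x - q⁻¹ ^ 2)`. -/
theorem chainDet_mul {s : ℕ → ℂ} {u : ℕ → ℂ} (s1 : s 1 = 1)
    (hs : ∀ a, s (a + 2) = s 2 * s (a + 1) - s a)
    (hu : ∀ k, u k = s (k + 1) * s (k + 3) / s (k + 2) ^ 2) (x : ℂ) (k : ℕ)
    (hne : ∀ a, 1 ≤ a → a ≤ k + 1 → s a ≠ 0) :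
    chainDet x u k * (x ^ 3 - s 3 * x ^ 2 + s 3 * x - 1) * s (k + 1) =
      x ^ (k + 2) * (s (k + 1) * x - s (k + 3)) + s (k + 3) * x - s (k + 1) := by
  induction k using Nat.twoStepInduction with
  | zero => simp only [chainDet, s1, zero_add]; ring
  | one =>
    have h4 := hs 2
    simp only [Nat.reduceAdd] at h4 ⊢
    rw [chainDet, h4]
    ring
  | more k ih1 ih2 =>
    have ih1 := ih1 fun a h1 h2 => hne a h1 (by omega)
    have ih2 := ih2 fun a h1 h2 => hne a h1 (by omega)
    have h2 := hne (k + 2) (by omega) (by omega)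
    have h3 := hne (k + 3) (by omega) (by omega)
    have e3 := hs (k + 1)
    have e5 := hs (k + 3)
    simp only [add_assoc, Nat.reduceAdd] at ih1 ih2 e3 e5 ⊢
    have hp : u k * u (k + 1) * s (k + 3) * s (k + 2) = s (k + 1) * s (k + 4) := by
      rw [hu, hu]
      simp only [add_assoc, Nat.reduceAdd]
      field_simp
    refine mul_right_cancel₀ h2 ?_
    rw [chainDet]
    linear_combination (x + 1) * s (k + 3) * ih2 - x * s (k + 4) * ih1 -
      x * chainDet x u k * (x ^ 3 - s 3 * x ^ 2 + s 3 * x - 1) * hp +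
      (x ^ (k + 4) - x) * (s (k + 2) * e5 - s (k + 4) * e3)

/-- The numbers `z = s (i + 1) * s (i + 3)` satisfy `1 + z = s (i + 2) ^ 2`, which solves the fixed
point equation along a chain. -/
theorem sq_sub_mul_eq_one {s : ℕ → ℝ} (s0 : s 0 = 0) (s1 : s 1 = 1)
    (hs : ∀ a, s (a + 2) = s 2 * s (a + 1) - s a) (a : ℕ) :
    s (a + 1) ^ 2 - s a * s (a + 2) = 1 := by
  induction a with
  | zero => simp [s0, s1]
  | succ a ih =>
    have h := hs a
    have h' := hs (a + 1)
    simp only [add_assoc, Nat.reduceAdd] at h h' ⊢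
    rw [h']
    linear_combination ih + s (a + 2) * h

theorem exp_pow_add_exp_pow {N a b : ℕ} (hN : N ≠ 0) (hab : a + b = N) :
    Complex.exp (2 * Real.pi * Complex.I / N) ^ a + Complex.exp (2 * Real.pi * Complex.I / N) ^ b =
      ((2 * Real.cos (2 * Real.pi * a / N) : ℝ) : ℂ) := by
  have h0 : (N : ℂ) ≠ 0 := by exact_mod_cast hN
  have h1 := (Complex.isPrimitiveRoot_exp N hN).pow_eq_one
  have h2 : Complex.exp (2 * Real.pi * Complex.I / N) ^ a =
      Complex.exp (((2 * Real.pi * a / N : ℝ) : ℂ) * Complex.I) := by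
    rw [← Complex.exp_nat_mul]
    congr 1
    push_cast
    field_simp
  have h3 : Complex.exp (2 * Real.pi * Complex.I / N) ^ b =
      Complex.exp (-((2 * Real.pi * a / N : ℝ) : ℂ) * Complex.I) := by
    rw [neg_mul, Complex.exp_neg, ← h2]
    refine eq_inv_of_mul_eq_one_right ?_
    rw [← pow_add, hab, h1]
  rw [h2, h3, ← Complex.two_cos]
  push_cast
  rfl

theorem map_range_reflect (n : ℕ) (g : ℕ → ℕ) :
    (Multiset.range n).map (fun k => g (n - 1 - k)) = (Multiset.range n).map g := by
  have h (g : ℕ → ℕ) : ∑ j ∈ Finset.range n, ({g j} : Multiset ℕ) = (Multiset.range n).map g := by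
    rw [← Multiset.sum_map_singleton (Multiset.map g _), Multiset.map_map]
    rfl
  rw [← h, ← h, Finset.sum_range_reflect fun k => ({g k} : Multiset ℕ)]

end Chains

/-! ### Diagrams of type A -/

section TypeA

theorem det_typeA {n : ℕ} {x : ℂ} {u : ℕ → ℂ} {M : Matrix (Fin n) (Fin n) ℂ}
    (h : IsDiagramMatrix (CartanMatrix.A n) x (fun i => u i) M) : M.det = chainDet x u n := by
  refine det_path (x + 1) (fun k => x * (u k * u (k + 1))) (chainDet x u) rfl rfl (fun k => rfl) n M
    h.diag (fun i j hij => ⟨h.eq_zero _ _ ?_ ?_, h.eq_zero _ _ ?_ ?_⟩) (fun i j hij => ?_)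
  · rintro rfl; omega
  · simp [CartanMatrix.A, Fin.ext_iff]; omega
  · rintro rfl; omega
  · simp [CartanMatrix.A, Fin.ext_iff]; omega
  · rw [h.mul_eq, ← hij]
    simp [CartanMatrix.A, Fin.ext_iff, hij]; omega

/-- The numbers `sin (a θ) / sin θ` with `θ = π / N`. -/
noncomputable def sinRatio (N a : ℕ) : ℝ := Real.sin (a * (Real.pi / N)) / Real.sin (Real.pi / N)

section

variable {N : ℕ} (hN : 2 ≤ N)

include hN

theorem sin_pi_div_pos : 0 < Real.sin (Real.pi / N) := by
  have h2 : (2 : ℝ) ≤ N := by exact_mod_cast hN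
  refine Real.sin_pos_of_pos_of_lt_pi (by positivity) ?_
  rw [div_lt_iff₀ (by linarith)]
  nlinarith [Real.pi_pos]

theorem sinRatio_one : sinRatio N 1 = 1 := by
  rw [sinRatio, Nat.cast_one, one_mul, div_self (sin_pi_div_pos hN).ne']

theorem sinRatio_pos {a : ℕ} (h1 : 1 ≤ a) (h2 : a < N) : 0 < sinRatio N a := by
  refine div_pos (Real.sin_pos_of_pos_of_lt_pi ?_ ?_) (sin_pi_div_pos hN)
  · have : (1 : ℝ) ≤ a := by exact_mod_cast h1
    positivity
  · have : (a : ℝ) < N := by exact_mod_cast h2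
    rw [← mul_div_assoc, div_lt_iff₀ (by linarith [(Nat.cast_nonneg a : (0 : ℝ) ≤ a)]), mul_comm]
    exact mul_lt_mul_of_pos_left this Real.pi_pos

theorem sinRatio_two : sinRatio N 2 = 2 * Real.cos (Real.pi / N) := by
  rw [sinRatio, Nat.cast_two, Real.sin_two_mul]
  have := (sin_pi_div_pos hN).ne'
  field_simp

theorem sinRatio_add_two (a : ℕ) :
    sinRatio N (a + 2) = sinRatio N 2 * sinRatio N (a + 1) - sinRatio N a := by
  rw [sinRatio_two hN, sinRatio, sinRatio, sinRatio]
  have := (sin_pi_div_pos hN).ne'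
  set θ := Real.pi / N
  have h1 : ((a + 2 : ℕ) : ℝ) * θ = ((a + 1 : ℕ) : ℝ) * θ + θ := by push_cast; ring
  have h2 : (a : ℝ) * θ = ((a + 1 : ℕ) : ℝ) * θ - θ := by push_cast; ring
  rw [h1, h2, Real.sin_add, Real.sin_sub]
  field_simp
  ring

theorem sinRatio_sub {a b : ℕ} (hab : a + b = N) : sinRatio N a = sinRatio N b := by
  have h0 : (N : ℝ) ≠ 0 := by norm_cast; omega
  have h1 : (a : ℝ) * (Real.pi / N) = Real.pi - b * (Real.pi / N) := by
    have : (a : ℝ) = N - b := by rw [← hab]; push_cast; ring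
    rw [this]; field_simp
  rw [sinRatio, sinRatio, h1, Real.sin_pi_sub]

end

theorem sinRatio_zero (N : ℕ) : sinRatio N 0 = 0 := by simp [sinRatio]

theorem prod_fin_ite_eq (n a : ℕ) (f : ℕ → ℝ) :
    ∏ j : Fin n, (if j.1 = a then f j else 1) = if a < n then f a else 1 := by
  rw [Fin.prod_univ_eq_prod_range (fun j => if j = a then f j else 1), Finset.prod_ite_eq']
  simp

/-- A product over the neighbors of `k` in the chain `0, …, n - 1`. -/
theorem prod_neighbors_chain (n : ℕ) (f : ℕ → ℝ) (k : ℕ) :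
    ∏ j : Fin n, (if j.1 + 1 = k ∨ k + 1 = j.1 then f j else 1) =
      (if k = 0 ∨ n < k then 1 else f (k - 1)) * if k + 1 < n then f (k + 1) else 1 := by
  rw [← prod_fin_ite_eq n (k + 1)]
  have h : (if k = 0 ∨ n < k then 1 else f (k - 1)) =
      ∏ j : Fin n, if j.1 + 1 = k then f j else 1 := by
    rcases k with _ | k
    · simp
    · simp only [add_left_inj]
      rw [prod_fin_ite_eq n k]
      by_cases h : k < n
      · rw [if_pos h, if_neg (by omega), Nat.add_sub_cancel]
      · rw [if_neg h, if_pos (by omega)]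
  rw [h, ← Finset.prod_mul_distrib]
  refine Finset.prod_congr rfl fun j _ => ?_
  split_ifs <;> first | omega | simp

/-- The exponents of the root system of type `A_n`. -/
def exponentsA (n : ℕ) : Multiset ℕ := (Multiset.range n).map (· + 1)

/-- The fixed point is given by `sin ((i + 1) θ) sin ((i + 3) θ) / sin² θ` with `θ = π / (n + 3)`. As
`sin ((n + 3) θ) = 0`, the determinant is `(x ^ (n + 3) - 1) / ((x - 1) (x - ζ) (x - ζ⁻¹))`. -/
theorem diagramData_typeA {n : ℕ} (hn : 1 ≤ n) :
    DiagramData (CartanMatrix.A n) (n + 1) (exponentsA n)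
      (fun i => sinRatio (n + 3) (i + 1) * sinRatio (n + 3) (i + 3))
      (∑ i ∈ Finset.range (n + 1), X ^ i) := by
  have hN : 2 ≤ n + 3 := by omega
  set s := sinRatio (n + 3) with hsdef
  have s0 : s 0 = 0 := sinRatio_zero _
  have s1 : s 1 = 1 := sinRatio_one hN
  have hs : ∀ a, s (a + 2) = s 2 * s (a + 1) - s a := sinRatio_add_two hN
  have hspos : ∀ a, 1 ≤ a → a < n + 3 → 0 < s a := fun a => sinRatio_pos hN
  have hsq (i : ℕ) : 1 + s (i + 1) * s (i + 3) = s (i + 2) ^ 2 := by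
    rw [← sq_sub_mul_eq_one s0 s1 hs (i + 1)]; ring
  have hpos (i : Fin n) : 0 < s (i + 1) * s (i + 3) := by
    rcases lt_or_ge (i.1 + 3) (n + 3) with h | h
    · exact mul_pos (hspos _ (by omega) (by omega)) (hspos _ (by omega) h)
    · exact absurd i.2 (by omega)
  refine ⟨fun i j => ?_, fun i => ?_, fun i j hij => ?_, ?_, fun k hk => ?_, ?_, hpos, ?_, ?_, ?_,
    ?_, ?_⟩
  · simp [CartanMatrix.A, Fin.ext_iff, eq_comm, or_comm]
  · simp [CartanMatrix.A]
  · simp only [CartanMatrix.A, Matrix.of_apply, hij, if_false]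
    split_ifs <;> simp
  · simp [exponentsA]
  · simp only [exponentsA, Multiset.mem_map, Multiset.mem_range] at hk
    omega
  · rw [exponentsA, Multiset.map_map, ← map_range_reflect n (· + 1)]
    refine Multiset.map_congr rfl fun k hk => ?_
    have := Multiset.mem_range.1 hk
    simp only [Function.comp_apply]
    omega
  · intro k
    have hk := k.2
    have h1 (j : Fin n) : (if CartanMatrix.A n j k = -1 then 1 + s (j + 1) * s (j + 3) else 1) =
        if j.1 + 1 = k ∨ k.1 + 1 = j then s (j + 2) ^ 2 else 1 := by
      rw [hsq]
      congr 1
      simp [CartanMatrix.A, Fin.ext_iff]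
      grind
    simp_rw [h1]
    rw [prod_neighbors_chain n fun j => s (j + 2) ^ 2, mul_pow]
    congr 1
    · by_cases h : k.1 = 0
      · simp [h, s1]
      · rw [if_neg (by omega)]; congr 2; omega
    · by_cases h : k.1 + 1 < n
      · rw [if_pos h]
      · rw [if_neg h, hsdef, sinRatio_sub hN (b := 1) (by omega), sinRatio_one hN, one_pow]
  · intro x hx M hM
    have hM' : IsDiagramMatrix (CartanMatrix.A n) x
        (fun i => (fun k : ℕ => (s (k + 1) * s (k + 3) / s (k + 2) ^ 2 : ℂ)) i) M := by
      convert hM using 2 with i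
      rw [hsq]; push_cast; rfl
    have h1 := chainDet_mul (s := fun a => (s a : ℂ)) (by simp [s1])
      (fun a => by rw [hs]; push_cast; rfl) (fun k => rfl) x n
      (fun a ha ha' => by exact_mod_cast (hspos a ha (by omega)).ne')
    rw [det_typeA (u := fun k => (s (k + 1) * s (k + 3) / s (k + 2) ^ 2 : ℂ)) hM']
    set D := chainDet x (fun k : ℕ => (s (k + 1) * s (k + 3) / s (k + 2) ^ 2 : ℂ)) n
    have h2 : s (n + 3) = 0 := by
      rw [hsdef, sinRatio_sub hN (b := 0) (by omega), sinRatio_zero]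
    have h3 : (s (n + 1) : ℂ) ≠ 0 := by exact_mod_cast (hspos (n + 1) (by omega) (by omega)).ne'
    simp only [h2, Complex.ofReal_zero] at h1
    have h4 : D * (x ^ 3 - s 3 * x ^ 2 + s 3 * x - 1) = x ^ (n + 3) - 1 :=
      mul_right_cancel₀ h3 (by rw [h1]; ring)
    set ζ := Complex.exp (2 * Real.pi * Complex.I / (((n + 1 : ℕ) : ℂ) + 2)) with hζdef
    have hζ : IsPrimitiveRoot ζ (n + 2 + 1) := by
      have := Complex.isPrimitiveRoot_exp (n + 2 + 1) (by omega)
      convert this using 3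
      push_cast; ring
    have h6 : ζ * ζ ^ (n + 2) = 1 := by
      rw [← pow_succ', hζ.pow_eq_one]
    have h5 : (s 3 : ℂ) = 1 + ζ + ζ ^ (n + 2) := by
      have e1 : ((n + 3 : ℕ) : ℂ) = ((n + 1 : ℕ) : ℂ) + 2 := by push_cast; ring
      have e2 := exp_pow_add_exp_pow (N := n + 3) (a := 1) (b := n + 2) (by omega) (by omega)
      rw [e1, ← hζdef, pow_one] at e2
      have e3 : s 3 = 1 + 2 * Real.cos (2 * Real.pi * (1 : ℕ) / (n + 3 : ℕ)) := by
        rw [hs 1, s1, hsdef, sinRatio_two hN, Nat.cast_one, mul_one, mul_div_assoc,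
          Real.cos_two_mul]
        ring
      rw [add_assoc, e2, e3]
      push_cast
      rfl
    have h7 : x ^ 3 - s 3 * x ^ 2 + s 3 * x - 1 = (x - 1) * ((x - ζ) * (x - ζ ^ (n + 2))) := by
      rw [h5]
      linear_combination (1 - x) * h6
    have h8 : x ^ (n + 3) - 1 =
        (∏ k ∈ Finset.range n, (x - ζ ^ (k + 2))) * ((x - 1) * ((x - ζ) * (x - ζ ^ (n + 2)))) := by
      rw [← mul_geom_sum, geom_sum_eq_prod hζ, Finset.prod_range_succ, Finset.prod_range_succ']
      simp only [zero_add, pow_one]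
      ring
    have h9 : (x - 1) * ((x - ζ) * (x - ζ ^ (n + 2))) ≠ 0 := by
      intro h0
      rw [h0, mul_zero, sub_eq_zero] at h8
      exact hx h8
    rw [exponentsA, Multiset.map_map]
    refine mul_right_cancel₀ h9 ?_
    rw [← h7, h4, h8, h7]
    rfl
  · intro x M hM
    rw [det_typeA (u := fun _ => 1) hM, chainDet_one]
    simp [eval_finsetSum]
  · exact ⟨1, X - 1, by rw [pow_one, mul_comm, mul_geom_sum]⟩
  · have := (Complex.isPrimitiveRoot_exp (n + 1) (by omega)).geom_sum_eq_zero (by omega)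
    simpa [eval_finsetSum] using this

end TypeA

open Polynomial

/-! ### Diagrams of type D -/

section TypeD

/-- The determinant for a chain with the weights `u` whose last node is joined to two more nodes, both
with the weight `w`. -/
theorem det_typeD {q : ℕ} {x : ℂ} {u : ℕ → ℂ} {w : ℂ} {M : Matrix (Fin (q + 4)) (Fin (q + 4)) ℂ}
    (h : IsDiagramMatrix (CartanMatrix.D (q + 4)) x (fun i => if i.1 < q + 2 then u i else w) M) :
    M.det = (x + 1) * ((x + 1) * chainDet x u (q + 2) -
      2 * (x * (u (q + 1) * w)) * chainDet x u (q + 1)) := by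
  -- the determinant of an initial part of the chain
  have hchain (k : ℕ) (hk : k ≤ q + 2) (g : Fin k → Fin (q + 4)) (hg : ∀ i, (g i).1 = i) :
      (M.submatrix g g).det = chainDet x u k := by
    refine det_path (x + 1) (fun k => x * (u k * u (k + 1))) (chainDet x u) rfl rfl (fun k => rfl)
      k _ (fun i => h.diag _) (fun i j hij => ⟨h.eq_zero _ _ ?_ ?_, h.eq_zero _ _ ?_ ?_⟩)
      (fun i j hij => ?_)
    · intro h; have h1 := congrArg Fin.val h; rw [hg, hg] at h1; omega
    · simp [CartanMatrix.D, Fin.ext_iff, hg]; omega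
    · intro h; have h1 := congrArg Fin.val h; rw [hg, hg] at h1; omega
    · simp [CartanMatrix.D, Fin.ext_iff, hg]; omega
    · simp only [Matrix.submatrix_apply]
      rw [h.mul_eq]
      · simp only [hg]
        rw [if_pos (by omega), if_pos (by omega), hij]
      · simp [CartanMatrix.D, Fin.ext_iff, hg]; omega
  have hz (i j : Fin (q + 4)) (h1 : i ≠ j) (h2 : CartanMatrix.D (q + 4) i j = 0) : M i j = 0 :=
    h.eq_zero i j h1 h2
  have hedge (i j : Fin (q + 4)) (hi : i.1 = q + 1) (hj : q + 2 ≤ j.1) :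
      M j i * M i j = x * (u (q + 1) * w) := by
    rw [h.mul_eq]
    · rw [if_neg (by omega), if_pos (by omega), hi, mul_comm w]
    · simp [CartanMatrix.D, Fin.ext_iff]; omega
  have hlast (i j : Fin (q + 4)) (hi : i.1 ≤ q) (hj : q + 2 ≤ j.1) : M j i = 0 ∧ M i j = 0 := by
    refine ⟨hz _ _ ?_ ?_, hz _ _ ?_ ?_⟩
    · rintro rfl; omega
    · simp [CartanMatrix.D, Fin.ext_iff]; omega
    · rintro rfl; omega
    · simp [CartanMatrix.D, Fin.ext_iff]; omega
  have hends (i j : Fin (q + 4)) (hi : i ≠ j) (hi : q + 2 ≤ i.1) (hj : q + 2 ≤ j.1) :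
      M i j = 0 := by
    refine hz _ _ ‹_› ?_
    simp [CartanMatrix.D, Fin.ext_iff]; omega
  have ha (j : Fin (q + 3)) (hj : j ≠ ⟨q + 1, by omega⟩) : M (Fin.last _) j.castSucc = 0 ∧
      M j.castSucc (Fin.last _) = 0 := by
    rcases Nat.lt_or_ge j.1 (q + 2) with h1 | h1
    · refine hlast _ _ ?_ (by simp)
      simp [Fin.ext_iff] at hj ⊢; omega
    · refine ⟨hends _ _ ?_ (by simp) (by simpa using h1), hends _ _ ?_ (by simpa using h1) (by simp)⟩
        <;> simp [Fin.ext_iff] <;> omega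
  rw [det_leaf M ⟨q + 1, by omega⟩ (fun j hj => (ha j hj).1) (fun j hj => (ha j hj).2), h.diag,
    hedge _ _ (by simp) (by simp)]
  set M1 := M.submatrix Fin.castSucc Fin.castSucc with hM1
  -- without the last end node, the diagram is a chain
  have h1 : M1.det =
      (x + 1) * chainDet x u (q + 2) - x * (u (q + 1) * w) * chainDet x u (q + 1) := by
    have hb (j : Fin (q + 2)) (hj : j ≠ Fin.last (q + 1)) : M1 (Fin.last _) j.castSucc = 0 ∧
        M1 j.castSucc (Fin.last _) = 0 := by
      refine hlast _ _ ?_ (by simp)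
      simp [Fin.ext_iff] at hj ⊢; omega
    rw [det_leaf M1 (Fin.last _) (fun j hj => (hb j hj).1) (fun j hj => (hb j hj).2)]
    simp only [hM1, Matrix.submatrix_apply, Matrix.submatrix_submatrix]
    rw [h.diag, hedge _ _ (by simp) (by simp), hchain _ le_rfl _ (by simp),
      hchain _ (by omega) _ (by simp)]
  -- without its neighbor, the other end node is isolated
  have h2 : (M1.submatrix (Fin.succAbove ⟨q + 1, by omega⟩)
      (Fin.succAbove ⟨q + 1, by omega⟩)).det = (x + 1) * chainDet x u (q + 1) := by
    have e1 (j : Fin (q + 1)) :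
        (Fin.succAbove (⟨q + 1, by omega⟩ : Fin (q + 3)) j.castSucc).1 = j.1 := by
      rw [Fin.succAbove_of_castSucc_lt]
      · simp
      · have := j.2
        simp [Fin.lt_def]; omega
    have e2 : (Fin.succAbove (⟨q + 1, by omega⟩ : Fin (q + 3)) (Fin.last (q + 1))).1 = q + 2 := by
      rw [Fin.succAbove_of_le_castSucc]
      · simp
      · simp [Fin.le_def]
    have hc (j : Fin (q + 1)) := hlast
      (Fin.succAbove (⟨q + 1, by omega⟩ : Fin (q + 3)) j.castSucc).castSucc
      (Fin.succAbove (⟨q + 1, by omega⟩ : Fin (q + 3)) (Fin.last (q + 1))).castSucc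
      (by rw [Fin.val_castSucc, e1]; have := j.2; omega) (by rw [Fin.val_castSucc, e2])
    rw [det_leaf _ (Fin.last _) (fun j _ => (hc j).1) (fun j _ => (hc j).2)]
    have h3 := (hc (Fin.last q)).1
    simp only [hM1, Matrix.submatrix_apply, Matrix.submatrix_submatrix]
    rw [h3, zero_mul, zero_mul, sub_zero, h.diag, hchain _ (by omega) _ (fun i => by
      simp only [Function.comp_apply, Fin.val_castSucc, e1])]
  rw [h1, h2]
  ring

/-- The value of the fixed point at the node `i` of the diagram of type `D_m`. -/
def fixedPointD (m : ℕ) (i : Fin m) : ℝ := if i.1 < m - 2 then (i + 1) * (i + 3) else m - 1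

/-- Along the chain, the determinant is evaluated with the sequence `s a = a`, for which the cubic
factor of `chainDet_mul` is `(x - 1) ^ 3`. The result is `(x + 1) (x ^ m - 1) / (x - 1)`. -/
theorem diagramData_typeD {m : ℕ} (hm : 4 ≤ m) :
    DiagramData (CartanMatrix.D m) (2 * m - 2) (exponentsD m) (fixedPointD m)
      ((X + 1) * (X ^ (m - 1) + 1)) := by
  obtain ⟨q, rfl⟩ := Nat.exists_eq_add_of_le' hm
  have hh : 2 * (q + 4) - 2 = 2 * (q + 3) := by omega
  have h0 : q + 4 - 2 = q + 2 := by omega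
  refine ⟨fun i j => ?_, fun i => ?_, fun i j hij => ?_, ?_, fun k hk => ?_, ?_, fun i => ?_, ?_, ?_,
    ?_, ?_, ?_⟩
  · simp [CartanMatrix.D, Fin.ext_iff]; grind
  · simp [CartanMatrix.D]
  · simp only [CartanMatrix.D, Matrix.of_apply, hij, if_false]
    split_ifs <;> simp
  · simp [exponentsD]
  · simp only [exponentsD, Multiset.mem_cons, Multiset.mem_map, Multiset.mem_range] at hk
    omega
  · rw [exponentsD, Multiset.map_cons, Multiset.map_map]
    congr 1
    · omega
    · rw [← map_range_reflect _ fun k => 2 * k + 1]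
      refine Multiset.map_congr rfl fun k hk => ?_
      have := Multiset.mem_range.1 hk
      simp only [Function.comp_apply]
      omega
  · rw [fixedPointD]
    split_ifs
    · positivity
    · push_cast; linarith [(Nat.cast_nonneg q : (0 : ℝ) ≤ q)]
  · intro k
    have hk := k.2
    have hz (j : Fin (q + 4)) : 1 + fixedPointD (q + 4) j =
        if j.1 < q + 2 then ((j.1 : ℝ) + 2) ^ 2 else (q : ℝ) + 4 := by
      simp only [fixedPointD, h0]
      split_ifs
      · ring
      · push_cast; ring
    simp_rw [hz]
    rw [Fin.prod_univ_castSucc, Fin.prod_univ_castSucc]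
    simp only [Fin.val_castSucc, Fin.is_lt, if_true]
    by_cases hk2 : k.1 < q + 2
    · have h1 (j : Fin (q + 2)) : (if CartanMatrix.D (q + 4) j.castSucc.castSucc k = -1 then
          ((j.1 : ℝ) + 2) ^ 2 else 1) =
          if j.1 + 1 = k ∨ k.1 + 1 = j then ((j.1 : ℝ) + 2) ^ 2 else 1 := by
        congr 1
        simp [CartanMatrix.D, Fin.ext_iff]
        grind
      have h2 : CartanMatrix.D (q + 4) (Fin.last (q + 2)).castSucc k = -1 ↔ k.1 = q + 1 := by
        simp [CartanMatrix.D, Fin.ext_iff]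
        grind
      have h3 : CartanMatrix.D (q + 4) (Fin.last (q + 3)) k = -1 ↔ k.1 = q + 1 := by
        simp [CartanMatrix.D, Fin.ext_iff]
        grind
      simp_rw [h1, h2, h3]
      rw [prod_neighbors_chain (q + 2) fun j => ((j : ℝ) + 2) ^ 2]
      simp only [fixedPointD, h0, hk2, if_true, Fin.val_last]
      rw [if_neg (by omega : ¬ q + 2 < q + 2), if_neg (by omega : ¬ q + 3 < q + 2)]
      have h4 : (if k.1 = 0 ∨ q + 2 < k.1 then 1 else (((k.1 - 1 : ℕ) : ℝ) + 2) ^ 2) =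
          ((k : ℝ) + 1) ^ 2 := by
        by_cases h : k.1 = 0
        · simp [h]
        · rw [if_neg (by omega), Nat.cast_sub (by omega)]
          push_cast; ring
      rw [h4]
      by_cases h : k.1 = q + 1
      · rw [if_neg (by omega), if_pos h, h]
        push_cast; ring
      · rw [if_pos (by omega), if_neg h]
        push_cast; ring
    · have h1 (j : Fin (q + 2)) : (if CartanMatrix.D (q + 4) j.castSucc.castSucc k = -1 then
          ((j.1 : ℝ) + 2) ^ 2 else 1) = if j.1 = q + 1 then ((j.1 : ℝ) + 2) ^ 2 else 1 := by
        congr 1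
        simp [CartanMatrix.D, Fin.ext_iff]
        grind
      have h2 : CartanMatrix.D (q + 4) (Fin.last (q + 2)).castSucc k ≠ -1 := by
        simp [CartanMatrix.D, Fin.ext_iff]
        grind
      have h3 : CartanMatrix.D (q + 4) (Fin.last (q + 3)) k ≠ -1 := by
        simp [CartanMatrix.D, Fin.ext_iff]
        grind
      simp_rw [h1]
      rw [prod_fin_ite_eq (q + 2) (q + 1) fun j => ((j : ℝ) + 2) ^ 2, if_neg h2, if_neg h3,
        if_pos (by omega), fixedPointD, h0, if_neg hk2]
      push_cast; ring
  · intro x hx M hM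
    have hM' : IsDiagramMatrix (CartanMatrix.D (q + 4)) x (fun i => if i.1 < q + 2 then
        (fun k : ℕ => ((k + 1 : ℕ) * (k + 3 : ℕ) / (k + 2 : ℕ) ^ 2 : ℂ)) i
        else (q + 3 : ℂ) / (q + 4)) M := by
      convert hM using 2 with i
      simp only [fixedPointD, h0]
      by_cases hi : i.1 < q + 2
      · have h1 : (i.1 : ℝ) + 2 ≠ 0 := by positivity
        have h2 : (1 : ℝ) + (i + 1) * (i + 3) = (i + 2) ^ 2 := by ring
        rw [if_pos hi, if_pos hi, h2]
        push_cast; rfl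
      · rw [if_neg hi, if_neg hi]
        push_cast
        congr 1 <;> ring
    have hch (k : ℕ) := chainDet_mul (s := fun a => (a : ℂ)) (u := fun k : ℕ =>
      ((k + 1 : ℕ) * (k + 3 : ℕ) / (k + 2 : ℕ) ^ 2 : ℂ)) (by simp)
      (fun a => by push_cast; ring) (fun k => rfl) x k (fun a ha _ => by norm_cast; omega)
    have hc1 := hch (q + 1)
    have hc2 := hch (q + 2)
    rw [det_typeD (u := fun k : ℕ => ((k + 1 : ℕ) * (k + 3 : ℕ) / (k + 2 : ℕ) ^ 2 : ℂ)) hM']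
    set D1 := chainDet x (fun k : ℕ => ((k + 1 : ℕ) * (k + 3 : ℕ) / (k + 2 : ℕ) ^ 2 : ℂ)) (q + 1)
    set D2 := chainDet x (fun k : ℕ => ((k + 1 : ℕ) * (k + 3 : ℕ) / (k + 2 : ℕ) ^ 2 : ℂ)) (q + 2)
    set ζ := Complex.exp (2 * Real.pi * Complex.I / (((2 * (q + 4) - 2 : ℕ) : ℂ) + 2)) with hζdef
    have hζ : IsPrimitiveRoot ζ (2 * (q + 4)) := by
      have := Complex.isPrimitiveRoot_exp (2 * (q + 4)) (by omega)
      convert this using 3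
      rw [hh]; push_cast; ring
    have hζ2 : IsPrimitiveRoot (ζ ^ 2) (q + 3 + 1) := hζ.pow (by omega) rfl
    have hζm : ζ ^ (q + 4) = -1 := (hζ.pow (by omega) (mul_comm 2 (q + 4))).eq_neg_one_of_two_right
    have hx1 : x - 1 ≠ 0 := fun h => hx (by rw [sub_eq_zero.1 h, one_pow])
    have hE : ((exponentsD (q + 4)).map fun k => x - ζ ^ (k + 1)).prod =
        (x + 1) * ∑ i ∈ Finset.range (q + 4), x ^ i := by
      rw [geom_sum_eq_prod hζ2, exponentsD, Multiset.map_cons, Multiset.prod_cons, Multiset.map_map]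
      congr 1
      · rw [show q + 4 - 1 + 1 = q + 4 by omega, hζm]; ring
      · refine congrArg Multiset.prod (Multiset.map_congr rfl fun k _ => ?_)
        simp only [Function.comp_apply]
        ring
    rw [hE]
    refine mul_left_cancel₀ (pow_ne_zero 3 hx1) ?_
    have hg := mul_geom_sum x (q + 4)
    have hq : ((q : ℂ) + 3) ≠ 0 := by norm_cast
    have hq1 : ((q : ℂ) + 2) ≠ 0 := by norm_cast
    have hq2 : ((q : ℂ) + 4) ≠ 0 := by norm_cast
    have hw : ((q + 1 + 1 : ℕ) * (q + 1 + 3 : ℕ) / (q + 1 + 2 : ℕ) ^ 2 : ℂ) *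
        ((q + 3 : ℂ) / (q + 4)) = (q + 2) / (q + 3) := by
      push_cast
      have e1 : (q : ℂ) + 1 + 3 = q + 4 := by ring
      have e2 : (q : ℂ) + 1 + 2 = q + 3 := by ring
      rw [e1, e2]
      field_simp
      ring
    rw [hw]
    push_cast at hc1 hc2
    refine mul_left_cancel₀ hq ?_
    have h5 : ((q : ℂ) + 3) * ((x - 1) ^ 3 * ((x + 1) * ((x + 1) * D2 -
        2 * (x * ((q + 2) / (q + 3))) * D1))) = (x - 1) ^ 3 * ((x + 1) * ((x + 1) * (D2 * (q + 3)) -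
        2 * x * (D1 * (q + 2)))) := by
      field_simp
    rw [h5]
    linear_combination (x + 1) ^ 2 * hc2 - 2 * x * (x + 1) * hc1 -
      (x + 1) * (x - 1) ^ 2 * (q + 3) * hg
  · intro x M hM
    have hM' : IsDiagramMatrix (CartanMatrix.D (q + 4)) x (fun i => if i.1 < q + 2 then
        (fun _ : ℕ => (1 : ℂ)) i else 1) M := by
      simpa using hM
    rw [det_typeD (u := fun _ => 1) hM', chainDet_one, chainDet_one, Finset.sum_range_succ']
    have hg := mul_geom_sum x (q + 2)
    simp only [eval_mul, eval_add, eval_X, eval_one, eval_pow, Nat.add_succ_sub_one,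
      pow_succ _ (_ + 1)]
    simp only [pow_succ x, ← Finset.sum_mul] at hg ⊢
    linear_combination (x + 1) * x * hg
  · have h1 : (X ^ (q + 3) + 1 : ℂ[X]) ∣ X ^ (2 * (q + 3)) - 1 :=
      ⟨X ^ (q + 3) - 1, by rw [mul_comm 2, pow_mul]; ring⟩
    have h2 : (X + 1 : ℂ[X]) ∣ X ^ (2 * (q + 3)) - 1 := by
      have : (X + 1 : ℂ[X]) ∣ X ^ 2 - 1 := ⟨X - 1, by ring⟩
      rw [pow_mul]
      exact this.trans (sub_one_dvd_pow_sub_one _ _)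
    exact ⟨2, by rw [hh, sq]; exact mul_dvd_mul h2 h1⟩
  · have h1 :
        Complex.exp (2 * Real.pi * Complex.I / ((2 * (q + 4) - 2 : ℕ) : ℂ)) ^ (q + 3) = -1 := by
      have := Complex.isPrimitiveRoot_exp (2 * (q + 3)) (by omega)
      rw [hh]
      exact (this.pow (by omega) (mul_comm 2 (q + 3))).eq_neg_one_of_two_right
    have h2 : q + 4 - 1 = q + 3 := by omega
    rw [IsRoot.def, eval_mul, h2, eval_add (p := X ^ _), eval_pow, eval_X, h1]
    simp

end TypeD

open Polynomial

/-! ### Diagrams of type E -/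

section TypeE

/-- The determinant of the part of a diagram of type `E` with the nodes `0, …, k + 2`. Node `3` is
joined to the nodes `1`, `2` and `4`, and node `0` is joined to node `2`. -/
def branchDet (x : ℂ) (u : ℕ → ℂ) : ℕ → ℂ
  | 0 => (x + 1) * ((x + 1) ^ 2 - x * (u 0 * u 2))
  | 1 => (x + 1) * ((x + 1) * ((x + 1) ^ 2 - x * (u 0 * u 2))) -
      x * (u 1 * u 3) * ((x + 1) ^ 2 - x * (u 0 * u 2)) - x * (u 2 * u 3) * (x + 1) ^ 2
  | k + 2 => (x + 1) * branchDet x u (k + 1) - x * (u (k + 3) * u (k + 4)) * branchDet x u k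

/-- The diagrams of type `E₆` and `E₇` are initial parts of the one of type `E₈`. Starting with node
`4`, every node is a leaf of the part up to this node, joined to its predecessor. -/
theorem det_typeE {m : ℕ} (hm : m ≤ 8) {C : Matrix (Fin m) (Fin m) ℤ}
    (hC : C = CartanMatrix.E₈.submatrix (Fin.castLE hm) (Fin.castLE hm)) {x : ℂ} {u : ℕ → ℂ}
    {M : Matrix (Fin m) (Fin m) ℂ} (h : IsDiagramMatrix C x (fun i => u i) M) (k : ℕ)
    (hk : k + 3 ≤ m) :
    (M.submatrix (Fin.castLE hk) (Fin.castLE hk)).det = branchDet x u k := by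
  have hz (i j : Fin m) (hij : i ≠ j)
      (h0 : CartanMatrix.E₈ (Fin.castLE hm i) (Fin.castLE hm j) = 0) : M i j = 0 :=
    h.eq_zero i j hij (by rw [hC]; exact h0)
  have he (i j : Fin m) (h0 : CartanMatrix.E₈ (Fin.castLE hm i) (Fin.castLE hm j) = -1) :
      M i j * M j i = x * (u i * u j) := h.mul_eq i j (by rw [hC]; exact h0)
  have hchain (i j : Fin 8) : 4 ≤ i.1 → j.1 < i.1 →
      (j.1 + 1 = i.1 → CartanMatrix.E₈ i j = -1) ∧
      (j.1 + 1 ≠ i.1 → CartanMatrix.E₈ i j = 0 ∧ CartanMatrix.E₈ j i = 0) := by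
    have : ∀ p : Fin 8 × Fin 8, 4 ≤ p.1.1 → p.2.1 < p.1.1 →
      (p.2.1 + 1 = p.1.1 → CartanMatrix.E₈ p.1 p.2 = -1) ∧
      (p.2.1 + 1 ≠ p.1.1 → CartanMatrix.E₈ p.1 p.2 = 0 ∧ CartanMatrix.E₈ p.2 p.1 = 0) := by decide
    exact this (i, j)
  induction k using Nat.twoStepInduction with
  | zero =>
    have h01 := hz (Fin.castLE hk 0) (Fin.castLE hk 1) (by simp [Fin.ext_iff]) rfl
    have h10 := hz (Fin.castLE hk 1) (Fin.castLE hk 0) (by simp [Fin.ext_iff]) rfl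
    have h12 := hz (Fin.castLE hk 1) (Fin.castLE hk 2) (by simp [Fin.ext_iff]) rfl
    have h21 := hz (Fin.castLE hk 2) (Fin.castLE hk 1) (by simp [Fin.ext_iff]) rfl
    have h02 := he (Fin.castLE hk 0) (Fin.castLE hk 2) rfl
    rw [Matrix.det_fin_three]
    simp only [Matrix.submatrix_apply, h.diag, h01, h10, h12, h21]
    simp only [Fin.val_castLE] at h02
    rw [branchDet]
    simp at h02
    linear_combination -(x + 1) * h02
  | one =>
    have h01 := hz (Fin.castLE hk 0) (Fin.castLE hk 1) (by simp [Fin.ext_iff]) rfl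
    have h10 := hz (Fin.castLE hk 1) (Fin.castLE hk 0) (by simp [Fin.ext_iff]) rfl
    have h12 := hz (Fin.castLE hk 1) (Fin.castLE hk 2) (by simp [Fin.ext_iff]) rfl
    have h21 := hz (Fin.castLE hk 2) (Fin.castLE hk 1) (by simp [Fin.ext_iff]) rfl
    have h03 := hz (Fin.castLE hk 0) (Fin.castLE hk 3) (by simp [Fin.ext_iff]) rfl
    have h30 := hz (Fin.castLE hk 3) (Fin.castLE hk 0) (by simp [Fin.ext_iff]) rfl
    have h02 := he (Fin.castLE hk 0) (Fin.castLE hk 2) rfl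
    have h13 := he (Fin.castLE hk 1) (Fin.castLE hk 3) rfl
    have h23 := he (Fin.castLE hk 2) (Fin.castLE hk 3) rfl
    have hM : M.submatrix (Fin.castLE hk) (Fin.castLE hk) =
        !![x + 1, 0, M (Fin.castLE hk 0) (Fin.castLE hk 2), 0;
          0, x + 1, 0, M (Fin.castLE hk 1) (Fin.castLE hk 3);
          M (Fin.castLE hk 2) (Fin.castLE hk 0), 0, x + 1, M (Fin.castLE hk 2) (Fin.castLE hk 3);
          0, M (Fin.castLE hk 3) (Fin.castLE hk 1), M (Fin.castLE hk 3) (Fin.castLE hk 2),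
            x + 1] := by
      ext i j
      fin_cases i <;> fin_cases j <;> first | exact h.diag _ | assumption | rfl
    rw [hM, branchDet]
    simp only [Fin.val_castLE] at h02 h13 h23
    generalize M (Fin.castLE hk 0) (Fin.castLE hk 2) = a at *
    generalize M (Fin.castLE hk 2) (Fin.castLE hk 0) = a' at *
    generalize M (Fin.castLE hk 1) (Fin.castLE hk 3) = b at *
    generalize M (Fin.castLE hk 3) (Fin.castLE hk 1) = b' at *
    generalize M (Fin.castLE hk 2) (Fin.castLE hk 3) = c at *
    generalize M (Fin.castLE hk 3) (Fin.castLE hk 2) = c' at *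
    change a * a' = x * (u 0 * u 2) at h02
    change b * b' = x * (u 1 * u 3) at h13
    change c * c' = x * (u 2 * u 3) at h23
    rw [← h02, ← h13, ← h23]
    simp [Matrix.det_succ_row_zero, Fin.sum_univ_succ, Fin.succAbove]
    ring
  | more k ih1 ih2 =>
    have hleaf (j : Fin (k + 4)) (hj : j ≠ Fin.last (k + 3)) :
        M (Fin.castLE hk (Fin.last _)) (Fin.castLE hk j.castSucc) = 0 ∧
          M (Fin.castLE hk j.castSucc) (Fin.castLE hk (Fin.last _)) = 0 := by
      have hj' : j.1 < k + 3 := by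
        have := j.2
        simp only [ne_eq, Fin.ext_iff, Fin.val_last] at hj
        omega
      have h1 := (hchain (Fin.castLE hm (Fin.castLE hk (Fin.last _)))
        (Fin.castLE hm (Fin.castLE hk j.castSucc)) (by simp) (by simp)).2 (by simp; omega)
      refine ⟨hz _ _ ?_ h1.1, hz _ _ ?_ h1.2⟩ <;> simp [Fin.ext_iff] <;> omega
    have hedge := he (Fin.castLE hk (Fin.last _)) (Fin.castLE hk (Fin.last (k + 3)).castSucc)
      ((hchain (Fin.castLE hm (Fin.castLE hk (Fin.last _)))
        (Fin.castLE hm (Fin.castLE hk (Fin.last (k + 3)).castSucc)) (by simp) (by simp)).1 (by simp))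
    rw [det_leaf _ (Fin.last (k + 3)) (fun j hj => (hleaf j hj).1) (fun j hj => (hleaf j hj).2)]
    simp only [Matrix.submatrix_apply, Matrix.submatrix_submatrix]
    rw [h.diag, hedge, branchDet, ← ih1 (by omega), ← ih2 (by omega)]
    simp only [Fin.val_castLE, Fin.val_last, Fin.val_castSucc]
    rw [mul_comm (u (k + 2 + 2))]
    congr 4 <;> (try ext i) <;> simp [Fin.succAbove_last]

theorem det_typeE_self {m : ℕ} (hm : m ≤ 8) {C : Matrix (Fin m) (Fin m) ℤ}
    (hC : C = CartanMatrix.E₈.submatrix (Fin.castLE hm) (Fin.castLE hm)) {x : ℂ} {u : ℕ → ℂ}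
    {M : Matrix (Fin m) (Fin m) ℂ} (h : IsDiagramMatrix C x (fun i => u i) M) {k : ℕ}
    (hk : k + 3 = m) : M.det = branchDet x u k := by
  rw [← det_typeE hm hC h k hk.le]
  subst hk
  rfl

/-- The weights `z / (1 + z)` enter the determinants only through their products along the edges,
which have a simple form. -/
theorem weight_mul_weight {a b : ℝ} (ha : 0 < a) (hb : 0 < b) (v : ℝ)
    (h : a * b - v * ((1 + a) * (1 + b)) = 0) :
    ((a / (1 + a) : ℝ) : ℂ) * ((b / (1 + b) : ℝ) : ℂ) = (v : ℂ) := by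
  rw [← Complex.ofReal_mul, div_mul_div_comm]
  congr 1
  rw [div_eq_iff (by positivity)]
  linear_combination h

theorem exp_pow_half {N : ℕ} (hN : N ≠ 0) :
    Complex.exp (2 * Real.pi * Complex.I / ((2 * N : ℕ) : ℂ)) ^ N = -1 :=
  ((Complex.isPrimitiveRoot_exp (2 * N) (by omega)).pow (by omega)
    (mul_comm 2 N)).eq_neg_one_of_two_right

/-- The values of the fixed point at the nodes of the diagram of type `E₆`, where
`c = 2 cos (2π / 7)`. -/
def fixedPointE₆ (c : ℝ) : ℕ → ℝ
  | 0 => c ^ 2 + 2 * c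
  | 1 => 2 * c ^ 2 + 3 * c
  | 2 => 3 * c ^ 2 + 7 * c + 2
  | 3 => 9 * c ^ 2 + 20 * c + 7
  | 4 => 3 * c ^ 2 + 7 * c + 2
  | _ => c ^ 2 + 2 * c

theorem fixedPointE₆_pos {c : ℝ} (hc : 0 < c) (i : ℕ) : 0 < fixedPointE₆ c i := by
  unfold fixedPointE₆
  split <;> positivity

/-- The real number `2 cos (2π / 7)`. -/
noncomputable def cosSeventh : ℝ := 2 * Real.cos (2 * Real.pi * (2 : ℕ) / (14 : ℕ))

theorem cosSeventh_pos : 0 < cosSeventh := by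
  refine mul_pos two_pos (Real.cos_pos_of_mem_Ioo ⟨?_, ?_⟩) <;> push_cast <;>
    linarith [Real.pi_pos]

theorem cosSeventh_cast : (cosSeventh : ℂ) = Complex.exp (2 * Real.pi * Complex.I / 14) ^ 2 +
    Complex.exp (2 * Real.pi * Complex.I / 14) ^ 12 :=
  (exp_pow_add_exp_pow (N := 14) (a := 2) (b := 12) (by norm_num) (by norm_num)).symm

theorem sum_exp_seventh : ∑ i ∈ Finset.range 7,
    (Complex.exp (2 * Real.pi * Complex.I / 14) ^ 2) ^ i = 0 := by
  have h := Complex.isPrimitiveRoot_exp 14 (by norm_num)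
  exact (h.pow (a := 2) (b := 7) (by norm_num) (by norm_num)).geom_sum_eq_zero (by norm_num)

theorem cosSeventh_cubic : cosSeventh ^ 3 + cosSeventh ^ 2 - 2 * cosSeventh - 1 = 0 := by
  have h1 := cosSeventh_cast
  have h2 := sum_exp_seventh
  have h3 := exp_pow_half (N := 7) (by norm_num)
  simp only [Finset.sum_range_succ, Finset.sum_range_zero] at h2
  norm_num at h3
  set ζ := Complex.exp (2 * Real.pi * Complex.I / 14)
  have h4 : (ζ ^ 2) ^ 7 = 1 := by linear_combination (ζ ^ 7 - 1) * h3
  have h5 : ζ ^ 12 = (ζ ^ 2) ^ 6 := by ring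
  have : (cosSeventh : ℂ) ^ 3 + (cosSeventh : ℂ) ^ 2 - 2 * cosSeventh - 1 = 0 := by
    rw [h1, h5]
    generalize ζ ^ 2 = ω at *
    linear_combination h2 + (3 * ω + 3 * ω ^ 6 + ω ^ 11 + ω ^ 4 + ω ^ 5 + 2) * h4
  exact_mod_cast this

theorem diagramData_typeE₆ : DiagramData CartanMatrix.E₆ 12 exponentsE₆
    (fun i => fixedPointE₆ cosSeventh i) ((X ^ 4 - X ^ 2 + 1) * (X ^ 2 + X + 1)) := by
  have hc := cosSeventh_cubic
  have hpos := cosSeventh_pos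
  have hcast := cosSeventh_cast
  set c := cosSeventh
  have hE : CartanMatrix.E₆ = CartanMatrix.E₈.submatrix (Fin.castLE (by norm_num))
    (Fin.castLE (by norm_num)) := by decide
  refine ⟨fun i j => CartanMatrix.E₆_isSymm.apply j i, CartanMatrix.E₆_diag,
    fun i j h => CartanMatrix.isSimplyLaced_E₆ h, by decide, by decide, by decide,
    fun i => fixedPointE₆_pos hpos i, fun k => ?_, fun x hx M hM => ?_, fun x M hM => ?_, ?_, ?_⟩
  · fin_cases k <;> simp [Fin.prod_univ_succ, CartanMatrix.E₆, fixedPointE₆]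
    · linear_combination (3 + c) * hc
    · linear_combination (8 + 4 * c) * hc
    · linear_combination 4 * hc
    · linear_combination (-40 - 131 * c - 93 * c ^ 2 - 18 * c ^ 3) * hc
    · linear_combination 4 * hc
    · linear_combination (3 + c) * hc
  · let u : ℕ → ℂ := fun i => ((fixedPointE₆ c i / (1 + fixedPointE₆ c i) : ℝ) : ℂ)
    have hu (i j : ℕ) := weight_mul_weight (fixedPointE₆_pos hpos i) (fixedPointE₆_pos hpos j)
    have hC : (c : ℂ) ^ 3 + (c : ℂ) ^ 2 - 2 * c - 1 = 0 := by exact_mod_cast hc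
    -- the products of the weights along the edges, in normal form modulo the cubic equation of `c`
    have p02 : u 0 * u 2 = 2 - c := by
      refine (hu 0 2 (2 - c) ?_).trans (by push_cast; ring)
      simp only [fixedPointE₆]
      linear_combination (6 + 7 * c + 3 * c ^ 2) * hc
    have p23 : u 2 * u 3 = 3 / 7 + 4 / 7 * c - 1 / 7 * c ^ 2 := by
      refine (hu 2 3 (3 / 7 + 4 / 7 * c - 1 / 7 * c ^ 2) ?_).trans (by push_cast; ring)
      simp only [fixedPointE₆]
      linear_combination (-26 / 7 - 127 / 7 * c - 12 / 7 * c ^ 2 + 27 / 7 * c ^ 3) * hc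
    have p13 : u 1 * u 3 = 15 / 7 - 1 / 7 * c - 5 / 7 * c ^ 2 := by
      refine (hu 1 3 (15 / 7 - 1 / 7 * c - 5 / 7 * c ^ 2) ?_).trans (by push_cast; ring)
      simp only [fixedPointE₆]
      linear_combination (120 / 7 + 265 / 7 * c + 263 / 7 * c ^ 2 + 90 / 7 * c ^ 3) * hc
    have p34 : u 3 * u 4 = 3 / 7 + 4 / 7 * c - 1 / 7 * c ^ 2 := by
      refine (hu 3 4 (3 / 7 + 4 / 7 * c - 1 / 7 * c ^ 2) ?_).trans (by push_cast; ring)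
      simp only [fixedPointE₆]
      linear_combination (-26 / 7 - 127 / 7 * c - 12 / 7 * c ^ 2 + 27 / 7 * c ^ 3) * hc
    have p45 : u 4 * u 5 = 2 - c := by
      refine (hu 4 5 (2 - c) ?_).trans (by push_cast; ring)
      simp only [fixedPointE₆]
      linear_combination (6 + 7 * c + 3 * c ^ 2) * hc
    -- the determinants of the parts of the diagram up to the nodes `2`, `3`, and so on
    have t0 : branchDet x u 0 =
        x ^ 3 + (1 + c) * x ^ 2 + (1 + c) * x + 1 := by
      rw [branchDet, p02]
      ring
    have t1 : branchDet x u 1 =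
        x ^ 4 + (-4 / 7 + 4 / 7 * c + 6 / 7 * c ^ 2) * x ^ 3 + (13 / 7 + 1 / 7 * c - 2
          / 7 * c ^ 2) * x ^ 2 + (-4 / 7 + 4 / 7 * c + 6 / 7 * c ^ 2) * x + 1 := by
      rw [branchDet, p02, p13, p23]
      linear_combination (5 / 7 * x ^ 2) * hC
    have t2 : branchDet x u 2 =
        x ^ 5 + c ^ 2 * x ^ 4 + x ^ 3 + x ^ 2 + c ^ 2 * x + 1 := by
      rw [branchDet, t1, t0, p34]
      linear_combination (1 / 7 * x ^ 3 + 1 / 7 * x ^ 2) * hC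
    have t3 : branchDet x u 3 =
        x ^ 6 + (-1 + c + c ^ 2) * x ^ 5 + (3 - c ^ 2) * x ^ 4 + (-2 + c + c ^ 2) * x
          ^ 3 + (3 - c ^ 2) * x ^ 2 + (-1 + c + c ^ 2) * x + 1 := by
      rw [branchDet, t2, t1, p45]
      linear_combination (6 / 7 * x ^ 4 + (-2 / 7) * x ^ 3 + 6 / 7 * x ^ 2) * hC
    rw [det_typeE_self (u := u) (by norm_num) hE hM (k := 3) rfl, t3]
    have h2 := sum_exp_seventh
    have h3 := exp_pow_half (N := 7) (by norm_num)
    simp only [Finset.sum_range_succ, Finset.sum_range_zero] at h2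
    norm_num at h3
    have hden : ((12 : ℕ) : ℂ) + 2 = 14 := by norm_num
    simp only [exponentsE₆, hden, Multiset.insert_eq_cons, Multiset.map_cons, Multiset.prod_cons,
      Multiset.map_singleton, Multiset.prod_singleton, Nat.reduceAdd]
    set ζ := Complex.exp (2 * Real.pi * Complex.I / 14)
    -- complex conjugate roots of unity are paired
    have f1 : (x - ζ ^ 2) * (x - ζ ^ 12) = x ^ 2 - c * x + 1 := by
      linear_combination x * hcast + (ζ ^ 7 - 1) * h3
    have f2 : (x - ζ ^ 5) * (x - ζ ^ 9) = x ^ 2 + c * x + 1 := by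
      linear_combination -x * hcast - x * (ζ ^ 2 + ζ ^ 5) * h3 + (ζ ^ 7 - 1) * h3
    have f3 : (x - ζ ^ 6) * (x - ζ ^ 8) = x ^ 2 + (c ^ 2 + c - 1) * x + 1 := by
      rw [hcast]
      linear_combination -x * h2 - x * (ζ ^ 10 + 2) * (ζ ^ 7 - 1) * h3 + (ζ ^ 7 - 1) * h3
    rw [show (x - ζ ^ 2) * ((x - ζ ^ 5) * ((x - ζ ^ 6) * ((x - ζ ^ 8) * ((x - ζ ^ 9) *
      (x - ζ ^ 12))))) = ((x - ζ ^ 2) * (x - ζ ^ 12)) * ((x - ζ ^ 5) * (x - ζ ^ 9)) *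
        ((x - ζ ^ 6) * (x - ζ ^ 8)) by ring, f1, f2, f3]
    linear_combination x ^ 3 * c * hC
  · rw [det_typeE_self (u := fun _ => 1) (by norm_num) hE hM (k := 3) rfl]
    simp [branchDet]
    ring
  · have h1 : (X ^ 4 - X ^ 2 + 1 : ℂ[X]) ∣ X ^ 12 - 1 := ⟨(X ^ 2 + 1) * (X ^ 6 - 1), by ring⟩
    have h2 : (X ^ 2 + X + 1 : ℂ[X]) ∣ X ^ 12 - 1 :=
      ⟨(X - 1) * (X ^ 3 + 1) * (X ^ 6 + 1), by ring⟩
    exact ⟨2, (mul_dvd_mul h1 h2).trans (sq (X ^ 12 - 1 : ℂ[X])).symm.dvd⟩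
  · have h := Complex.isPrimitiveRoot_exp 12 (by norm_num)
    have h6 := exp_pow_half (N := 6) (by norm_num)
    have h4 := h.pow_ne_one_of_pos_of_lt (l := 4) (by norm_num) (by norm_num)
    norm_num at h6 h4
    simp only [IsRoot.def, eval_mul, eval_add, eval_sub, eval_pow, eval_X, eval_one, Nat.cast_ofNat]
    set ω := Complex.exp (2 * Real.pi * Complex.I / 12)
    have h2 : ω ^ 2 + 1 ≠ 0 := fun h => h4 (by linear_combination (ω ^ 2 - 1) * h)
    refine mul_eq_zero_of_left (mul_left_cancel₀ h2 ?_) _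
    linear_combination h6

/-- The values of the fixed point at the nodes of the diagram of type `E₇`, where `r = √5`. -/
noncomputable def fixedPointE₇ (r : ℝ) : ℕ → ℝ
  | 0 => (5 + 3 * r) / 2
  | 1 => (12 + 6 * r) / 2
  | 2 => (33 + 15 * r) / 2
  | 3 => (160 + 72 * r) / 2
  | 4 => (54 + 24 * r) / 2
  | 5 => (16 + 8 * r) / 2
  | _ => (4 + 2 * r) / 2

theorem fixedPointE₇_pos {r : ℝ} (hr : 0 < r) (i : ℕ) : 0 < fixedPointE₇ r i := by
  unfold fixedPointE₇
  split <;> positivity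

theorem diagramData_typeE₇ : DiagramData CartanMatrix.E₇ 18 exponentsE₇
    (fun i => fixedPointE₇ √5 i) ((X ^ 6 - X ^ 3 + 1) * (X + 1)) := by
  have hr : √5 ^ 2 - 5 = 0 := by rw [Real.sq_sqrt (by norm_num), sub_self]
  have hpos : 0 < √5 := by positivity
  have hcos : 2 * Real.cos (2 * Real.pi * (2 : ℕ) / (20 : ℕ)) = (1 + √5) / 2 := by
    rw [show 2 * Real.pi * (2 : ℕ) / (20 : ℕ) = Real.pi / 5 by push_cast; ring,
      Real.cos_pi_div_five]
    ring
  have hcast := exp_pow_add_exp_pow (N := 20) (a := 2) (b := 18) (by norm_num) (by norm_num)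
  rw [hcos] at hcast
  push_cast at hcast
  set r := √5
  have hE : CartanMatrix.E₇ = CartanMatrix.E₈.submatrix (Fin.castLE (by norm_num))
    (Fin.castLE (by norm_num)) := by decide
  refine ⟨fun i j => CartanMatrix.E₇_isSymm.apply j i, CartanMatrix.E₇_diag,
    fun i j h => CartanMatrix.isSimplyLaced_E₇ h, by decide, by decide, by decide,
    fun i => fixedPointE₇_pos hpos i, fun k => ?_, fun x hx M hM => ?_, fun x M hM => ?_, ?_, ?_⟩
  · fin_cases k <;> simp [Fin.prod_univ_succ, CartanMatrix.E₇, fixedPointE₇]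
    · linear_combination 9 / 4 * hr
    · linear_combination 9 * hr
    · linear_combination 9 / 4 * hr
    · linear_combination (-594 - 270 * r) * hr
    · ring
    · linear_combination 4 * hr
    · linear_combination hr
  · let u : ℕ → ℂ := fun i => ((fixedPointE₇ r i / (1 + fixedPointE₇ r i) : ℝ) : ℂ)
    have hu (i j : ℕ) := weight_mul_weight (fixedPointE₇_pos hpos i) (fixedPointE₇_pos hpos j)
    have hC : (r : ℂ) ^ 2 - 5 = 0 := by exact_mod_cast hr
    -- the products of the weights along the edges, in normal form modulo `r ^ 2 = 5`
    have p02 : u 0 * u 2 = 3 / 2 - 3 / 10 * r := by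
      refine (hu 0 2 (3 / 2 - 3 / 10 * r) ?_).trans (by push_cast; ring)
      simp only [fixedPointE₇]
      linear_combination (81 / 8 + 27 / 8 * r) * hr
    have p23 : u 2 * u 3 = 2 / 3 + 2 / 15 * r := by
      refine (hu 2 3 (2 / 3 + 2 / 15 * r) ?_).trans (by push_cast; ring)
      simp only [fixedPointE₇]
      linear_combination (-75 - 36 * r) * hr
    have p13 : u 1 * u 3 = 5 / 3 - 1 / 3 * r := by
      refine (hu 1 3 (5 / 3 - 1 / 3 * r) ?_).trans (by push_cast; ring)
      simp only [fixedPointE₇]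
      linear_combination (93 + 36 * r) * hr
    have p34 : u 3 * u 4 = 5 / 12 + 1 / 4 * r := by
      refine (hu 3 4 (5 / 12 + 1 / 4 * r) ?_).trans (by push_cast; ring)
      simp only [fixedPointE₇]
      linear_combination (-243 - 108 * r) * hr
    have p45 : u 4 * u 5 = -3 / 4 + 3 / 4 * r := by
      refine (hu 4 5 (-3 / 4 + 3 / 4 * r) ?_).trans (by push_cast; ring)
      simp only [fixedPointE₇]
      linear_combination (-81 - 36 * r) * hr
    have p56 : u 5 * u 6 = 3 - r := by
      refine (hu 5 6 (3 - r) ?_).trans (by push_cast; ring)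
      simp only [fixedPointE₇]
      linear_combination (13 + 4 * r) * hr
    -- the determinants of the parts of the diagram up to the nodes `2`, `3`, and so on
    have t0 : branchDet x u 0 =
        x ^ 3 + (3 / 2 + 3 / 10 * r) * x ^ 2 + (3 / 2 + 3 / 10 * r) * x + 1 := by
      rw [branchDet, p02]
      ring
    have t1 : branchDet x u 1 =
        x ^ 4 + (1 / 6 + 1 / 2 * r) * x ^ 3 + 4 / 3 * x ^ 2 + (1 / 6 + 1 / 2 * r) * x + 1 := by
      rw [branchDet, p02, p13, p23]
      linear_combination (1 / 10 * x ^ 2) * hC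
    have t2 : branchDet x u 2 =
        x ^ 5 + (3 / 4 + 1 / 4 * r) * x ^ 4 + 1 / 2 * x ^ 3 + 1 / 2 * x ^ 2 + (3 / 4 +
          1 / 4 * r) * x + 1 := by
      rw [branchDet, t1, t0, p34]
      linear_combination ((-3 / 40) * x ^ 3 + (-3 / 40) * x ^ 2) * hC
    have t3 : branchDet x u 3 =
        x ^ 6 + (5 / 2 - 1 / 2 * r) * x ^ 5 + (-1 / 2 + 1 / 2 * r) * x ^ 4 + (2 - r) *
          x ^ 3 + (-1 / 2 + 1 / 2 * r) * x ^ 2 + (5 / 2 - 1 / 2 * r) * x + 1 := by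
      rw [branchDet, t2, t1, p45]
      linear_combination ((-3 / 8) * x ^ 4 + (-3 / 8) * x ^ 2) * hC
    have t4 : branchDet x u 4 =
        x ^ 7 + (1 / 2 + 1 / 2 * r) * x ^ 6 + x ^ 5 + x ^ 2 + (1 / 2 + 1 / 2 * r) * x + 1 := by
      rw [branchDet, t3, t2, p56]
      linear_combination (1 / 4 * x ^ 5 + 1 / 4 * x ^ 2) * hC
    rw [det_typeE_self (u := u) (by norm_num) hE hM (k := 4) rfl, t4]
    have h3 := exp_pow_half (N := 10) (by norm_num)
    have h4 := (Complex.isPrimitiveRoot_exp 20 (by norm_num)).pow_ne_one_of_pos_of_lt (l := 4)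
      (by norm_num) (by norm_num)
    norm_num at h3 h4
    have hden : ((18 : ℕ) : ℂ) + 2 = 20 := by norm_num
    simp only [exponentsE₇, hden, Multiset.insert_eq_cons, Multiset.map_cons, Multiset.prod_cons,
      Multiset.map_singleton, Multiset.prod_singleton, Nat.reduceAdd]
    set ζ := Complex.exp (2 * Real.pi * Complex.I / 20)
    have h5 : ζ ^ 8 - ζ ^ 6 + ζ ^ 4 - ζ ^ 2 + 1 = 0 := by
      have h6 : ζ ^ 2 + 1 ≠ 0 := fun h => h4 (by linear_combination (ζ ^ 2 - 1) * h)
      refine mul_left_cancel₀ h6 ?_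
      linear_combination h3
    -- complex conjugate roots of unity are paired
    have f1 : (x - ζ ^ 2) * (x - ζ ^ 18) = x ^ 2 - (1 + r) / 2 * x + 1 := by
      linear_combination -x * hcast + (ζ ^ 10 - 1) * h3
    have f2 : (x - ζ ^ 6) * (x - ζ ^ 14) = x ^ 2 - (1 - r) / 2 * x + 1 := by
      linear_combination x * hcast + (ζ ^ 10 - 1) * h3 + x * h5 - x * (ζ ^ 8 + ζ ^ 4) * h3
    have f3 : (x - ζ ^ 8) * (x - ζ ^ 12) = x ^ 2 + (1 + r) / 2 * x + 1 := by
      linear_combination x * hcast + (ζ ^ 10 - 1) * h3 - x * (ζ ^ 8 + ζ ^ 2) * h3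
    rw [show (x - ζ ^ 2) * ((x - ζ ^ 6) * ((x - ζ ^ 8) * ((x - ζ ^ 10) * ((x - ζ ^ 12) *
      ((x - ζ ^ 14) * (x - ζ ^ 18)))))) = ((x - ζ ^ 2) * (x - ζ ^ 18)) *
        ((x - ζ ^ 6) * (x - ζ ^ 14)) * ((x - ζ ^ 8) * (x - ζ ^ 12)) * (x - ζ ^ 10) by ring,
      f1, f2, f3, h3]
    linear_combination 1 / 4 * x ^ 2 * (x ^ 2 + (1 + r) / 2 * x + 1) * (x + 1) * hC
  · rw [det_typeE_self (u := fun _ => 1) (by norm_num) hE hM (k := 4) rfl]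
    simp [branchDet]
    ring
  · have h1 : (X ^ 6 - X ^ 3 + 1 : ℂ[X]) ∣ X ^ 18 - 1 := ⟨(X ^ 3 + 1) * (X ^ 9 - 1), by ring⟩
    have h2 : (X + 1 : ℂ[X]) ∣ X ^ 18 - 1 :=
      ⟨(X - 1) * (X ^ 16 + X ^ 14 + X ^ 12 + X ^ 10 + X ^ 8 + X ^ 6 + X ^ 4 + X ^ 2 + 1), by ring⟩
    exact ⟨2, (mul_dvd_mul h1 h2).trans (sq (X ^ 18 - 1 : ℂ[X])).symm.dvd⟩
  · have h := Complex.isPrimitiveRoot_exp 18 (by norm_num)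
    have h9 := exp_pow_half (N := 9) (by norm_num)
    have h6 := h.pow_ne_one_of_pos_of_lt (l := 6) (by norm_num) (by norm_num)
    norm_num at h9 h6
    simp only [IsRoot.def, eval_mul, eval_add, eval_sub, eval_pow, eval_X, eval_one, Nat.cast_ofNat]
    set ω := Complex.exp (2 * Real.pi * Complex.I / 18)
    have h2 : ω ^ 3 + 1 ≠ 0 := fun h => h6 (by linear_combination (ω ^ 3 - 1) * h)
    refine mul_eq_zero_of_left (mul_left_cancel₀ h2 ?_) _
    linear_combination h9

/-- The values of the fixed point at the nodes of the diagram of type `E₈`, where `r = √2`. -/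
def fixedPointE₈ (r : ℝ) : ℕ → ℝ
  | 0 => 5 + 4 * r
  | 1 => 16 + 12 * r
  | 2 => 56 + 40 * r
  | 3 => 543 + 384 * r
  | 4 => 152 + 108 * r
  | 5 => 42 + 30 * r
  | 6 => 11 + 8 * r
  | _ => 2 + 2 * r

theorem fixedPointE₈_pos {r : ℝ} (hr : 0 < r) (i : ℕ) : 0 < fixedPointE₈ r i := by
  unfold fixedPointE₈
  split <;> positivity

theorem diagramData_typeE₈ : DiagramData CartanMatrix.E₈ 30 exponentsE₈
    (fun i => fixedPointE₈ √2 i) (X ^ 8 + X ^ 7 - X ^ 5 - X ^ 4 - X ^ 3 + X + 1) := by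
  have hr : √2 ^ 2 - 2 = 0 := by rw [Real.sq_sqrt (by norm_num), sub_self]
  have hpos : 0 < √2 := by positivity
  have hcos : 2 * Real.cos (2 * Real.pi * (4 : ℕ) / (32 : ℕ)) = √2 := by
    rw [show 2 * Real.pi * (4 : ℕ) / (32 : ℕ) = Real.pi / 4 by push_cast; ring,
      Real.cos_pi_div_four]
    ring
  have hcast := exp_pow_add_exp_pow (N := 32) (a := 4) (b := 28) (by norm_num) (by norm_num)
  rw [hcos] at hcast
  push_cast at hcast
  set r := √2
  refine ⟨fun i j => CartanMatrix.E₈_isSymm.apply j i, CartanMatrix.E₈_diag,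
    fun i j h => CartanMatrix.isSimplyLaced_E₈ h, by decide, by decide, by decide,
    fun i => fixedPointE₈_pos hpos i, fun k => ?_, fun x hx M hM => ?_, fun x M hM => ?_, ?_, ?_⟩
  · fin_cases k <;> simp [Fin.prod_univ_succ, CartanMatrix.E₈, fixedPointE₈]
    · linear_combination 16 * hr
    · linear_combination 144 * hr
    · linear_combination 64 * hr
    · linear_combination (-73296 - 51840 * r) * hr
    · linear_combination 144 * hr
    · linear_combination 36 * hr
    · linear_combination 4 * hr
    · linear_combination 4 * hr
  · let u : ℕ → ℂ := fun i => ((fixedPointE₈ r i / (1 + fixedPointE₈ r i) : ℝ) : ℂ)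
    have hu (i j : ℕ) := weight_mul_weight (fixedPointE₈_pos hpos i) (fixedPointE₈_pos hpos j)
    have hC : (r : ℂ) ^ 2 - 2 = 0 := by exact_mod_cast hr
    -- the products of the weights along the edges, in normal form modulo `r ^ 2 = 2`
    have p02 : u 0 * u 2 = 12 / 7 - 4 / 7 * r := by
      refine (hu 0 2 (12 / 7 - 4 / 7 * r) ?_).trans (by push_cast; ring)
      simp only [fixedPointE₈]
      linear_combination (1072 / 7 + 640 / 7 * r) * hr
    have p23 : u 2 * u 3 = 15 / 28 + 9 / 28 * r := by
      refine (hu 2 3 (15 / 28 + 9 / 28 * r) ?_).trans (by push_cast; ring)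
      simp only [fixedPointE₈]
      linear_combination (-48288 / 7 - 34560 / 7 * r) * hr
    have p13 : u 1 * u 3 = 3 / 2 - 3 / 8 * r := by
      refine (hu 1 3 (3 / 2 - 3 / 8 * r) ?_).trans (by push_cast; ring)
      simp only [fixedPointE₈]
      linear_combination (2592 + 1728 * r) * hr
    have p34 : u 3 * u 4 = 7 / 12 + 7 / 24 * r := by
      refine (hu 3 4 (7 / 12 + 7 / 24 * r) ?_).trans (by push_cast; ring)
      simp only [fixedPointE₈]
      linear_combination (-16992 - 12096 * r) * hr
    have p45 : u 4 * u 5 = 32 / 21 - 8 / 21 * r := by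
      refine (hu 4 5 (32 / 21 - 8 / 21 * r) ?_).trans (by push_cast; ring)
      simp only [fixedPointE₈]
      linear_combination (12744 / 7 + 8640 / 7 * r) * hr
    have p56 : u 5 * u 6 = 9 / 14 + 3 / 14 * r := by
      refine (hu 5 6 (9 / 14 + 3 / 14 * r) ?_).trans (by push_cast; ring)
      simp only [fixedPointE₈]
      linear_combination (-456 / 7 - 360 / 7 * r) * hr
    have p67 : u 6 * u 7 = 3 / 2 - 1 / 2 * r := by
      refine (hu 6 7 (3 / 2 - 1 / 2 * r) ?_).trans (by push_cast; ring)
      simp only [fixedPointE₈]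
      linear_combination (16 + 8 * r) * hr
    -- the determinants of the parts of the diagram up to the nodes `2`, `3`, and so on
    have t0 : branchDet x u 0 =
        x ^ 3 + (9 / 7 + 4 / 7 * r) * x ^ 2 + (9 / 7 + 4 / 7 * r) * x + 1 := by
      rw [branchDet, p02]
      ring
    have t1 : branchDet x u 1 =
        x ^ 4 + (1 / 4 + 5 / 8 * r) * x ^ 3 + (3 / 2 - 1 / 4 * r) * x ^ 2 + (1 / 4 + 5
          / 8 * r) * x + 1 := by
      rw [branchDet, p02, p13, p23]
      linear_combination (3 / 14 * x ^ 2) * hC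
    have t2 : branchDet x u 2 =
        x ^ 5 + (2 / 3 + 1 / 3 * r) * x ^ 4 + (2 / 3 - 1 / 3 * r) * x ^ 3 + (2 / 3 - 1
          / 3 * r) * x ^ 2 + (2 / 3 + 1 / 3 * r) * x + 1 := by
      rw [branchDet, t1, t0, p34]
      linear_combination ((-1 / 6) * x ^ 3 + (-1 / 6) * x ^ 2) * hC
    have t3 : branchDet x u 3 =
        x ^ 6 + (1 / 7 + 5 / 7 * r) * x ^ 5 + (10 / 7 - 6 / 7 * r) * x ^ 4 + (-8 / 7 +
          2 / 7 * r) * x ^ 3 + (10 / 7 - 6 / 7 * r) * x ^ 2 + (1 / 7 + 5 / 7 * r) * x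
          + 1 := by
      rw [branchDet, t2, t1, p45]
      linear_combination (5 / 21 * x ^ 4 + (-2 / 21) * x ^ 3 + 5 / 21 * x ^ 2) * hC
    have t4 : branchDet x u 4 =
        x ^ 7 + (1 / 2 + 1 / 2 * r) * x ^ 6 + (1 - 1 / 2 * r) * x ^ 5 + (-1 / 2 * r) *
          x ^ 4 + (-1 / 2 * r) * x ^ 3 + (1 - 1 / 2 * r) * x ^ 2 + (1 / 2 + 1 / 2 * r)
          * x + 1 := by
      rw [branchDet, t3, t2, p56]
      linear_combination ((-1 / 14) * x ^ 5 + 1 / 14 * x ^ 4 + 1 / 14 * x ^ 3 + (-1 /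
        14) * x ^ 2) * hC
    have t5 : branchDet x u 5 =
        x ^ 8 + r * x ^ 7 + (2 - r) * x ^ 6 + (-2 + r) * x ^ 5 + (2 - 2 * r) * x ^ 4 +
          (-2 + r) * x ^ 3 + (2 - r) * x ^ 2 + r * x + 1 := by
      rw [branchDet, t4, t3, p67]
      linear_combination (5 / 14 * x ^ 6 + (-3 / 7) * x ^ 5 + 1 / 7 * x ^ 4 + (-3 / 7) *
        x ^ 3 + 5 / 14 * x ^ 2) * hC
    rw [det_typeE_self (u := u) le_rfl rfl hM (k := 5) rfl, t5]
    have h3 := exp_pow_half (N := 16) (by norm_num)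
    norm_num at h3
    have hden : ((30 : ℕ) : ℂ) + 2 = 32 := by norm_num
    simp only [exponentsE₈, hden, Multiset.insert_eq_cons, Multiset.map_cons, Multiset.prod_cons,
      Multiset.map_singleton, Multiset.prod_singleton, Nat.reduceAdd]
    set ζ := Complex.exp (2 * Real.pi * Complex.I / 32)
    -- the primitive 16th roots of unity among them are paired as `±ζ ^ 2` and `±ζ ^ 14`, the
    -- others with their complex conjugates
    have f1 : (x - ζ ^ 2) * (x - ζ ^ 18) = x ^ 2 - ζ ^ 4 := by
      linear_combination (ζ ^ 4 - x * ζ ^ 2) * h3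
    have f2 : (x - ζ ^ 14) * (x - ζ ^ 30) = x ^ 2 - ζ ^ 28 := by
      linear_combination (ζ ^ 28 - x * ζ ^ 14) * h3
    have f3 : (x - ζ ^ 8) * (x - ζ ^ 24) = x ^ 2 + 1 := by
      linear_combination (ζ ^ 16 - 1 - x * ζ ^ 8) * h3
    have f4 : (x - ζ ^ 12) * (x - ζ ^ 20) = x ^ 2 + r * x + 1 := by
      linear_combination x * hcast + (ζ ^ 16 - 1) * h3 - x * (ζ ^ 12 + ζ ^ 4) * h3
    have f5 : (x ^ 2 - ζ ^ 4) * (x ^ 2 - ζ ^ 28) = x ^ 4 - r * x ^ 2 + 1 := by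
      linear_combination -x ^ 2 * hcast + (ζ ^ 16 - 1) * h3
    rw [show (x - ζ ^ 2) * ((x - ζ ^ 8) * ((x - ζ ^ 12) * ((x - ζ ^ 14) * ((x - ζ ^ 18) *
      ((x - ζ ^ 20) * ((x - ζ ^ 24) * (x - ζ ^ 30))))))) =
        ((x - ζ ^ 2) * (x - ζ ^ 18)) * ((x - ζ ^ 14) * (x - ζ ^ 30)) *
        ((x - ζ ^ 8) * (x - ζ ^ 24)) * ((x - ζ ^ 12) * (x - ζ ^ 20)) by ring,
      f1, f2, f3, f4, f5]
    linear_combination (x ^ 5 + x ^ 3) * hC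
  · rw [det_typeE_self (u := fun _ => 1) le_rfl rfl hM (k := 5) rfl]
    simp [branchDet]
    ring
  · exact ⟨1, (X ^ 15 - 1) * (X ^ 7 - X ^ 6 + X ^ 5 + X ^ 2 - X + 1), by ring⟩
  · have h := Complex.isPrimitiveRoot_exp 30 (by norm_num)
    have h15 := exp_pow_half (N := 15) (by norm_num)
    have h6 := h.pow_ne_one_of_pos_of_lt (l := 6) (by norm_num) (by norm_num)
    have h10 := h.pow_ne_one_of_pos_of_lt (l := 10) (by norm_num) (by norm_num)
    norm_num at h15 h6 h10
    simp only [IsRoot.def, eval_add, eval_sub, eval_pow, eval_X, eval_one, Nat.cast_ofNat]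
    set ω := Complex.exp (2 * Real.pi * Complex.I / 30)
    have h3 : ω ^ 3 + 1 ≠ 0 := fun h => h6 (by linear_combination (ω ^ 3 - 1) * h)
    have h5 : ω ^ 5 + 1 ≠ 0 := fun h => h10 (by linear_combination (ω ^ 5 - 1) * h)
    refine mul_left_cancel₀ (mul_ne_zero h3 h5) ?_
    linear_combination (ω + 1) * h15

end TypeE

end ClusterX

theorem mainTheorem5 {ι M N : Type*} [Fintype ι] [AddCommGroup M] [Module ℝ M]
    [AddCommGroup N] [Module ℝ N] (P : RootPairing ι ℝ M N) [P.IsRootSystem]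
    [P.IsCrystallographic] [P.IsReduced] (b : P.Base)
    (hADE : ClusterX.IsTypeADE b.cartanMatrix) {n : ℕ} (e : Fin n ≃ b.support)
    (b' : P.Base) (h : ℕ) (hh : h = ClusterX.coxeterNumber b e)
    (ζ : ℂ) (hζ : ζ = Complex.exp (2 * Real.pi * Complex.I / ((h : ℂ) + 2))) :
    ∃ hred : ClusterX.IsReddeningTriple (ClusterX.initialMatrix b e) (List.finRange n) 1,
      (∃! p, ClusterX.DTX hred p = p) ∧
      ∀ p, ClusterX.DTX hred p = p → ∀ t : List (Fin n),
        ∃ L : (Fin n → ℝ) →L[ℝ] (Fin n → ℝ),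
          ClusterX.IsLinearizationAt (ClusterX.DTX hred) p t L ∧
          (((Polynomial.X ^ (h + 2) - 1) / (Polynomial.X - 1) : Polynomial ℂ)) ^ n =
            (LinearMap.charpoly (L : (Fin n → ℝ) →ₗ[ℝ] (Fin n → ℝ))).map (algebraMap ℝ ℂ) *
              ∏ i : ι, (Polynomial.X - Polynomial.C (ζ ^ b'.height i)) := by
  rcases hADE with ⟨m, hm, f, hf⟩ | ⟨m, hm, f, hf⟩ | ⟨f, hf⟩ | ⟨f, hf⟩ | ⟨f, hf⟩
  · exact ClusterX.mizuno_of_diagramData P b e b' (ClusterX.diagramData_typeA hm) f hf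
      (ClusterX.prod_height_typeA b f hf) h hh ζ hζ
  · exact ClusterX.mizuno_of_diagramData P b e b' (ClusterX.diagramData_typeD hm) f hf
      (ClusterX.prod_height_typeD b hm f hf) h hh ζ hζ
  · exact ClusterX.mizuno_of_diagramData P b e b' ClusterX.diagramData_typeE₆ f hf
      (ClusterX.isRootList_rootsE₆.prod_height ClusterX.heights_rootsE₆ b f hf) h hh ζ hζ
  · exact ClusterX.mizuno_of_diagramData P b e b' ClusterX.diagramData_typeE₇ f hf
      (ClusterX.isRootList_rootsE₇.prod_height ClusterX.heights_rootsE₇ b f hf) h hh ζ hζ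
  · exact ClusterX.mizuno_of_diagramData P b e b' ClusterX.diagramData_typeE₈ f hf
      (ClusterX.isRootList_rootsE₈.prod_height ClusterX.heights_rootsE₈ b f hf) h hh ζ hζ
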